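/- A clustering of a set $V$ of $n$ points is a partition of $V$. For a fairness constraint $\mathcal P$ (an arbitrary predicate on subsets of $V$), a clustering is *fair* if each of its clusters satisfies $\mathcal P$. Let $\mathrm{dist}(\mathcal C,\mathcal D)$ be the number of unordered pairs of points that are together in exactly one of $\mathcal C,\mathcal D$. A fair clustering $\mathcal N$ is *$\gamma$-close* to a clustering $\mathcal D$ if $\mathrm{dist}(\mathcal D,\mathcal N)\le\gamma\,\mathrm{dist}(\mathcal D,\mathcal N^*)$ for a fair clustering $\mathcal N^*$ closest to $\mathcal D$. An *$\eta$-approximate fair correlation clustering* of a complete graph on $V$ with edges labelled $+$ or $-$ is a fair clustering whose cost (number of $+$ pairs separated plus number of $-$ pairs together) is at most $\eta$ times the minimum cost of a fair clustering. A *$(\rho,1)$-approximate fair consensus clustering* of $\mathcal C_1,\dots,\mathcal C_m$ is a fair clustering $\mathcal F$ for which $\sum_i \mathrm{dist}(\mathcal C_i,\mathcal F)$ is at most $\rho$ times the minimum of this sum over fair clusterings. In the *generalized insertion-only stream*, the input clusterings arrive as triples $((u,v),j,b)$, in arbitrary order, where $b\in\{0,1\}$ says whether $u,v$ are together ($b=0$)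 or separated ($b=1$) in $\mathcal C_j$; for each $j$ all pairs of points occur. **Lemma.** Let $\gamma,\eta,\alpha>0$, $0<\beta<1$, $c>1$, $s>1$ and $g>s$ be fixed with $sc-s-2c>0$. Suppose that there is a subroutine that computes a $\gamma$-close fair clustering to any given clustering of $n$ points in time $t_1(n)$, and a subroutine that computes an $\eta$-approximate fair correlation clustering of any labelled complete graph on $n$ vertices in time $t_2(n)$. Then there is a randomized one-pass streaming algorithm, using these subroutines as black boxes, which for all $n\ge1$, $m\ge2$, $\varepsilon\in(0,1)$ and any $m$ clusterings of $n$ points given by a generalized insertion-only stream outputs, with probability at least $1-\frac1m$, a $\left(\frac{1+\varepsilon}{1-\varepsilon}\,r,\,1\right)$-approximate fair consensus clustering, where \begin{align*} r=\max\Bigl\{&\gamma+2-(\gamma+1)\beta,\quad \gamma+2+(\gamma+1)\tfrac{\beta(g-s)+s}{g(s-1)}-\tfrac{2\alpha}{c},\\ &\gamma+2+(\gamma+1)\tfrac{\beta(g(2c+s)-sc)+sc}{g(cs-s-2c)}-2\bigl(1-\tfrac1s-\tfrac1c\bigr)\alpha,\quad 1+3(\eta+1)\alpha\Bigr\}. \end{align*}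 On a word RAM with words of $O(\log(n+m+1/\varepsilon))$ bits, which is given $n$, $m$ and $\lceil 1/\varepsilon\rceil$, the algorithm uses $O(\varepsilon^{-2}n\log m)$ words of space (the subroutines' argument tape, own work space and the output tape not counted), and its running time outside the pass over the stream is $$O\bigl(\varepsilon^{-2}n^2\log^4m+t_1(n)\log m+t_2(n)\log^3m\bigr);$$ each triple of the stream is processed in time $O(\varepsilon^{-2}\log m)$. The $O$-constants and the algorithm depend only on $\gamma,\eta,\alpha,\beta,c,s,g$. In particular, for fixed $\varepsilon$ the space is $O(n\log m)$ and the running time is $O(n^2\log^4m+t_1(n)\log m+t_2(n)\log^3m)$. -/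

import Mathlib

open MeasureTheory

/-! ### Clusterings

A clustering of the `n` points `0, …, n-1` is an equivalence relation; its clusters are the
equivalence classes.  A fairness constraint is an arbitrary predicate on clusters. -/

namespace FairConsensus

abbrev Clustering (n : ℕ) : Type := Setoid (Fin n)

/-- A clustering is fair if each of its clusters satisfies the constraint `P`. -/
def IsFair {n : ℕ} (P : Set (Fin n) → Prop) (C : Clustering n) : Prop :=
  ∀ F ∈ C.classes, P F

open Classical in
/-- The number of unordered pairs of points that are together in exactly one of `C`, `D`. -/
noncomputable def dist {n : ℕ} (C D : Clustering n) : ℕ :=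
  (Finset.univ.filter fun p : Fin n × Fin n =>
    p.1 < p.2 ∧ ¬ (C.r p.1 p.2 ↔ D.r p.1 p.2)).card

/-- `N` is a closest fair clustering to `D`. -/
def IsClosestFair {n : ℕ} (P : Set (Fin n) → Prop) (D N : Clustering n) : Prop :=
  IsFair P N ∧ ∀ N' : Clustering n, IsFair P N' → dist D N ≤ dist D N'

/-- `N` is a `γ`-close fair clustering to `D`. -/
def IsCloseFair {n : ℕ} (P : Set (Fin n) → Prop) (γ : ℝ) (D N : Clustering n) : Prop :=
  IsFair P N ∧ ∀ N' : Clustering n, IsClosestFair P D N' → (dist D N : ℝ) ≤ γ * dist D N'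

open Classical in
/-- The correlation cost of `C` on the complete signed graph whose `+` edges are the edges of `G`
and whose `-` edges are the other pairs of distinct vertices. -/
noncomputable def corCost {n : ℕ} (G : SimpleGraph (Fin n)) (C : Clustering n) : ℕ :=
  (Finset.univ.filter fun p : Fin n × Fin n =>
    p.1 < p.2 ∧ ¬ (G.Adj p.1 p.2 ↔ C.r p.1 p.2)).card

/-- `C` is an optimal fair correlation clustering of `G`. -/
def IsOptFairCor {n : ℕ} (P : Set (Fin n) → Prop) (G : SimpleGraph (Fin n))
    (C : Clustering n) : Prop :=
  IsFair P C ∧ ∀ D : Clustering n, IsFair P D → corCost G C ≤ corCost G D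

/-- `C` is an `η`-approximate fair correlation clustering of `G`. -/
def IsApproxFairCor {n : ℕ} (P : Set (Fin n) → Prop) (η : ℝ) (G : SimpleGraph (Fin n))
    (C : Clustering n) : Prop :=
  IsFair P C ∧ ∀ D : Clustering n, IsOptFairCor P G D → (corCost G C : ℝ) ≤ η * corCost G D

/-- The median objective. -/
noncomputable def obj {n m : ℕ} (I : Fin m → Clustering n) (C : Clustering n) : ℕ :=
  ∑ i, dist (I i) C

/-- `C` is an optimal fair consensus clustering of `I`. -/
def IsOptConsensus {n m : ℕ} (P : Set (Fin n) → Prop) (I : Fin m → Clustering n)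
    (C : Clustering n) : Prop :=
  IsFair P C ∧ ∀ D : Clustering n, IsFair P D → obj I C ≤ obj I D

/-- `C` is a `(ρ, 1)`-approximate fair consensus clustering of `I`. -/
def IsApproxConsensus {n m : ℕ} (P : Set (Fin n) → Prop) (ρ : ℝ) (I : Fin m → Clustering n)
    (C : Clustering n) : Prop :=
  IsFair P C ∧ ∀ D : Clustering n, IsOptConsensus P I D → (obj I C : ℝ) ≤ ρ * obj I D

/-! ### Generalized insertion-only streams -/

/-- A triple `((u, v), j, b)`: `sep = false` (`b = 0`) says that `u` and `v` are together in the
`j`-th clustering, `sep = true` (`b = 1`) that they are separated. -/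
structure Triple (n m : ℕ) where
  u : Fin n
  v : Fin n
  j : Fin m
  sep : Bool

/-- `l` is a generalized insertion-only stream for the clusterings `I`: every triple is correct,
and for each clustering every pair of distinct points occurs, in at least one of its two
orientations.  The order is arbitrary; the stream may list each unordered pair once, or all `n²`
ordered pairs. -/
def IsStream {n m : ℕ} (I : Fin m → Clustering n) (l : List (Triple n m)) : Prop :=
  (∀ x ∈ l, x.sep = false ↔ (I x.j).r x.u x.v) ∧
  ∀ (j : Fin m) (u v : Fin n), u ≠ v →
    ∃ x ∈ l, x.j = j ∧ ((x.u = u ∧ x.v = v) ∨ (x.u = v ∧ x.v = u))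

/-! ### The machine model

A randomized word RAM with structured control flow and with two subroutines that are called as
black boxes.  Every elementary instruction costs one time unit.  Space is the number of memory
words used (one plus the largest address written); arguments for a subroutine are written on a
write-only tape, results are delivered into the memory.  The fields `time`, `space` and `top` of a
state are counters that a program cannot read. -/

/-- The random source: entry `(i, b)` is used if the `i`-th random draw of a run asks for a uniform
element of `{0, …, b}`. -/
abbrev Coins : Type := (p : ℕ × ℕ) → Fin (p.2 + 1)

/-- All entries of the random source are independent and uniform. -/
noncomputable def coinMeasure : Measure Coins :=
  Measure.infinitePi fun p : ℕ × ℕ => (PMF.uniformOfFintype (Fin (p.2 + 1))).toMeasure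

/-- A subroutine: its answer and its running time on each argument. -/
structure Subroutine where
  answer : List ℕ → List ℕ
  cost : List ℕ → ℕ

/-- What a program is run with: the random source, a subroutine for closest fair clustering, and
one for fair correlation clustering. -/
structure Env where
  coins : Coins
  cls : Subroutine
  cor : Subroutine

structure State where
  /-- memory: address to word -/
  mem : ℕ → ℕ
  /-- the argument tape -/
  arg : List ℕ
  /-- the output tape -/
  out : List ℕ
  /-- number of random draws so far -/
  draws : ℕ
  /-- time used so far -/
  time : ℕ
  /-- one plus the largest address written so far -/
  space : ℕ
  /-- the largest word written so far -/
  top : ℕ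

namespace State

def empty : State := ⟨fun _ => 0, [], [], 0, 0, 0, 0⟩

/-- Spend `k` time units. -/
def spend (k : ℕ) (σ : State) : State := { σ with time := σ.time + k }

/-- Write the word `x` at address `a`. -/
def put (a x : ℕ) (σ : State) : State :=
  { σ with
    mem := Function.update σ.mem a x
    space := max σ.space (a + 1)
    top := max σ.top x }

/-- Write a list of words at consecutive addresses, starting from `a`. -/
def putList : ℕ → List ℕ → State → State
  | _, [], σ => σ
  | a, x :: xs, σ => putList (a + 1) xs (σ.put a x)

/-- Call a subroutine on the argument tape, clear the tape, and store the answer from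
address `a` on.  Writing the answer is charged as well. -/
def call (S : Subroutine) (a : ℕ) (σ : State) : State :=
  (putList a (S.answer σ.arg) { σ with arg := [] }).spend
    (1 + S.cost σ.arg + (S.answer σ.arg).length)

end State

inductive Op where
  | add | sub | mul | div | mod

def Op.eval : Op → ℕ → ℕ → ℕ
  | add, x, y => x + y
  | sub, x, y => x - y
  | mul, x, y => x * y
  | div, x, y => x / y
  | mod, x, y => x % y

/-- Programs. `M` stands for the memory; the arguments `d`, `a`, `b` are fixed addresses. -/
inductive Prog where
  /-- `M[d] := k` -/
  | const (d k : ℕ)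
  /-- `M[d] := M[a] ∘ M[b]` -/
  | op (o : Op) (d a b : ℕ)
  /-- `M[d] :=` the length of the binary expansion of `M[a]` -/
  | size (d a : ℕ)
  /-- `M[d] := M[M[a]]` -/
  | load (d a : ℕ)
  /-- `M[M[a]] := M[b]` -/
  | store (a b : ℕ)
  /-- `M[d] :=` a uniformly random element of `{0, …, M[a] - 1}` -/
  | rand (d a : ℕ)
  /-- append `M[a]` to the argument tape -/
  | push (a : ℕ)
  /-- call the closest fair clustering subroutine, answer stored from address `M[a]` on -/
  | callCls (a : ℕ)
  /-- call the fair correlation clustering subroutine, answer stored from address `M[a]` on -/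
  | callCor (a : ℕ)
  /-- append `M[a]` to the output tape -/
  | emit (a : ℕ)
  | skip
  | seq (p q : Prog)
  /-- run `p` if `M[a] = 0`, and `q` otherwise -/
  | ifZero (a : ℕ) (p q : Prog)
  /-- run `p` as often as `M[a]` says at the start of the loop -/
  | loop (a : ℕ) (p : Prog)

/-- The state after running a program. -/
def Prog.run (E : Env) : Prog → State → State
  | const d k, σ => (σ.put d k).spend 1
  | op o d a b, σ => (σ.put d (o.eval (σ.mem a) (σ.mem b))).spend 1
  | size d a, σ => (σ.put d (Nat.size (σ.mem a))).spend 1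
  | load d a, σ => (σ.put d (σ.mem (σ.mem a))).spend 1
  | store a b, σ => (σ.put (σ.mem a) (σ.mem b)).spend 1
  | rand d a, σ =>
      { (σ.put d (E.coins (σ.draws, σ.mem a - 1) : ℕ)).spend 1 with draws := σ.draws + 1 }
  | push a, σ => { σ.spend 1 with arg := σ.arg ++ [σ.mem a] }
  | callCls a, σ => σ.call E.cls (σ.mem a)
  | callCor a, σ => σ.call E.cor (σ.mem a)
  | emit a, σ => { σ.spend 1 with out := σ.out ++ [σ.mem a] }
  | skip, σ => σ.spend 1
  | seq p q, σ => q.run E (p.run E σ)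
  | ifZero a p q, σ => if σ.mem a = 0 then p.run E (σ.spend 1) else q.run E (σ.spend 1)
  | loop a p, σ => (fun τ => (p.run E τ).spend 1)^[σ.mem a] (σ.spend 1)

/-- A one-pass streaming algorithm: a program run before the stream, a program run on each
arriving triple, and a program run after the stream. -/
structure StreamAlg where
  init : Prog
  update : Prog
  query : Prog

namespace StreamAlg

/-- The state after the initialization.  The words `n`, `m`, `e` are given in the cells 0, 1, 2. -/
def start (A : StreamAlg) (E : Env) (n m e : ℕ) : State :=
  A.init.run E (((State.empty.put 0 n).put 1 m).put 2 e)

/-- Processing one triple; it is delivered in the cells 3, 4, 5, 6. -/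
def step {n m : ℕ} (A : StreamAlg) (E : Env) (σ : State) (x : Triple n m) : State :=
  A.update.run E
    ((((σ.put 3 x.u).put 4 x.v).put 5 x.j).put 6 (if x.sep then 1 else 0))

/-- The state after the initialization and the triples of `l`. -/
def after {n m : ℕ} (A : StreamAlg) (E : Env) (e : ℕ) (l : List (Triple n m)) : State :=
  l.foldl (A.step E) (A.start E n m e)

/-- The state at the end. -/
def final {n m : ℕ} (A : StreamAlg) (E : Env) (e : ℕ) (l : List (Triple n m)) : State :=
  A.query.run E (A.after E e l)

end StreamAlg

/-! ### Encodings -/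

/-- The list `L` of `n` labels smaller than `n` represents `C`: two points are together if and only
if they have the same label. -/
def Represents {n : ℕ} (L : List ℕ) (C : Clustering n) : Prop :=
  L.length = n ∧ (∀ x ∈ L, x < n) ∧ ∀ u v : Fin n, C.r u v ↔ L.getD u 0 = L.getD v 0

open Classical in
/-- The adjacency matrix of `G`, row by row. -/
noncomputable def matrixWord {n : ℕ} (G : SimpleGraph (Fin n)) : List ℕ :=
  (List.finRange n).flatMap fun u => (List.finRange n).map fun v => if G.Adj u v then 1 else 0

/-- `S` computes, in time at most `t`, a `γ`-close fair clustering to each clustering of `n`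
points. -/
def SolvesClosestFair {n : ℕ} (P : Set (Fin n) → Prop) (γ : ℝ) (t : ℕ) (S : Subroutine) : Prop :=
  ∀ (D : Clustering n) (L : List ℕ), Represents L D →
    S.cost L ≤ t ∧ ∃ N : Clustering n, Represents (S.answer L) N ∧ IsCloseFair P γ D N

/-- `S` computes, in time at most `t`, an `η`-approximate fair correlation clustering of each
complete signed graph on `n` vertices. -/
def SolvesFairCor {n : ℕ} (P : Set (Fin n) → Prop) (η : ℝ) (t : ℕ) (S : Subroutine) : Prop :=
  ∀ G : SimpleGraph (Fin n),
    S.cost (matrixWord G) ≤ t ∧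
      ∃ C : Clustering n, Represents (S.answer (matrixWord G)) C ∧ IsApproxFairCor P η G C

/-- The ratio of the main result. -/
noncomputable def ratio (γ η α β c s g : ℝ) : ℝ :=
  max (max (γ + 2 - (γ + 1) * β)
        (γ + 2 + (γ + 1) * ((β * (g - s) + s) / (g * (s - 1))) - 2 * α / c))
    (max (γ + 2 + (γ + 1) * ((β * (g * (2 * c + s) - s * c) + s * c) / (g * (c * s - s - 2 * c)))
          - 2 * (1 - 1 / s - 1 / c) * α)
      (1 + 3 * (η + 1) * α))

end FairConsensus

/-!
The algorithm samples `O(ε⁻² log m)` of the input clusterings with replacement; the first `O(log m)`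
of them are the seeds.  It recovers each sampled clustering from the stream by lowering the label of
every point to the least point of its cluster.  The candidates are a close fair clustering to every
seed and a fair correlation clustering of the majority graph of every triple of seeds; the output is
the candidate that is cheapest on the sample.

Let `N` be an optimal fair clustering.  A close fair clustering to an input is good if the input is
much closer to `N` than the average input is, or if it is not much further away and shares many of
its disagreements with `N` with many other inputs.  If only a small fraction of the inputs yield
a good candidate in this way, then, by averaging, many inputs are not much further away than average
and hence share few disagreements with most others.  Three inputs that pairwise share few
disagreements have a majority graph close to `N`, so a fair correlation clustering of it is good.

In both cases the seeds only have to meet every member of a family of `O(m²)` index sets, each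
containing a constant fraction of the inputs.  The difference of the distances of an input to two
candidates is at most the distance of the candidates, so by Hoeffding's inequality comparing two
costs on the sample is right up to a factor `1 + O(ε)`.  By union bounds, the second one over all
clusterings that can become candidates, each of the two fails with probability at most `1 / m²`.
-/

namespace FairConsensus

/-! ### Distances and costs -/

section Combinatorics

open scoped symmDiff

section Counting

variable {α : Type*} [DecidableEq α]

theorem card_symmDiff_le (A B C : Finset α) : (A ∆ C).card ≤ (A ∆ B).card + (B ∆ C).card :=
  (Finset.card_le_card (symmDiff_triangle A B C)).trans (Finset.card_union_le _ _)

theorem card_symmDiff_add_two_mul_card_inter (A B : Finset α) :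
    (A ∆ B).card + 2 * (A ∩ B).card = A.card + B.card := by
  have hdisj : Disjoint (A \ B) (B \ A) := disjoint_sdiff_sdiff
  have hsplit : (A ∆ B).card = (A \ B).card + (B \ A).card :=
    Finset.card_union_of_disjoint hdisj
  have hA := Finset.card_sdiff_add_card_inter A B
  have hB := Finset.card_sdiff_add_card_inter B A
  rw [Finset.inter_comm] at hB
  omega

theorem cast_card_sub_le_card_sdiff (A B : Finset α) :
    (A.card : ℝ) - B.card ≤ (A \ B).card := by
  have : (A.card : ℝ) ≤ (A \ B).card + B.card := by
    exact_mod_cast Finset.card_le_card_sdiff_add_card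
  linarith

end Counting

variable {n m : ℕ} {P : Set (Fin n) → Prop}

open Classical in
/-- The pairs `u < v` that are related by `r`: the pairs that are together in a clustering, or the
edges of a graph. Distances and correlation costs count symmetric differences of such sets. -/
noncomputable def relatedPairs (r : Fin n → Fin n → Prop) : Finset (Fin n × Fin n) :=
  Finset.univ.filter fun p => p.1 < p.2 ∧ r p.1 p.2

theorem mem_symmDiff_relatedPairs {r r' : Fin n → Fin n → Prop} {p : Fin n × Fin n} :
    p ∈ relatedPairs r ∆ relatedPairs r' ↔ p.1 < p.2 ∧ ¬ (r p.1 p.2 ↔ r' p.1 p.2) := by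
  classical
  simp only [relatedPairs, Finset.mem_symmDiff, Finset.mem_filter, Finset.mem_univ, true_and]
  tauto

theorem dist_eq_card_symmDiff (C D : Clustering n) :
    dist C D = (relatedPairs C.r ∆ relatedPairs D.r).card := by
  classical
  refine congrArg Finset.card (Finset.ext fun p => ?_)
  rw [mem_symmDiff_relatedPairs, Finset.mem_filter_univ]

theorem corCost_eq_card_symmDiff (G : SimpleGraph (Fin n)) (C : Clustering n) :
    corCost G C = (relatedPairs G.Adj ∆ relatedPairs C.r).card := by
  classical
  refine congrArg Finset.card (Finset.ext fun p => ?_)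
  rw [mem_symmDiff_relatedPairs, Finset.mem_filter_univ]

theorem dist_comm (C D : Clustering n) : dist C D = dist D C := by
  classical
  rw [dist_eq_card_symmDiff, dist_eq_card_symmDiff, symmDiff_comm]

theorem dist_triangle (C D F : Clustering n) : dist C F ≤ dist C D + dist D F := by
  classical
  simpa only [dist_eq_card_symmDiff] using card_symmDiff_le _ _ _

theorem dist_le_corCost_add_corCost (G : SimpleGraph (Fin n)) (C D : Clustering n) :
    dist C D ≤ corCost G C + corCost G D := by
  classical
  simpa only [dist_eq_card_symmDiff, corCost_eq_card_symmDiff, symmDiff_comm (relatedPairs G.Adj)]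
    using card_symmDiff_le (relatedPairs C.r) (relatedPairs G.Adj) (relatedPairs D.r)

open Classical in
/-- The number of pairs on which both `C` and `D` disagree with `N`. -/
noncomputable def overlap (N C D : Clustering n) : ℕ :=
  (relatedPairs C.r ∆ relatedPairs N.r ∩ (relatedPairs D.r ∆ relatedPairs N.r)).card

theorem dist_add_two_mul_overlap (N C D : Clustering n) :
    dist C D + 2 * overlap N C D = dist C N + dist D N := by
  classical
  have hcancel : (relatedPairs C.r ∆ relatedPairs N.r) ∆ (relatedPairs D.r ∆ relatedPairs N.r) =
      relatedPairs C.r ∆ relatedPairs D.r := by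
    rw [symmDiff_symmDiff_symmDiff_comm, symmDiff_self, symmDiff_bot]
  simp only [dist_eq_card_symmDiff, overlap]
  rw [← card_symmDiff_add_two_mul_card_inter, hcancel]

/-- The graph of the pairs that are together in at least two of three clusterings. -/
def majority (A B C : Clustering n) : SimpleGraph (Fin n) where
  Adj u v := u ≠ v ∧ ((A.r u v ∧ B.r u v) ∨ (A.r u v ∧ C.r u v) ∨ (B.r u v ∧ C.r u v))
  symm := ⟨fun _ _ ⟨hne, h⟩ => ⟨hne.symm, h.imp (.imp A.symm' B.symm')
    (.imp (.imp A.symm' C.symm') (.imp B.symm' C.symm'))⟩⟩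
  loopless := ⟨fun _ h => h.1 rfl⟩

-- Where the majority disagrees with `N`, at least two of the three clusterings do.
theorem corCost_majority_le (N A B C : Clustering n) :
    corCost (majority A B C) N ≤ overlap N A B + overlap N A C + overlap N B C := by
  classical
  rw [corCost_eq_card_symmDiff]
  refine (Finset.card_le_card fun p hp => ?_).trans ((Finset.card_union_le _ _).trans
    (Nat.add_le_add_right (Finset.card_union_le _ _) _))
  obtain ⟨hlt, hdisagree⟩ := mem_symmDiff_relatedPairs.1 hp
  have hne : p.1 ≠ p.2 := hlt.ne
  simp only [Finset.mem_union, Finset.mem_inter, mem_symmDiff_relatedPairs]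
  simp only [majority] at hdisagree
  tauto

theorem IsCloseFair.dist_le {γ : ℝ} (hγ : 0 ≤ γ) {D F N : Clustering n}
    (h : IsCloseFair P γ D F) (hN : IsFair P N) : (dist D F : ℝ) ≤ γ * dist D N := by
  let N' := Function.argminOn (dist D) {C | IsFair P C} ⟨N, hN⟩
  have hN' : IsFair P N' := Function.argminOn_mem _ {C | IsFair P C} _
  have hmin : ∀ C, IsFair P C → dist D N' ≤ dist D C :=
    fun C hC => Function.argminOn_le _ {C | IsFair P C} hC
  calc (dist D F : ℝ) ≤ γ * dist D N' := h.2 N' ⟨hN', hmin⟩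
    _ ≤ γ * dist D N := by gcongr; exact hmin N hN

theorem IsApproxFairCor.corCost_le {η : ℝ} (hη : 0 ≤ η) {G : SimpleGraph (Fin n)}
    {F N : Clustering n} (h : IsApproxFairCor P η G F) (hN : IsFair P N) :
    (corCost G F : ℝ) ≤ η * corCost G N := by
  let N' := Function.argminOn (corCost G) {C | IsFair P C} ⟨N, hN⟩
  have hN' : IsFair P N' := Function.argminOn_mem _ {C | IsFair P C} _
  have hmin : ∀ C, IsFair P C → corCost G N' ≤ corCost G C :=
    fun C hC => Function.argminOn_le _ {C | IsFair P C} hC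
  calc (corCost G F : ℝ) ≤ η * corCost G N' := h.2 N' ⟨hN', hmin⟩
    _ ≤ η * corCost G N := by gcongr; exact hmin N hN

/-! ### The objective of the candidates -/

theorem obj_le_obj_add_mul_dist (I : Fin m → Clustering n) (N F : Clustering n) :
    obj I F ≤ obj I N + m * dist N F := by
  refine (Finset.sum_le_sum fun j _ => dist_triangle (I j) N F).trans_eq ?_
  simp [obj, Finset.sum_add_distrib]

theorem mul_dist_le_obj_add_obj (I : Fin m → Clustering n) (F F' : Clustering n) :
    m * dist F F' ≤ obj I F + obj I F' := by
  have htriangle : ∀ j, dist F F' ≤ dist (I j) F + dist (I j) F' := fun j => by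
    simpa only [dist_comm F (I j)] using dist_triangle F (I j) F'
  simpa [obj, Finset.sum_add_distrib] using Finset.sum_le_sum fun j (_ : j ∈ Finset.univ) =>
    htriangle j

theorem obj_le_of_isCloseFair {γ : ℝ} (hγ : 0 ≤ γ) (I : Fin m → Clustering n)
    {N F : Clustering n} (hN : IsFair P N) {i : Fin m} (h : IsCloseFair P γ (I i) F) :
    (obj I F : ℝ) ≤ obj I N + (γ + 1) * (m * dist (I i) N)
      - 2 * ∑ j, (overlap N (I i) (I j) : ℝ) := by
  have hpointwise : ∀ j, (dist (I j) F : ℝ) ≤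
      dist (I j) N + (γ + 1) * dist (I i) N - 2 * overlap N (I i) (I j) := by
    intro j
    have htriangle : (dist (I j) F : ℝ) ≤ dist (I i) (I j) + dist (I i) F := by
      exact_mod_cast dist_comm (I i) (I j) ▸ dist_triangle (I j) (I i) F
    have hoverlap : (dist (I i) (I j) : ℝ) + 2 * overlap N (I i) (I j) =
        dist (I i) N + dist (I j) N := by
      exact_mod_cast dist_add_two_mul_overlap N (I i) (I j)
    linarith [h.dist_le hγ hN]
  calc (obj I F : ℝ) = ∑ j, (dist (I j) F : ℝ) := by simp [obj]
    _ ≤ ∑ j, ((dist (I j) N : ℝ) + (γ + 1) * dist (I i) N - 2 * overlap N (I i) (I j)) :=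
        Finset.sum_le_sum fun j _ => hpointwise j
    _ = _ := by
        rw [Finset.sum_sub_distrib, Finset.sum_add_distrib, ← Finset.mul_sum]
        simp [obj, ← Finset.mul_sum]

open Classical in
/-- The indices `j` such that `I i` and `I j` share more than `t` of their disagreements
with `N`. -/
noncomputable def nearIndices (I : Fin m → Clustering n) (N : Clustering n) (t : ℝ) (i : Fin m) :
    Finset (Fin m) :=
  Finset.univ.filter fun j => t < overlap N (I i) (I j)

theorem mem_nearIndices {I : Fin m → Clustering n} {N : Clustering n} {t : ℝ} {i j : Fin m} :
    j ∈ nearIndices I N t i ↔ t < overlap N (I i) (I j) := by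
  classical
  simp [nearIndices]

theorem card_nearIndices_mul_le (I : Fin m → Clustering n) (N : Clustering n) (t : ℝ) (i : Fin m) :
    (nearIndices I N t i).card * t ≤ ∑ j, (overlap N (I i) (I j) : ℝ) :=
  calc (nearIndices I N t i).card * t = ∑ _j ∈ nearIndices I N t i, t := by simp
    _ ≤ ∑ j ∈ nearIndices I N t i, (overlap N (I i) (I j) : ℝ) :=
        Finset.sum_le_sum fun j hj => (mem_nearIndices.1 hj).le
    _ ≤ ∑ j, (overlap N (I i) (I j) : ℝ) :=
        Finset.sum_le_univ_sum_of_nonneg fun _ => Nat.cast_nonneg _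

-- Shared disagreements are saved twice, so many near clusterings make `F` cheaper.
theorem obj_le_of_isCloseFair_of_dist_le {γ α a b y : ℝ} (hγ : 0 ≤ γ) (hα : 0 ≤ α) (ha : 0 ≤ a)
    (I : Fin m → Clustering n) {N F : Clustering n} (hN : IsFair P N) (hmean : m * a = obj I N)
    {i : Fin m} (hF : IsCloseFair P γ (I i) F) (hdist : (dist (I i) N : ℝ) ≤ (1 + y) * a)
    (hnear : b * m ≤ (nearIndices I N (α * a) i).card) :
    (obj I F : ℝ) ≤ (γ + 2 + (γ + 1) * y - 2 * (b * α)) * obj I N := by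
  have hoverlap : b * m * (α * a) ≤ ∑ j, (overlap N (I i) (I j) : ℝ) :=
    (mul_le_mul_of_nonneg_right hnear (by positivity)).trans (card_nearIndices_mul_le I N _ i)
  calc (obj I F : ℝ)
      ≤ obj I N + (γ + 1) * (m * dist (I i) N) - 2 * ∑ j, (overlap N (I i) (I j) : ℝ) :=
        obj_le_of_isCloseFair hγ I hN hF
    _ ≤ obj I N + (γ + 1) * (m * ((1 + y) * a)) - 2 * (b * m * (α * a)) := by gcongr
    _ = (γ + 2 + (γ + 1) * y - 2 * (b * α)) * obj I N := by rw [← hmean]; ring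

theorem obj_le_of_isApproxFairCor_majority {η t : ℝ} (hη : 0 ≤ η) (I : Fin m → Clustering n)
    {N F : Clustering n} (hN : IsFair P N) {i j k : Fin m}
    (hF : IsApproxFairCor P η (majority (I i) (I j) (I k)) F)
    (hij : j ∉ nearIndices I N t i) (hik : k ∉ nearIndices I N t i)
    (hjk : k ∉ nearIndices I N t j) :
    (obj I F : ℝ) ≤ obj I N + m * (3 * (η + 1) * t) := by
  rw [mem_nearIndices, not_lt] at hij hik hjk
  have hmaj : (corCost (majority (I i) (I j) (I k)) N : ℝ) ≤ overlap N (I i) (I j)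
      + overlap N (I i) (I k) + overlap N (I j) (I k) := by
    exact_mod_cast corCost_majority_le N (I i) (I j) (I k)
  have hdist : (dist N F : ℝ) ≤ corCost (majority (I i) (I j) (I k)) N
      + corCost (majority (I i) (I j) (I k)) F := by
    exact_mod_cast dist_le_corCost_add_corCost _ N F
  have hcor := hF.corCost_le hη hN
  have hthree : (dist N F : ℝ) ≤ 3 * (η + 1) * t := by nlinarith
  calc (obj I F : ℝ) ≤ obj I N + m * dist N F := by
        exact_mod_cast obj_le_obj_add_mul_dist I N F
    _ ≤ obj I N + m * (3 * (η + 1) * t) := by gcongr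

/-! ### Index sets that a sample has to meet -/

section Family

variable {ι : Type*} [Fintype ι]

section TripleFamily

variable [DecidableEq ι]

/-- A family of index sets, indexed so that every set which meets all of its members contains
`i ∈ U`, `j ∈ V` and `k` with `j, k ∉ near i` and `k ∉ near j`: the member `(0, _, _)` provides `i`,
then `(1, i, _)` provides `j`, then `(2, i, j)` provides `k`. Members that are not asked for are the
whole type. -/
def tripleFamily (near : ι → Finset ι) (U V : Finset ι) : Fin 3 × ι × ι → Finset ι
  | (0, _, _) => U
  | (1, i, _) => if i ∈ U then V \ near i else Finset.univ
  | (2, i, j) => if i ∈ U ∧ j ∈ V then (near i ∪ near j)ᶜ else Finset.univ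

theorem exists_triple_of_meets [Nonempty ι] {near : ι → Finset ι} {U V : Finset ι} {X : Set ι}
    (hX : ∀ q, ∃ i ∈ X, i ∈ tripleFamily near U V q) :
    ∃ i ∈ X, ∃ j ∈ X, ∃ k ∈ X, j ∉ near i ∧ k ∉ near i ∧ k ∉ near j := by
  have i₀ : ι := Classical.arbitrary ι
  obtain ⟨i, hiX, hi⟩ := hX (0, i₀, i₀)
  replace hi : i ∈ U := hi
  obtain ⟨j, hjX, hj⟩ := hX (1, i, i₀)
  replace hj : j ∈ V ∧ j ∉ near i := by
    simpa only [tripleFamily, if_pos hi, Finset.mem_sdiff] using hj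
  obtain ⟨k, hkX, hk⟩ := hX (2, i, j)
  replace hk : k ∉ near i ∧ k ∉ near j := by
    simpa only [tripleFamily, hi, hj.1, and_self, if_true, Finset.mem_compl, Finset.mem_union,
      not_or] using hk
  exact ⟨i, hiX, j, hjX, k, hkX, hj.2, hk.1, hk.2⟩

theorem le_card_tripleFamily {near : ι → Finset ι} {U V : Finset ι} {x y z : ℝ}
    (hU : x ≤ U.card) (hV : x + y ≤ V.card) (huniv : x + y + z ≤ Fintype.card ι)
    (hy : 0 ≤ y) (hz : 0 ≤ z) (hnearU : ∀ i ∈ U, ((near i).card : ℝ) ≤ y)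
    (hnearV : ∀ j ∈ V, ((near j).card : ℝ) ≤ z) (q : Fin 3 × ι × ι) :
    x ≤ (tripleFamily near U V q).card := by
  obtain ⟨q, i, j⟩ := q
  have hall : x ≤ (Finset.univ : Finset ι).card := by rw [Finset.card_univ]; linarith
  fin_cases q
  · exact hU
  · change x ≤ ((if i ∈ U then V \ near i else Finset.univ).card : ℝ)
    split_ifs with hi
    · linarith [cast_card_sub_le_card_sdiff V (near i), hnearU i hi]
    · exact hall
  · change x ≤ ((if i ∈ U ∧ j ∈ V then (near i ∪ near j)ᶜ else Finset.univ).card : ℝ)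
    split_ifs with hij
    · have hunion : ((near i ∪ near j).card : ℝ) ≤ (near i).card + (near j).card := by
        exact_mod_cast Finset.card_union_le _ _
      have hcompl := cast_card_sub_le_card_sdiff Finset.univ (near i ∪ near j)
      rw [Finset.card_univ] at hcompl
      rw [Finset.compl_eq_univ_sdiff]
      linarith [hnearU i hij.1, hnearV j hij.2]
    · exact hall

theorem le_card_tripleFamily_sdiff {near : ι → Finset ι} {good U V : Finset ι} {c s p : ℝ}
    (hc : 0 ≤ 1 / c) (hsc : 1 / s + 1 / c ≤ 1) (hp : 2 * p ≤ 1 / s)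
    (hgood : good.card ≤ p * Fintype.card ι) (hU : 1 / s * Fintype.card ι ≤ U.card)
    (hV : (1 / c + 2 / s) * Fintype.card ι ≤ V.card)
    (hnearU : ∀ i ∈ U \ good, ((near i).card : ℝ) ≤ 1 / c * Fintype.card ι)
    (hnearV : ∀ j ∈ V \ good, ((near j).card : ℝ) ≤ (1 - 1 / s - 1 / c) * Fintype.card ι)
    (q : Fin 3 × ι × ι) :
    p * Fintype.card ι ≤ (tripleFamily near (U \ good) (V \ good) q).card := by
  have hM : (0 : ℝ) ≤ Fintype.card ι := Nat.cast_nonneg _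
  have hgood₀ : (0 : ℝ) ≤ good.card := Nat.cast_nonneg _
  have hpM : 2 * p * Fintype.card ι ≤ 1 / s * Fintype.card ι := by gcongr
  have htwo : 2 / s = 2 * (1 / s) := by ring
  refine le_card_tripleFamily ?_ ?_ ?_ (by positivity) ?_ hnearU hnearV q
  · linarith [cast_card_sub_le_card_sdiff U good]
  · rw [htwo] at hV
    linarith [cast_card_sub_le_card_sdiff V good]
  · linarith
  · exact mul_nonneg (by linarith) hM

end TripleFamily

theorem card_filter_lt_mul_add_le_sum (d : ι → ℝ) (hd : ∀ i, 0 ≤ d i) {x y : ℝ} (hxy : x ≤ y) :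
    ((Finset.univ.filter fun i => x < d i).card : ℝ) * x
      + (Finset.univ.filter fun i => y < d i).card * (y - x) ≤ ∑ i, d i := by
  have hpointwise : ∀ i, (if x < d i then x else 0) + (if y < d i then y - x else 0) ≤ d i := by
    intro i
    split_ifs <;> linarith [hd i]
  simpa only [Finset.sum_add_distrib, ← Finset.sum_filter, Finset.sum_const, nsmul_eq_mul]
    using Finset.sum_le_sum fun i (_ : i ∈ Finset.univ) => hpointwise i

theorem cast_card_filter_lt (d : ι → ℝ) (x : ℝ) :
    ((Finset.univ.filter fun i => x < d i).card : ℝ) =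
      Fintype.card ι - (Finset.univ.filter fun i => d i ≤ x).card := by
  have hsplit := Finset.card_filter_add_card_filter_not (s := Finset.univ) fun i => d i ≤ x
  simp only [not_le, Finset.card_univ] at hsplit
  rw [← hsplit]
  push_cast
  ring

theorem le_card_filter_le_of_card_filter_le (d : ι → ℝ) (hd : ∀ i, 0 ≤ d i) {a β g k y : ℝ}
    (ha : 0 ≤ a) (hmean : ∑ i, d i = Fintype.card ι * a) (hβ₀ : 0 < β)
    (hβ₁ : β ≤ 1) (hg : 0 < g) (hk : 0 < k) (hy : k * (y + β) = β + (1 - β) / g)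
    (hfew : ((Finset.univ.filter fun i => d i ≤ (1 - β) * a).card : ℝ) ≤ Fintype.card ι / g) :
    (1 - k) * Fintype.card ι ≤ ((Finset.univ.filter fun i => d i ≤ (1 + y) * a).card : ℝ) := by
  have hyβ : 0 < y + β := by
    have : 0 < k * (y + β) := by
      rw [hy]
      linarith [div_nonneg (by linarith : 0 ≤ 1 - β) hg.le]
    exact pos_of_mul_pos_right this hk.le
  rcases ha.eq_or_lt with rfl | ha
  · have hzero : ∀ i, d i = 0 := by
      have hsum : ∑ i, d i = 0 := by rw [hmean, mul_zero]
      exact fun i => (Finset.sum_eq_zero_iff_of_nonneg fun i _ => hd i).1 hsum i (Finset.mem_univ i)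
    simp only [hzero, mul_zero, le_refl, Finset.filter_true, Finset.card_univ]
    exact mul_le_of_le_one_left (Nat.cast_nonneg _) (by linarith)
  have hcount := card_filter_lt_mul_add_le_sum d hd
    (mul_le_mul_of_nonneg_right (by linarith : 1 - β ≤ 1 + y) ha.le)
  rw [cast_card_filter_lt, cast_card_filter_lt, hmean] at hcount
  set M : ℝ := (Fintype.card ι : ℝ)
  set L : ℝ := ((Finset.univ.filter fun i => d i ≤ (1 - β) * a).card : ℝ)
  set H : ℝ := ((Finset.univ.filter fun i => d i ≤ (1 + y) * a).card : ℝ)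
  have hscaled : (M - L) * (1 - β) + (M - H) * (y + β) ≤ M :=
    le_of_mul_le_mul_right (by linarith) ha
  have hL : L * (1 - β) ≤ M / g * (1 - β) := mul_le_mul_of_nonneg_right hfew (by linarith)
  have hk' : M / g * (1 - β) = M * (k * (y + β)) - M * β := by rw [hy]; ring
  exact le_of_mul_le_mul_right (by linarith : (1 - k) * M * (y + β) ≤ H * (y + β)) hyβ

end Family

/-- The excess `y` for which `le_card_filter_le_of_card_filter_le` provides the fraction `1 / s`
of all indices. -/
noncomputable def excessFst (β s g : ℝ) : ℝ := (β * (g - s) + s) / (g * (s - 1))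

/-- The excess `y` for which `le_card_filter_le_of_card_filter_le` provides the fraction
`1 / c + 2 / s` of all indices. -/
noncomputable def excessSnd (β c s g : ℝ) : ℝ :=
  (β * (g * (2 * c + s) - s * c) + s * c) / (g * (c * s - s - 2 * c))

theorem one_sub_mul_excessFst_add {β s g : ℝ} (hs : s - 1 ≠ 0) (hs' : s ≠ 0) (hg : g ≠ 0) :
    (1 - 1 / s) * (excessFst β s g + β) = β + (1 - β) / g := by
  unfold excessFst
  field_simp
  ring

theorem one_sub_mul_excessSnd_add {β c s g : ℝ} (hc : c ≠ 0) (hs : s ≠ 0) (hg : g ≠ 0)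
    (hsc : c * s - s - 2 * c ≠ 0) :
    (1 - (1 / c + 2 / s)) * (excessSnd β c s g + β) = β + (1 - β) / g := by
  unfold excessSnd
  have hfactor : 1 - (1 / c + 2 / s) = (c * s - s - 2 * c) / (c * s) := by field_simp; ring
  rw [hfactor]
  generalize hD : c * s - s - 2 * c = D at hsc ⊢
  field_simp
  linear_combination -β * g * hD

/-- The indices of the clusterings within distance `t` of `N`. -/
noncomputable def lightIndices (I : Fin m → Clustering n) (N : Clustering n) (t : ℝ) :
    Finset (Fin m) :=
  Finset.univ.filter fun i => (dist (I i) N : ℝ) ≤ t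

theorem le_card_lightIndices {β g a k y : ℝ} (hβ₀ : 0 < β) (hβ₁ : β ≤ 1) (hg : 0 < g)
    (I : Fin m → Clustering n) (N : Clustering n) (ha : 0 ≤ a) (hmean : m * a = obj I N)
    (hfew : (lightIndices I N ((1 - β) * a)).card ≤ m / g)
    (hk : 0 < k) (hy : k * (y + β) = β + (1 - β) / g) :
    (1 - k) * m ≤ (lightIndices I N ((1 + y) * a)).card := by
  have hsum : ∑ i, (dist (I i) N : ℝ) = Fintype.card (Fin m) * a := by
    rw [Fintype.card_fin, hmean, obj, Nat.cast_sum]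
  simpa only [lightIndices, Fintype.card_fin] using le_card_filter_le_of_card_filter_le _
    (fun i => Nat.cast_nonneg _) ha hsum hβ₀ hβ₁ hg hk hy (by rw [Fintype.card_fin]; exact hfew)

theorem sub_le_ratio (γ η α β c s g : ℝ) : γ + 2 - (γ + 1) * β ≤ ratio γ η α β c s g :=
  (le_max_left _ _).trans (le_max_left _ _)

theorem excessFst_le_ratio (γ η α β c s g : ℝ) :
    γ + 2 + (γ + 1) * excessFst β s g - 2 * (1 / c * α) ≤ ratio γ η α β c s g :=
  (by rw [excessFst]; ring : _ = γ + 2 + (γ + 1) * _ - 2 * α / c).trans_le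
    ((le_max_right _ _).trans (le_max_left _ _))

theorem excessSnd_le_ratio (γ η α β c s g : ℝ) :
    γ + 2 + (γ + 1) * excessSnd β c s g - 2 * ((1 - 1 / s - 1 / c) * α) ≤
      ratio γ η α β c s g :=
  (by rw [excessSnd]; ring : _ = γ + 2 + (γ + 1) * _ - 2 * (1 - 1 / s - 1 / c) * α).trans_le
    ((le_max_left _ _).trans (le_max_right _ _))

theorem one_add_le_ratio (γ η α β c s g : ℝ) : 1 + 3 * (η + 1) * α ≤ ratio γ η α β c s g :=
  (le_max_right _ _).trans (le_max_right _ _)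

theorem mem_of_mem_lightIndices {γ α ρ a y b : ℝ} (hγ : 0 ≤ γ) (hα : 0 ≤ α)
    {I : Fin m → Clustering n} {N : Clustering n} (hN : IsFair P N) (ha : 0 ≤ a)
    (hmean : m * a = obj I N) {cls : Fin m → Clustering n}
    (hcls : ∀ i, IsCloseFair P γ (I i) (cls i)) {good : Finset (Fin m)}
    (hgood : ∀ i, (obj I (cls i) : ℝ) ≤ ρ * obj I N → i ∈ good)
    (hρ : γ + 2 + (γ + 1) * y - 2 * (b * α) ≤ ρ) {i : Fin m}
    (hi : i ∈ lightIndices I N ((1 + y) * a))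
    (hb : b * m ≤ (nearIndices I N (α * a) i).card) : i ∈ good := by
  refine hgood i ((obj_le_of_isCloseFair_of_dist_le hγ hα ha I hN hmean (hcls i)
    ((Finset.mem_filter_univ i).1 hi) hb).trans ?_)
  gcongr

theorem le_card_tripleFamily_of_few_good {γ η α β c s g a : ℝ} (hγ : 0 ≤ γ)
    (hα : 0 ≤ α) (hβ₀ : 0 < β) (hβ₁ : β ≤ 1) (hc : 0 < c) (hs : 1 < s) (hg : 0 < g)
    (hsc : 0 < s * c - s - 2 * c) (I : Fin m → Clustering n) {N : Clustering n}
    (hN : IsFair P N) (ha : 0 ≤ a) (hmean : m * a = obj I N)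
    {cls : Fin m → Clustering n} (hcls : ∀ i, IsCloseFair P γ (I i) (cls i))
    {good : Finset (Fin m)}
    (hgood : ∀ i, (obj I (cls i) : ℝ) ≤ ratio γ η α β c s g * obj I N → i ∈ good)
    (hfew : good.card ≤ min (1 / g) (1 / (2 * s)) * m) (q : Fin 3 × Fin m × Fin m) :
    min (1 / g) (1 / (2 * s)) * m ≤ (tripleFamily (nearIndices I N (α * a))
      (lightIndices I N ((1 + excessFst β s g) * a) \ good)
      (lightIndices I N ((1 + excessSnd β c s g) * a) \ good) q).card := by
  have hs₀ : 0 < s := by linarith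
  have hcs : 0 < c * s - s - 2 * c := by linarith
  have hcompl : 0 < 1 - (1 / c + 2 / s) := by
    rw [show 1 - (1 / c + 2 / s) = (c * s - s - 2 * c) / (c * s) by field_simp; ring]
    positivity
  have hfewLight : ((lightIndices I N ((1 - β) * a)).card : ℝ) ≤ m / g := by
    have hsub : lightIndices I N ((1 - β) * a) ⊆ good := fun i hi =>
      mem_of_mem_lightIndices (y := -β) (b := 0) hγ hα hN ha hmean hcls hgood
        ((by ring : _ = _).trans_le (sub_le_ratio γ η α β c s g)) hi (by simp)
    calc ((lightIndices I N ((1 - β) * a)).card : ℝ) ≤ good.card := by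
          exact_mod_cast Finset.card_le_card hsub
      _ ≤ 1 / g * m := hfew.trans (by gcongr; exact min_le_left _ _)
      _ = m / g := by ring
  have hU := le_card_lightIndices hβ₀ hβ₁ hg I N ha hmean hfewLight
    (sub_pos.2 ((div_lt_one hs₀).2 hs))
    (one_sub_mul_excessFst_add (β := β) (by linarith) hs₀.ne' hg.ne')
  have hV := le_card_lightIndices hβ₀ hβ₁ hg I N ha hmean hfewLight hcompl
    (one_sub_mul_excessSnd_add (β := β) hc.ne' hs₀.ne' hg.ne' hcs.ne')
  rw [sub_sub_cancel] at hU hV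
  have card_near_le {y b : ℝ} (hρ : γ + 2 + (γ + 1) * y - 2 * (b * α) ≤ ratio γ η α β c s g)
      (i : Fin m) (hi : i ∈ lightIndices I N ((1 + y) * a) \ good) :
      ((nearIndices I N (α * a) i).card : ℝ) ≤ b * m := by
    rw [Finset.mem_sdiff] at hi
    exact le_of_not_ge fun hb =>
      hi.2 (mem_of_mem_lightIndices hγ hα hN ha hmean hcls hgood hρ hi.1 hb)
  have hs_inv : 0 < 1 / s := by positivity
  have htwo : 2 / s = 2 * (1 / s) := by ring
  have hp : 2 * min (1 / g) (1 / (2 * s)) ≤ 1 / s :=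
    calc 2 * min (1 / g) (1 / (2 * s)) ≤ 2 * (1 / (2 * s)) := by gcongr; exact min_le_right _ _
      _ = 1 / s := by field_simp
  have hcard := le_card_tripleFamily_sdiff (near := nearIndices I N (α * a)) (good := good)
    (U := lightIndices I N ((1 + excessFst β s g) * a))
    (V := lightIndices I N ((1 + excessSnd β c s g) * a)) (c := c) (s := s)
    (p := min (1 / g) (1 / (2 * s))) (by positivity) (by linarith) hp
  simp only [Fintype.card_fin] at hcard
  exact hcard hfew hU hV (card_near_le (excessFst_le_ratio γ η α β c s g))
    (card_near_le (excessSnd_le_ratio γ η α β c s g)) q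

open Classical in
/-- If many of the candidates `cls i` are good, then all members are the set of their indices;
otherwise `tripleFamily` provides a majority graph. -/
theorem exists_family_yielding_good_candidate {γ η α β c s g : ℝ} (hγ : 0 < γ) (hη : 0 < η)
    (hα : 0 < α) (hβ₀ : 0 < β) (hβ₁ : β < 1) (hc : 0 < c) (hs : 1 < s) (hg : 0 < g)
    (hsc : 0 < s * c - s - 2 * c) (hm : 0 < m)
    (I : Fin m → Clustering n) {N : Clustering n} (hN : IsFair P N)
    (cls : Fin m → Clustering n) (hcls : ∀ i, IsCloseFair P γ (I i) (cls i))
    (cor : Fin m → Fin m → Fin m → Clustering n)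
    (hcor : ∀ i j k, IsApproxFairCor P η (majority (I i) (I j) (I k)) (cor i j k)) :
    ∃ 𝒜 : Fin 3 × Fin m × Fin m → Finset (Fin m),
      (∀ q, min (1 / g) (1 / (2 * s)) * m ≤ (𝒜 q).card) ∧
      ∀ X : Set (Fin m), (∀ q, ∃ i ∈ X, i ∈ 𝒜 q) →
        (∃ i ∈ X, (obj I (cls i) : ℝ) ≤ ratio γ η α β c s g * obj I N) ∨
        ∃ i ∈ X, ∃ j ∈ X, ∃ k ∈ X,
          (obj I (cor i j k) : ℝ) ≤ ratio γ η α β c s g * obj I N := by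
  have : Nonempty (Fin m) := ⟨⟨0, hm⟩⟩
  set p := min (1 / g) (1 / (2 * s))
  set r := ratio γ η α β c s g
  let good : Finset (Fin m) := Finset.univ.filter fun i => (obj I (cls i) : ℝ) ≤ r * obj I N
  have mem_good : ∀ i, i ∈ good ↔ (obj I (cls i) : ℝ) ≤ r * obj I N := fun i =>
    Finset.mem_filter_univ i
  rcases le_or_gt (p * m) good.card with hmany | hfew
  · refine ⟨fun _ => good, fun _ => hmany, fun X hX => Or.inl ?_⟩
    obtain ⟨i, hiX, hi⟩ := hX (Classical.arbitrary _)
    exact ⟨i, hiX, (mem_good i).1 hi⟩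
  obtain ⟨a, ha₀, ha⟩ : ∃ a : ℝ, 0 ≤ a ∧ m * a = obj I N :=
    ⟨obj I N / m, by positivity, mul_div_cancel₀ _ (by positivity)⟩
  refine ⟨_, le_card_tripleFamily_of_few_good hγ.le hα.le hβ₀ hβ₁.le hc hs hg hsc I hN ha₀ ha hcls
    (fun i => (mem_good i).2) hfew.le, fun X hX => ?_⟩
  obtain ⟨i, hi, j, hj, k, hk, hij, hik, hjk⟩ := exists_triple_of_meets hX
  refine .inr ⟨i, hi, j, hj, k, hk, ?_⟩
  calc (obj I (cor i j k) : ℝ)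
      ≤ obj I N + m * (3 * (η + 1) * (α * a)) :=
        obj_le_of_isApproxFairCor_majority hη.le I hN (hcor i j k) hij hik hjk
    _ = (1 + 3 * (η + 1) * α) * obj I N := by rw [← ha]; ring
    _ ≤ r * obj I N := by gcongr; exact one_add_le_ratio γ η α β c s g

end Combinatorics

/-! ### Random draws -/

section Sampling

open ProbabilityTheory

variable {n m : ℕ}

instance : IsProbabilityMeasure coinMeasure := by
  unfold coinMeasure
  infer_instance

/-- The element of `Fin m` obtained if the `t`-th random draw of a run asks for `m` values. -/
def draw (hm : 0 < m) (ω : Coins) (t : ℕ) : Fin m :=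
  (ω (t, m - 1)).cast (Nat.sub_add_cancel hm)

theorem measurable_draw (hm : 0 < m) (t : ℕ) : Measurable fun ω => draw hm ω t :=
  (measurable_of_finite (Fin.cast (Nat.sub_add_cancel hm))).comp (measurable_pi_apply (t, m - 1))

theorem iIndepFun_draw (hm : 0 < m) : iIndepFun (fun t ω => draw hm ω t) coinMeasure := by
  have hcoins : iIndepFun (fun (p : ℕ × ℕ) (ω : Coins) => ω p) coinMeasure :=
    iIndepFun_infinitePi (X := fun (p : ℕ × ℕ) (x : Fin (p.2 + 1)) => x) fun _ => measurable_id
  have hinj : Function.Injective fun t : ℕ => (t, m - 1) := fun _ _ h => (Prod.mk.inj h).1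
  exact (hcoins.precomp hinj).comp _ fun _ => measurable_of_finite _

theorem map_draw (hm : 0 < m) (t : ℕ) :
    coinMeasure.map (fun ω => draw hm ω t) = (m : ENNReal)⁻¹ • Measure.count := by
  obtain ⟨b, rfl⟩ : ∃ b, m = b + 1 := ⟨m - 1, (Nat.sub_add_cancel hm).symm⟩
  have heval : coinMeasure.map (fun ω => draw hm ω t) =
      (PMF.uniformOfFintype (Fin (b + 1))).toMeasure :=
    Measure.infinitePi_map_eval _ (t, b)
  refine heval.trans (Measure.ext_of_singleton fun i => ?_)
  simp

theorem integral_draw (hm : 0 < m) (f : Fin m → ℝ) (t : ℕ) :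
    ∫ ω, f (draw hm ω t) ∂coinMeasure = (∑ j, f j) / m := by
  rw [← integral_map (measurable_draw hm t).aemeasurable
    (measurable_of_finite f).aestronglyMeasurable, map_draw, integral_smul_measure,
    integral_count, ENNReal.toReal_inv, ENNReal.toReal_natCast, smul_eq_mul, inv_mul_eq_div]

theorem measureReal_draw_mem (hm : 0 < m) (A : Finset (Fin m)) (t : ℕ) :
    coinMeasure.real {ω | draw hm ω t ∈ A} = A.card / m := by
  have hmap := map_measureReal_apply (μ := coinMeasure) (measurable_draw hm t)
    (A.measurableSet)
  rw [map_draw] at hmap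
  refine hmap.symm.trans ?_
  simp [measureReal_def, inv_mul_eq_div]

theorem measureReal_forall_draw_notMem (hm : 0 < m) (A : Finset (Fin m)) (T : ℕ) :
    coinMeasure.real {ω | ∀ t < T, draw hm ω t ∉ A} = (1 - (A.card : ℝ) / m) ^ T := by
  have hmiss : ∀ t, coinMeasure.real ((fun ω => draw hm ω t) ⁻¹' (A : Set (Fin m))ᶜ) =
      1 - (A.card : ℝ) / m := fun t => by
    rw [← measureReal_draw_mem hm A t, Set.preimage_compl]
    exact probReal_compl_eq_one_sub (measurable_draw hm t A.measurableSet)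
  have hprod := (iIndepFun_draw hm).measure_inter_preimage_eq_mul (Finset.range T)
    (sets := fun _ => (A : Set (Fin m))ᶜ) fun _ _ => A.measurableSet.compl
  have hinter : {ω | ∀ t < T, draw hm ω t ∉ A} =
      ⋂ t ∈ Finset.range T, (fun ω => draw hm ω t) ⁻¹' (A : Set (Fin m))ᶜ := by
    ext ω
    simp
  rw [hinter, measureReal_def, hprod, ENNReal.toReal_prod]
  simp only [← measureReal_def, hmiss, Finset.prod_const, Finset.card_range]

theorem measureReal_sum_draw_nonneg_le (hm : 0 < m) {f : Fin m → ℝ} (hf : ∀ j, |f j| ≤ 1) {δ : ℝ}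
    (hδ : 0 ≤ δ) (hmean : ∑ j, f j ≤ -δ * m) (T : ℕ) :
    coinMeasure.real {ω | 0 ≤ ∑ t ∈ Finset.range T, f (draw hm ω t)} ≤
      Real.exp (-(δ ^ 2 / 2)) ^ T := by
  set μ : ℝ := (∑ j, f j) / m
  have hμ : δ ≤ -μ := by
    have : μ ≤ -δ := (div_le_iff₀ (by exact_mod_cast hm)).2 hmean
    linarith
  have hmeas : ∀ t, Measurable fun ω => f (draw hm ω t) := fun t =>
    (measurable_of_finite f).comp (measurable_draw hm t)
  have hsubG : ∀ t < T, HasSubgaussianMGF (fun ω => f (draw hm ω t) - μ) 1 coinMeasure := by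
    intro t _
    have hoeffding := hasSubgaussianMGF_of_mem_Icc (μ := coinMeasure) (hmeas t).aemeasurable
      (.of_forall fun ω => Set.mem_Icc.2 (abs_le.1 (hf (draw hm ω t))))
    rw [integral_draw] at hoeffding
    convert hoeffding using 1
    norm_num
  have hindep : iIndepFun (fun t ω => f (draw hm ω t) - μ) coinMeasure :=
    (iIndepFun_draw hm).comp _ fun _ => measurable_of_finite fun j => f j - μ
  calc coinMeasure.real {ω | 0 ≤ ∑ t ∈ Finset.range T, f (draw hm ω t)}
      ≤ coinMeasure.real {ω | T * δ ≤ ∑ t ∈ Finset.range T, (f (draw hm ω t) - μ)} := by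
        refine measureReal_mono fun ω hω => ?_
        rw [Set.mem_ofPred_eq] at hω ⊢
        rw [Finset.sum_sub_distrib, Finset.sum_const, Finset.card_range, nsmul_eq_mul]
        nlinarith [mul_le_mul_of_nonneg_left hμ T.cast_nonneg]
    _ ≤ Real.exp (-(T * δ) ^ 2 / (2 * T * (1 : NNReal))) :=
        HasSubgaussianMGF.measure_sum_range_ge_le_of_iIndepFun hindep hsubG (by positivity)
    _ = Real.exp (-(δ ^ 2 / 2)) ^ T := by
        rw [← Real.exp_nat_mul, NNReal.coe_one]
        congr 1
        rcases eq_or_ne (T : ℝ) 0 with hT | hT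
        · simp [hT]
        · field_simp

theorem measureReal_sum_dist_draw_le (hm : 0 < m) (I : Fin m → Clustering n) {F F' : Clustering n}
    {ε : ℝ} (hε₀ : 0 < ε) (hε₁ : ε ≤ 1) (hlt : (1 + 2 * ε) * obj I F' < obj I F) (T : ℕ) :
    coinMeasure.real {ω | ∑ t ∈ Finset.range T, dist (I (draw hm ω t)) F ≤
        ∑ t ∈ Finset.range T, dist (I (draw hm ω t)) F'} ≤
      Real.exp (-(ε ^ 2 / 8)) ^ T := by
  have hF' : (0 : ℝ) ≤ obj I F' := Nat.cast_nonneg _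
  have hD : (0 : ℝ) < dist F F' := by
    rw [Nat.cast_pos, dist_comm, Nat.pos_iff_ne_zero]
    intro hzero
    have hle : (obj I F : ℝ) ≤ obj I F' := by
      simpa only [hzero, mul_zero, add_zero, Nat.cast_le] using obj_le_obj_add_mul_dist I F' F
    nlinarith
  set f : Fin m → ℝ := fun j => ((dist (I j) F' : ℝ) - dist (I j) F) / dist F F' with hf
  have hbound : ∀ j, |f j| ≤ 1 := fun j => by
    have hle : (dist (I j) F' : ℝ) ≤ dist (I j) F + dist F F' := by
      exact_mod_cast dist_triangle _ F _
    have hge : (dist (I j) F : ℝ) ≤ dist (I j) F' + dist F F' := by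
      rw [dist_comm F F']
      exact_mod_cast dist_triangle _ F' _
    rw [abs_div, abs_of_pos hD, div_le_one hD, abs_le]
    constructor <;> linarith
  have hmean : ∑ j, f j ≤ -(ε / 2) * m := by
    have hmul : (m : ℝ) * dist F F' ≤ obj I F + obj I F' := by
      exact_mod_cast mul_dist_le_obj_add_obj I F F'
    rw [hf, ← Finset.sum_div, Finset.sum_sub_distrib, div_le_iff₀ hD, ← Nat.cast_sum,
      ← Nat.cast_sum]
    change (obj I F' : ℝ) - obj I F ≤ _
    nlinarith [mul_le_mul_of_nonneg_left hmul (by positivity : 0 ≤ ε / 2),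
      mul_le_mul_of_nonneg_right hlt.le (by linarith : 0 ≤ 1 - ε / 2),
      mul_nonneg (mul_nonneg hε₀.le (by linarith : 0 ≤ 1 - ε)) hF']
  calc _ ≤ coinMeasure.real {ω | 0 ≤ ∑ t ∈ Finset.range T, f (draw hm ω t)} := by
        refine measureReal_mono fun ω hω => ?_
        rw [Set.mem_ofPred_eq] at hω ⊢
        rw [hf, ← Finset.sum_div, Finset.sum_sub_distrib, ← Nat.cast_sum, ← Nat.cast_sum]
        exact div_nonneg (sub_nonneg.2 (Nat.cast_le.2 hω)) hD.le
    _ ≤ Real.exp (-((ε / 2) ^ 2 / 2)) ^ T :=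
        measureReal_sum_draw_nonneg_le hm hbound (by positivity) hmean T
    _ = Real.exp (-(ε ^ 2 / 8)) ^ T := by congr 3; ring

theorem pow_mul_size_le_one_div_pow {x : ℝ} (hx : 0 ≤ x) {C k : ℕ} (hm : 0 < m)
    (hC : x ^ C ≤ (1 / 2) ^ k) : x ^ (C * Nat.size m) ≤ (1 / (m : ℝ)) ^ k :=
  calc x ^ (C * Nat.size m) ≤ ((1 / 2) ^ k) ^ Nat.size m := by rw [pow_mul]; gcongr
    _ = (1 / (2 : ℝ) ^ Nat.size m) ^ k := by rw [← pow_mul, mul_comm, pow_mul, div_pow, one_pow]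
    _ ≤ (1 / (m : ℝ)) ^ k := by
      gcongr
      exact_mod_cast (Nat.lt_size_self m).le

theorem exp_pow_mul_sq_le {ε : ℝ} {e : ℕ} (he : 1 ≤ e * ε) (T : ℕ) :
    Real.exp (-(ε ^ 2 / 8)) ^ (T * (e * e)) ≤ Real.exp (-(1 / 8)) ^ T := by
  have hexp : Real.exp (-(ε ^ 2 / 8)) ^ (e * e) ≤ Real.exp (-(1 / 8)) := by
    rw [← Real.exp_nat_mul, Real.exp_le_exp]
    push_cast
    linarith [one_le_pow₀ (n := 2) he]
  rw [mul_comm T, pow_mul]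
  gcongr

theorem measureReal_exists_forall_draw_notMem_le {ι : Type*} [Fintype ι] (hm : 0 < m) {p : ℝ}
    (hp : p ≤ 1) {C k : ℕ} (hC : (1 - p) ^ C ≤ (1 / 2) ^ k) (𝒜 : ι → Finset (Fin m))
    (h𝒜 : ∀ q, p * m ≤ (𝒜 q).card) :
    coinMeasure.real {ω | ∃ q, ∀ t < C * Nat.size m, draw hm ω t ∉ 𝒜 q} ≤
      Fintype.card ι * (1 / (m : ℝ)) ^ k := by
  have hmiss : ∀ q, coinMeasure.real {ω | ∀ t < C * Nat.size m, draw hm ω t ∉ 𝒜 q} ≤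
      (1 / (m : ℝ)) ^ k := fun q => by
    have hcard : ((𝒜 q).card : ℝ) / m ≤ 1 := by
      refine div_le_one_of_le₀ ?_ (by positivity)
      exact_mod_cast (Finset.card_le_univ _).trans_eq (Fintype.card_fin m)
    have hp' : p ≤ (𝒜 q).card / m := (le_div_iff₀ (by exact_mod_cast hm)).2 (h𝒜 q)
    rw [measureReal_forall_draw_notMem]
    calc (1 - ((𝒜 q).card : ℝ) / m) ^ (C * Nat.size m)
        ≤ (1 - p) ^ (C * Nat.size m) := by gcongr
      _ ≤ (1 / (m : ℝ)) ^ k := pow_mul_size_le_one_div_pow (by linarith) hm hC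
  simp only [Set.ofPred_exists]
  refine (measureReal_iUnion_fintype_le _).trans ?_
  simpa using Finset.sum_le_card_nsmul Finset.univ _ _ fun q _ => hmiss q

theorem measureReal_exists_sum_dist_draw_le {κ : Type*} [Fintype κ] (hm : 0 < m) {C e k : ℕ} {ε : ℝ}
    (hε₀ : 0 < ε) (hε₁ : ε ≤ 1) (he : 1 ≤ e * ε) (hC : Real.exp (-(1 / 8)) ^ C ≤ (1 / 2) ^ k)
    (I : Fin m → Clustering n) (cand : κ → Clustering n) :
    coinMeasure.real {ω | ∃ ab : κ × κ, (1 + 2 * ε) * obj I (cand ab.2) < obj I (cand ab.1) ∧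
        ∑ t ∈ Finset.range (C * Nat.size m * (e * e)), dist (I (draw hm ω t)) (cand ab.1) ≤
          ∑ t ∈ Finset.range (C * Nat.size m * (e * e)), dist (I (draw hm ω t)) (cand ab.2)} ≤
      (Fintype.card κ : ℝ) ^ 2 * (1 / (m : ℝ)) ^ k := by
  have hwrong : ∀ ab : κ × κ, coinMeasure.real {ω |
      (1 + 2 * ε) * obj I (cand ab.2) < obj I (cand ab.1) ∧
        ∑ t ∈ Finset.range (C * Nat.size m * (e * e)), dist (I (draw hm ω t)) (cand ab.1) ≤
          ∑ t ∈ Finset.range (C * Nat.size m * (e * e)), dist (I (draw hm ω t)) (cand ab.2)} ≤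
      (1 / (m : ℝ)) ^ k := fun ab => by
    by_cases hlt : (1 + 2 * ε) * obj I (cand ab.2) < obj I (cand ab.1)
    · simp only [hlt, true_and]
      exact (measureReal_sum_dist_draw_le hm I hε₀ hε₁ hlt _).trans
        ((exp_pow_mul_sq_le he _).trans (pow_mul_size_le_one_div_pow (Real.exp_pos _).le hm hC))
    · simp only [hlt, false_and, Set.ofPred_false, measureReal_empty]
      positivity
  rw [Set.ofPred_exists]
  refine (measureReal_iUnion_fintype_le _).trans ?_
  simpa [sq] using Finset.sum_le_card_nsmul Finset.univ _ _ fun ab _ => hwrong ab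

/-- The failure probabilities are at most `m ^ 4 * m⁻¹ ^ 6` and `m ^ 8 * m⁻¹ ^ 10`. -/
theorem one_sub_le_measureReal_good_sample {ι κ : Type*} [Fintype ι] [Fintype κ] (hm : 2 ≤ m)
    {p : ℝ} (hp : p ≤ 1) {C e : ℕ} {ε : ℝ} (hε₀ : 0 < ε) (hε₁ : ε ≤ 1) (he : 1 ≤ e * ε)
    (hCp : (1 - p) ^ C ≤ (1 / 2) ^ 6) (hCe : Real.exp (-(1 / 8)) ^ C ≤ (1 / 2) ^ 10)
    (hι : Fintype.card ι ≤ m ^ 4) (hκ : Fintype.card κ ≤ m ^ 4)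
    (𝒜 : ι → Finset (Fin m)) (h𝒜 : ∀ q, p * m ≤ (𝒜 q).card)
    (I : Fin m → Clustering n) (cand : κ → Clustering n) :
    1 - 1 / (m : ℝ) ≤ coinMeasure.real {ω |
      (∀ q, ∃ t < C * Nat.size m, draw (by omega) ω t ∈ 𝒜 q) ∧
      ∀ a b, (1 + 2 * ε) * obj I (cand b) < obj I (cand a) →
        ∑ t ∈ Finset.range (C * Nat.size m * (e * e)), dist (I (draw (by omega) ω t)) (cand b) <
          ∑ t ∈ Finset.range (C * Nat.size m * (e * e)),
            dist (I (draw (by omega) ω t)) (cand a)} := by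
  have hm₀ : 0 < m := by omega
  have hmiss := measureReal_exists_forall_draw_notMem_le hm₀ hp hCp 𝒜 h𝒜
  have hwrong := measureReal_exists_sum_dist_draw_le hm₀ hε₀ hε₁ he hCe I cand
  set miss := {ω | ∃ q, ∀ t < C * Nat.size m, draw hm₀ ω t ∉ 𝒜 q}
  set wrong := {ω | ∃ ab : κ × κ, (1 + 2 * ε) * obj I (cand ab.2) < obj I (cand ab.1) ∧
    ∑ t ∈ Finset.range (C * Nat.size m * (e * e)), dist (I (draw hm₀ ω t)) (cand ab.1) ≤
      ∑ t ∈ Finset.range (C * Nat.size m * (e * e)), dist (I (draw hm₀ ω t)) (cand ab.2)}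
  have hhalf : 1 / (m : ℝ) ≤ 1 / 2 := by
    gcongr
    exact_mod_cast hm
  have hmiss' : coinMeasure.real miss ≤ 1 / m * (1 / m) :=
    calc coinMeasure.real miss ≤ (m : ℝ) ^ 4 * (1 / m) ^ 6 :=
          hmiss.trans (by gcongr; exact_mod_cast hι)
      _ = 1 / m * (1 / m) := by field_simp
  have hwrong' : coinMeasure.real wrong ≤ 1 / m * (1 / m) :=
    calc coinMeasure.real wrong ≤ ((m : ℝ) ^ 4) ^ 2 * (1 / m) ^ 10 :=
          hwrong.trans (by gcongr; exact_mod_cast hκ)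
      _ = 1 / m * (1 / m) := by field_simp
  have hbad : coinMeasure.real (miss ∪ wrong) ≤ 1 / m :=
    calc coinMeasure.real (miss ∪ wrong) ≤ 1 / m * (1 / m) + 1 / m * (1 / m) :=
          (measureReal_union_le _ _).trans (add_le_add hmiss' hwrong')
      _ = 2 * (1 / m) * (1 / m) := by ring
      _ ≤ 1 / m := mul_le_of_le_one_left (by positivity) (by linarith)
  have hcompl : 1 ≤ coinMeasure.real (miss ∪ wrong) + coinMeasure.real (miss ∪ wrong)ᶜ := by
    rw [← probReal_univ (μ := coinMeasure), ← Set.union_compl_self (miss ∪ wrong)]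
    exact measureReal_union_le _ _
  refine (by linarith : 1 - 1 / (m : ℝ) ≤ coinMeasure.real (miss ∪ wrong)ᶜ).trans
    (measureReal_mono fun ω hω => ?_)
  simp only [Set.mem_compl_iff, Set.mem_union, not_or] at hω
  exact ⟨by simpa [miss] using hω.1, fun a b hab => not_le.1 fun hle => hω.2 ⟨(a, b), hab, hle⟩⟩

end Sampling

/-! ### A program logic for the machine

Addresses `40, …, 63` are scratch space for the evaluation of expressions.  The observable part of a
state masks them, so that commands act on it by plain updates. -/

/-- The observable part of a state: everything a program can read, except the scratch addresses. -/
structure Core where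
  mem : ℕ → ℕ
  arg : List ℕ
  out : List ℕ
  draws : ℕ

/-- Overwrite one memory word of an observable state. -/
def Core.set (c : Core) (a x : ℕ) : Core := { c with mem := Function.update c.mem a x }

@[simp] theorem Core.set_mem (c : Core) (a x : ℕ) :
    (c.set a x).mem = Function.update c.mem a x := rfl

/-- A memory with its scratch addresses blanked out. -/
def mask (μ : ℕ → ℕ) (a : ℕ) : ℕ := if 40 ≤ a ∧ a < 64 then 0 else μ a

theorem mask_of_not_scratch {μ : ℕ → ℕ} {a : ℕ} (h : a < 40 ∨ 64 ≤ a) : mask μ a = μ a :=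
  if_neg (by omega)

theorem mask_update_scratch {μ : ℕ → ℕ} {a x : ℕ} (h : 40 ≤ a) (h' : a < 64) :
    mask (Function.update μ a x) = mask μ := by
  funext b
  unfold mask
  split_ifs with hb
  · rfl
  · rw [Function.update_of_ne (by omega)]

theorem mask_update {μ : ℕ → ℕ} {a x : ℕ} (h : a < 40 ∨ 64 ≤ a) :
    mask (Function.update μ a x) = Function.update (mask μ) a x := by
  funext b
  rcases eq_or_ne b a with rfl | hb
  · rw [mask_of_not_scratch h, Function.update_self, Function.update_self]
  · simp only [mask, Function.update_of_ne hb]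

namespace State

/-- The observable part of a state of the machine. -/
def core (σ : State) : Core := ⟨mask σ.mem, σ.arg, σ.out, σ.draws⟩

/-- All addresses written so far are below `B`, and all words are at most `W`. -/
structure Within (B W : ℕ) (σ : State) : Prop where
  mem_le : ∀ a, σ.mem a ≤ W
  space_le : σ.space ≤ B
  top_le : σ.top ≤ W

theorem Within.put {B W : ℕ} {σ : State} (h : σ.Within B W) {a x : ℕ} (ha : a < B)
    (hx : x ≤ W) : (σ.put a x).Within B W where
  mem_le b := by
    rcases eq_or_ne b a with rfl | hb
    · simpa only [State.put, Function.update_self] using hx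
    · simpa only [State.put, Function.update_of_ne hb] using h.mem_le b
  space_le := max_le h.space_le ha
  top_le := max_le h.top_le hx

theorem Within.spend {B W : ℕ} {σ : State} (h : σ.Within B W) (k : ℕ) :
    (σ.spend k).Within B W := ⟨h.mem_le, h.space_le, h.top_le⟩

theorem core_put {σ : State} {a x : ℕ} (h : a < 40 ∨ 64 ≤ a) :
    (σ.put a x).core = σ.core.set a x := by
  simp only [core, put, Core.set, mask_update h]

theorem core_put_scratch {σ : State} {a x : ℕ} (h : 40 ≤ a) (h' : a < 64) :
    (σ.put a x).core = σ.core := by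
  simp only [core, put, mask_update_scratch h h']

theorem core_mem_of_not_scratch {σ : State} {a : ℕ} (h : a < 40 ∨ 64 ≤ a) :
    σ.core.mem a = σ.mem a := mask_of_not_scratch h

@[simp] theorem core_spend (σ : State) (k : ℕ) : (σ.spend k).core = σ.core := rfl
@[simp] theorem spend_mem (σ : State) (k : ℕ) : (σ.spend k).mem = σ.mem := rfl
@[simp] theorem spend_time (σ : State) (k : ℕ) : (σ.spend k).time = σ.time + k := rfl
@[simp] theorem put_time (σ : State) (a x : ℕ) : (σ.put a x).time = σ.time := rfl
@[simp] theorem put_mem (σ : State) (a x : ℕ) :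
    (σ.put a x).mem = Function.update σ.mem a x := rfl

/-- The state `τ` arises from `σ` in `t` steps that leave the observable part and the scratch
addresses below `k` alone and deliver the word `v` at the scratch address `k`. -/
structure Delivers (B W k : ℕ) (σ : State) (v t : ℕ) (τ : State) : Prop where
  core_eq : τ.core = σ.core
  mem_self : τ.mem k = v
  mem_of_lt : ∀ a, 40 ≤ a → a < k → τ.mem a = σ.mem a
  within : τ.Within B W
  time_eq : τ.time = σ.time + t

variable {B W k v w t t' : ℕ} {σ τ ρ : State}

theorem Within.delivers (h : σ.Within B W) (k : ℕ) : Delivers B W k σ (σ.mem k) 0 σ :=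
  ⟨rfl, rfl, fun _ _ _ => rfl, h, rfl⟩

theorem Delivers.le (h : Delivers B W k σ v t τ) : v ≤ W :=
  h.mem_self ▸ h.within.mem_le k

theorem Delivers.trans (h : Delivers B W k σ v t τ) (h' : Delivers B W (k + 1) τ w t' ρ)
    (hk : 40 ≤ k) : Delivers B W k σ v (t + t') ρ where
  core_eq := h'.core_eq.trans h.core_eq
  mem_self := (h'.mem_of_lt k hk k.lt_succ_self).trans h.mem_self
  mem_of_lt a ha hak := (h'.mem_of_lt a ha (hak.trans k.lt_succ_self)).trans (h.mem_of_lt a ha hak)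
  within := h'.within
  time_eq := by rw [h'.time_eq, h.time_eq, add_assoc]

theorem Delivers.put_spend (h : Delivers B W k σ v t τ) (hB : 64 ≤ B) (hk : 40 ≤ k) (hk' : k < 64)
    (hw : w ≤ W) : Delivers B W k σ w (t + 1) ((τ.put k w).spend 1) where
  core_eq := by rw [core_spend, core_put_scratch hk hk', h.core_eq]
  mem_self := by rw [spend_mem, put_mem, Function.update_self]
  mem_of_lt a ha hak := by
    rw [spend_mem, put_mem, Function.update_of_ne hak.ne, h.mem_of_lt a ha hak]
  within := (h.within.put (hk'.trans_le hB) hw).spend 1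
  time_eq := by rw [spend_time, put_time, h.time_eq, add_assoc]

end State

/-! ### Expressions -/

/-- Arithmetic expressions over the memory; `ld x` is the word at the address `x`. -/
inductive RExpr where
  | lit (k : ℕ)
  | reg (a : ℕ)
  | bin (o : Op) (x y : RExpr)
  | size (x : RExpr)
  | ld (x : RExpr)

namespace RExpr

instance : Add RExpr := ⟨bin .add⟩
instance : Sub RExpr := ⟨bin .sub⟩
instance : Mul RExpr := ⟨bin .mul⟩
instance : Div RExpr := ⟨bin .div⟩
instance : Mod RExpr := ⟨bin .mod⟩

/-- The value of an expression in the memory `μ`. -/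
def eval (μ : ℕ → ℕ) : RExpr → ℕ
  | lit k => k
  | reg a => μ a
  | bin o x y => o.eval (x.eval μ) (y.eval μ)
  | size x => Nat.size (x.eval μ)
  | ld x => μ (x.eval μ)

/-- Evaluation does not read scratch space and produces no word larger than `W`. -/
def Ok (W : ℕ) (μ : ℕ → ℕ) : RExpr → Prop
  | lit k => k ≤ W
  | reg a => a < 40
  | bin .add x y => x.Ok W μ ∧ y.Ok W μ ∧ x.eval μ + y.eval μ ≤ W
  | bin .mul x y => x.Ok W μ ∧ y.Ok W μ ∧ x.eval μ * y.eval μ ≤ W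
  | bin _ x y => x.Ok W μ ∧ y.Ok W μ
  | size x => x.Ok W μ
  | ld x => x.Ok W μ ∧ 64 ≤ x.eval μ

section

variable (μ : ℕ → ℕ) (W : ℕ) (x y : RExpr)

@[simp] theorem eval_lit (k : ℕ) : (lit k).eval μ = k := rfl
@[simp] theorem eval_reg (a : ℕ) : (reg a).eval μ = μ a := rfl
@[simp] theorem eval_add : (x + y).eval μ = x.eval μ + y.eval μ := rfl
@[simp] theorem eval_sub : (x - y).eval μ = x.eval μ - y.eval μ := rfl
@[simp] theorem eval_mul : (x * y).eval μ = x.eval μ * y.eval μ := rfl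
@[simp] theorem eval_div : (x / y).eval μ = x.eval μ / y.eval μ := rfl
@[simp] theorem eval_mod : (x % y).eval μ = x.eval μ % y.eval μ := rfl
@[simp] theorem eval_size : (size x).eval μ = Nat.size (x.eval μ) := rfl
@[simp] theorem eval_ld : (ld x).eval μ = μ (x.eval μ) := rfl
@[simp] theorem ok_lit (k : ℕ) : (lit k).Ok W μ ↔ k ≤ W := Iff.rfl
@[simp] theorem ok_reg (a : ℕ) : (reg a).Ok W μ ↔ a < 40 := Iff.rfl
@[simp] theorem ok_add :
    (x + y).Ok W μ ↔ x.Ok W μ ∧ y.Ok W μ ∧ x.eval μ + y.eval μ ≤ W := Iff.rfl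
@[simp] theorem ok_mul :
    (x * y).Ok W μ ↔ x.Ok W μ ∧ y.Ok W μ ∧ x.eval μ * y.eval μ ≤ W := Iff.rfl
@[simp] theorem ok_sub : (x - y).Ok W μ ↔ x.Ok W μ ∧ y.Ok W μ := Iff.rfl
@[simp] theorem ok_div : (x / y).Ok W μ ↔ x.Ok W μ ∧ y.Ok W μ := Iff.rfl
@[simp] theorem ok_mod : (x % y).Ok W μ ↔ x.Ok W μ ∧ y.Ok W μ := Iff.rfl
@[simp] theorem ok_size : (size x).Ok W μ ↔ x.Ok W μ := Iff.rfl
@[simp] theorem ok_ld : (ld x).Ok W μ ↔ x.Ok W μ ∧ 64 ≤ x.eval μ := Iff.rfl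

end

/-- The equality test: its value is `1` if the values of `x` and `y` are equal, and `0`
otherwise.  Subtraction of words is truncated. -/
def eq (x y : RExpr) : RExpr := (lit 1 - (x - y)) * (lit 1 - (y - x))

@[simp] theorem eval_eq (μ : ℕ → ℕ) (x y : RExpr) :
    (eq x y).eval μ = if x.eval μ = y.eval μ then 1 else 0 := by
  simp only [eq, eval_mul, eval_sub, eval_lit]
  split_ifs with h
  · rw [h, Nat.sub_self]
  · rcases Nat.lt_or_gt_of_ne h with h | h
    · rw [show 1 - (y.eval μ - x.eval μ) = 0 by omega, mul_zero]
    · rw [show 1 - (x.eval μ - y.eval μ) = 0 by omega, zero_mul]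

@[simp] theorem ok_eq (W : ℕ) (μ : ℕ → ℕ) (x y : RExpr) :
    (eq x y).Ok W μ ↔ 1 ≤ W ∧ x.Ok W μ ∧ y.Ok W μ := by
  have value_le : (1 - (x.eval μ - y.eval μ)) * (1 - (y.eval μ - x.eval μ)) ≤ 1 :=
    Nat.mul_le_mul (Nat.sub_le _ _) (Nat.sub_le _ _)
  simp only [eq, ok_mul, ok_sub, ok_lit, eval_sub, eval_lit]
  exact ⟨by tauto, fun h => ⟨⟨h.1, h.2⟩, ⟨h.1, h.2.2, h.2.1⟩, value_le.trans h.1⟩⟩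

/-- Code that computes the value into address `k`, using addresses from `k` on as scratch space. -/
def code : RExpr → ℕ → Prog
  | lit v, k => .const k v
  | reg a, k => .seq (.const k 0) (.op .add k a k)
  | bin o x y, k => .seq (x.code k) (.seq (y.code (k + 1)) (.op o k k (k + 1)))
  | size x, k => .seq (x.code k) (.size k k)
  | ld x, k => .seq (x.code k) (.load k k)

/-- The number of steps of the code. -/
def cost : RExpr → ℕ
  | lit _ => 1
  | reg _ => 2
  | bin _ x y => x.cost + (y.cost + 1)
  | size x => x.cost + 1
  | ld x => x.cost + 1

/-- The number of scratch addresses that the code uses. -/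
def depth : RExpr → ℕ
  | lit _ => 1
  | reg _ => 1
  | bin _ x y => max x.depth (y.depth + 1)
  | size x => x.depth
  | ld x => x.depth

section

variable (x y : RExpr)

@[simp] theorem cost_lit (k : ℕ) : (lit k).cost = 1 := rfl
@[simp] theorem cost_reg (a : ℕ) : (reg a).cost = 2 := rfl
@[simp] theorem cost_add : (x + y).cost = x.cost + (y.cost + 1) := rfl
@[simp] theorem cost_sub : (x - y).cost = x.cost + (y.cost + 1) := rfl
@[simp] theorem cost_mul : (x * y).cost = x.cost + (y.cost + 1) := rfl
@[simp] theorem cost_size : (size x).cost = x.cost + 1 := rfl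
@[simp] theorem cost_ld : (ld x).cost = x.cost + 1 := rfl

end

theorem depth_pos (e : RExpr) : 0 < e.depth := by
  induction e with
  | lit | reg => exact Nat.one_pos
  | bin _ _ _ hx => exact lt_max_of_lt_left hx
  | size _ hx | ld _ hx => exact hx

theorem Ok.left {W : ℕ} {μ : ℕ → ℕ} {o : Op} {x y : RExpr} (h : (bin o x y).Ok W μ) :
    x.Ok W μ := by
  cases o <;> exact h.1

theorem Ok.right {W : ℕ} {μ : ℕ → ℕ} {o : Op} {x y : RExpr} (h : (bin o x y).Ok W μ) :
    y.Ok W μ := by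
  cases o <;> first | exact h.2.1 | exact h.2

theorem Ok.op_eval_le {W : ℕ} {μ : ℕ → ℕ} {o : Op} {x y : RExpr} (h : (bin o x y).Ok W μ)
    (hx : x.eval μ ≤ W) : o.eval (x.eval μ) (y.eval μ) ≤ W := by
  cases o with
  | add | mul => exact h.2.2
  | sub => exact (Nat.sub_le _ _).trans hx
  | div => exact (Nat.div_le_self _ _).trans hx
  | mod => exact (Nat.mod_le _ _).trans hx

theorem delivers_code {B W : ℕ} (E : Env) (hB : 64 ≤ B) (e : RExpr) (k : ℕ) (σ : State)
    (hk : 40 ≤ k) (hd : k + e.depth ≤ 64) (hok : e.Ok W σ.core.mem) (hσ : σ.Within B W) :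
    State.Delivers B W k σ (e.eval σ.core.mem) e.cost ((e.code k).run E σ) := by
  have hk' : k < 64 := by have := e.depth_pos; omega
  induction e generalizing k σ with
  | lit v => exact (hσ.delivers k).put_spend hB hk hk' hok
  | reg a =>
    have ha : a ≠ k := (lt_of_lt_of_le hok hk).ne
    have cleared := (hσ.delivers k).put_spend hB hk hk' (Nat.zero_le W)
    have copied := cleared.put_spend hB hk hk' (hσ.mem_le a)
    simpa only [code, Prog.run, Op.eval, State.spend_mem, State.put_mem, Function.update_self,
      Function.update_of_ne ha, add_zero, eval, cost,
      State.core_mem_of_not_scratch (σ := σ) (Or.inl hok)] using copied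
  | bin o x y ihx ihy =>
    have hdx : k + x.depth ≤ 64 := (Nat.add_le_add_left (le_max_left _ _) k).trans hd
    have hdy : k + (y.depth + 1) ≤ 64 := (Nat.add_le_add_left (le_max_right _ _) k).trans hd
    have first := ihx k σ hk hdx hok.left hσ hk'
    have second := ihy (k + 1) _ (by omega) (by omega) (by rw [first.core_eq]; exact hok.right)
      first.within (by have := y.depth_pos; omega)
    have both := first.trans second hk
    have result := both.put_spend hB hk hk' (hok.op_eval_le first.le)
    rw [code, Prog.run, Prog.run, Prog.run, both.mem_self, second.mem_self, first.core_eq]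
    exact result
  | size x ih =>
    have value := ih k σ hk hd hok hσ hk'
    have size_le : Nat.size (x.eval σ.core.mem) ≤ W :=
      (Nat.size_le.2 Nat.lt_two_pow_self).trans value.le
    rw [code, Prog.run, Prog.run, value.mem_self]
    exact value.put_spend hB hk hk' size_le
  | ld x ih =>
    have address := ih k σ hk hd hok.1 hσ hk'
    rw [code, Prog.run, Prog.run, address.mem_self,
      ← State.core_mem_of_not_scratch (Or.inr hok.2), address.core_eq]
    have word_le : (RExpr.ld x).eval σ.core.mem ≤ W :=
      (State.core_mem_of_not_scratch (Or.inr hok.2)).trans_le (hσ.mem_le _)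
    exact address.put_spend hB hk hk' word_le

end RExpr

/-! ### Commands and their rules -/

/-- The command `M[d] := e`. -/
def assign (d : ℕ) (e : RExpr) : Prog :=
  .seq (e.code 40) (.seq (.const 41 0) (.op .add d 40 41))

/-- The command `M[x] := y`. -/
def storeAt (x y : RExpr) : Prog := .seq (x.code 40) (.seq (y.code 41) (.store 40 41))

/-- Append the value of `e` to the argument tape. -/
def pushVal (e : RExpr) : Prog := .seq (e.code 40) (.push 40)

/-- Append the value of `e` to the output tape. -/
def emitVal (e : RExpr) : Prog := .seq (e.code 40) (.emit 40)

/-- Run `p` if the value of `e` is zero, and `q` otherwise. -/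
def branch (e : RExpr) (p q : Prog) : Prog := .seq (e.code 40) (.ifZero 40 p q)

/-- Run `p` as often as the value of `e` says at the start. -/
def repeatVal (e : RExpr) (p : Prog) : Prog := .seq (e.code 40) (.loop 40 p)

/-- Run `p` with the values `0, 1, …` below that of `e` in the counter `r`. -/
def forLoop (r : ℕ) (e : RExpr) (p : Prog) : Prog :=
  .seq (assign r (.lit 0)) (repeatVal e (.seq p (assign r (.reg r + .lit 1))))

/-- What a program is run in: the environment, a space bound and a bound for the words. -/
structure Setting where
  env : Env
  B : ℕ
  W : ℕ
  hB : 64 ≤ B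

/-- The state `τ` respects the bounds of `Γ`, is reached by time `t` and satisfies `Q`. -/
structure Attains (Γ : Setting) (Q : Core → Prop) (t : ℕ) (τ : State) : Prop where
  post : Q τ.core
  within : τ.Within Γ.B Γ.W
  time_le : τ.time ≤ t

/-- From observable state `c`, the program `p` stays within the bounds, takes at most `t` steps and
establishes `Q`. -/
def Run (Γ : Setting) (p : Prog) (t : ℕ) (c : Core) (Q : Core → Prop) : Prop :=
  ∀ σ : State, σ.core = c → σ.Within Γ.B Γ.W → Attains Γ Q (σ.time + t) (p.run Γ.env σ)

section Rules

variable {Γ : Setting} {c : Core} {Q : Core → Prop}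

theorem Run.mono {p : Prog} {t t' : ℕ} {R : Core → Prop} (h : Run Γ p t c R) (ht : t ≤ t')
    (hR : ∀ c', R c' → Q c') : Run Γ p t' c Q := fun σ hc hσ =>
  have attained := h σ hc hσ
  ⟨hR _ attained.post, attained.within, attained.time_le.trans (Nat.add_le_add_left ht _)⟩

theorem Run.seq {p q : Prog} {s : ℕ} (t t' : ℕ) (hs : t + t' ≤ s)
    (h : Run Γ p t c fun c' => Run Γ q t' c' Q) : Run Γ (.seq p q) s c Q := fun σ hc hσ => by
  have first := h σ hc hσ
  have second := first.post _ rfl first.within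
  exact ⟨second.post, second.within, second.time_le.trans (by have := first.time_le; omega)⟩

theorem Run.skip {s : ℕ} (hs : 1 ≤ s) (h : Q c) : Run Γ .skip s c Q := fun _ hc hσ =>
  ⟨hc ▸ h, hσ.spend 1, Nat.add_le_add_left hs _⟩

theorem Run.expr {e : RExpr} {p : Prog} {s : ℕ} (t : ℕ) (hs : e.cost + t ≤ s)
    (hd : e.depth ≤ 24) (hok : e.Ok Γ.W c.mem)
    (h : ∀ σ : State, σ.core = c → σ.mem 40 = e.eval c.mem → σ.Within Γ.B Γ.W →
      Attains Γ Q (σ.time + t) (p.run Γ.env σ)) :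
    Run Γ (.seq (e.code 40) p) s c Q := fun σ hc hσ => by
  subst hc
  have value := e.delivers_code Γ.env Γ.hB 40 σ le_rfl (by omega) hok hσ
  have attained := h _ value.core_eq value.mem_self value.within
  exact ⟨attained.post, attained.within,
    attained.time_le.trans (by have := value.time_eq; omega)⟩

theorem Run.assign {d s : ℕ} {e : RExpr} (hs : e.cost + 2 ≤ s) (hd : d < 40) (he : e.depth ≤ 24)
    (hok : e.Ok Γ.W c.mem) (h : Q (c.set d (e.eval c.mem))) :
    Run Γ (assign d e) s c Q := by
  refine Run.expr 2 hs he hok fun σ hc hval hσ => ?_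
  have cleared := (hσ.delivers 41).put_spend Γ.hB (by norm_num) (by norm_num) (Nat.zero_le Γ.W)
  have value_le : e.eval c.mem ≤ Γ.W := hval ▸ hσ.mem_le 40
  have sum_eq : Op.add.eval (((σ.put 41 0).spend 1).mem 40) (((σ.put 41 0).spend 1).mem 41) =
      e.eval c.mem := by
    rw [cleared.mem_of_lt 40 le_rfl (by norm_num), cleared.mem_self, hval, Op.eval, add_zero]
  have hdB : d < Γ.B := hd.trans_le ((by norm_num : 40 ≤ 64).trans Γ.hB)
  rw [Prog.run, Prog.run, Prog.run, sum_eq]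
  refine ⟨?_, (cleared.within.put hdB value_le).spend 1, le_rfl⟩
  rwa [State.core_spend, State.core_put (Or.inl hd), cleared.core_eq, hc]

theorem Run.assign_seq {d s : ℕ} {e : RExpr} {p : Prog} (t : ℕ) (hs : e.cost + 2 + t ≤ s)
    (hd : d < 40) (he : e.depth ≤ 24) (hok : e.Ok Γ.W c.mem)
    (h : Run Γ p t (c.set d (e.eval c.mem)) Q) : Run Γ (.seq (FairConsensus.assign d e) p) s c Q :=
  Run.seq _ t hs (Run.assign le_rfl hd he hok h)

theorem Run.storeAt {s : ℕ} {x y : RExpr} (hs : x.cost + (y.cost + 1) ≤ s) (hx : x.depth ≤ 24)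
    (hy : y.depth ≤ 23) (hokx : x.Ok Γ.W c.mem) (hoky : y.Ok Γ.W c.mem) (h64 : 64 ≤ x.eval c.mem)
    (hlt : x.eval c.mem < Γ.B) (h : Q (c.set (x.eval c.mem) (y.eval c.mem))) :
    Run Γ (storeAt x y) s c Q := by
  refine Run.expr (y.cost + 1) hs hx hokx fun σ hc hval hσ => ?_
  subst hc
  have value := y.delivers_code Γ.env Γ.hB 41 σ (by norm_num) (by omega) hoky hσ
  rw [Prog.run, Prog.run, value.mem_of_lt 40 le_rfl (by norm_num), hval, value.mem_self]
  refine ⟨?_, (value.within.put hlt value.le).spend 1, ?_⟩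
  · rwa [State.core_spend, State.core_put (Or.inr h64), value.core_eq]
  · rw [State.spend_time, State.put_time, value.time_eq, add_assoc]

theorem Run.pushVal {s : ℕ} {e : RExpr} (hs : e.cost + 1 ≤ s) (he : e.depth ≤ 24)
    (hok : e.Ok Γ.W c.mem) (h : Q { c with arg := c.arg ++ [e.eval c.mem] }) :
    Run Γ (pushVal e) s c Q := by
  refine Run.expr 1 hs he hok fun σ hc hval hσ =>
    ⟨?_, ⟨hσ.mem_le, hσ.space_le, hσ.top_le⟩, le_rfl⟩
  subst hc
  rwa [← hval] at h

theorem Run.emitVal {s : ℕ} {e : RExpr} (hs : e.cost + 1 ≤ s) (he : e.depth ≤ 24)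
    (hok : e.Ok Γ.W c.mem) (h : Q { c with out := c.out ++ [e.eval c.mem] }) :
    Run Γ (emitVal e) s c Q := by
  refine Run.expr 1 hs he hok fun σ hc hval hσ =>
    ⟨?_, ⟨hσ.mem_le, hσ.space_le, hσ.top_le⟩, le_rfl⟩
  subst hc
  rwa [← hval] at h

theorem Run.branch {e : RExpr} {p q : Prog} {s : ℕ} (t : ℕ) (hs : e.cost + (t + 1) ≤ s)
    (he : e.depth ≤ 24) (hok : e.Ok Γ.W c.mem)
    (hp : e.eval c.mem = 0 → Run Γ p t c Q) (hq : e.eval c.mem ≠ 0 → Run Γ q t c Q) :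
    Run Γ (branch e p q) s c Q := by
  refine Run.expr (t + 1) hs he hok fun σ hc hval hσ => ?_
  rw [Prog.run, hval, add_comm t, ← add_assoc, ← State.spend_time]
  split_ifs with h0
  · exact hp h0 (σ.spend 1) hc (hσ.spend 1)
  · exact hq h0 (σ.spend 1) hc (hσ.spend 1)

theorem Attains.iterate {p : Prog} {t N : ℕ} {inv : ℕ → Core → Prop} {σ : State} {s : ℕ}
    (h0 : Attains Γ (inv 0) s σ)
    (hstep : ∀ i < N, ∀ c', inv i c' → Run Γ p t c' (inv (i + 1))) :
    Attains Γ (inv N) (s + N * (t + 1)) ((fun τ => (p.run Γ.env τ).spend 1)^[N] σ) := by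
  induction N with
  | zero => simpa only [zero_mul, add_zero, Function.iterate_zero, id] using h0
  | succ N ih =>
    have before := ih fun i hi => hstep i (hi.trans N.lt_succ_self)
    have round := hstep N N.lt_succ_self _ before.post _ rfl before.within
    rw [Function.iterate_succ_apply']
    refine ⟨round.post, round.within.spend 1, ?_⟩
    have := before.time_le
    have := round.time_le
    rw [State.spend_time, Nat.succ_mul]
    omega

theorem Run.repeatVal {e : RExpr} {p : Prog} {t : ℕ} (inv : ℕ → Core → Prop) (he : e.depth ≤ 24)
    (hok : e.Ok Γ.W c.mem) (h0 : inv 0 c)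
    (hstep : ∀ i < e.eval c.mem, ∀ c', inv i c' → Run Γ p t c' (inv (i + 1)))
    (hend : ∀ c', inv (e.eval c.mem) c' → Q c') :
    Run Γ (repeatVal e p) (e.cost + (1 + e.eval c.mem * (t + 1))) c Q := by
  refine Run.expr _ le_rfl he hok fun σ hc hval hσ => ?_
  have start : Attains Γ (inv 0) (σ.time + 1) (σ.spend 1) := ⟨hc ▸ h0, hσ.spend 1, le_rfl⟩
  have finish := start.iterate hstep
  rw [Prog.run, hval, ← add_assoc]
  exact ⟨hend _ finish.post, finish.within, finish.time_le⟩

/-- The invariant is stated for the moment before the counter is set. -/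
theorem Run.forLoop {r : ℕ} {e : RExpr} {p : Prog} {s : ℕ} (t N : ℕ) (inv : ℕ → Core → Prop)
    (hs : e.cost + 4 + N * (t + 7) ≤ s) (hr : r < 40)
    (he : e.depth ≤ 24) (hok : e.Ok Γ.W (c.set r 0).mem) (hN : e.eval (c.set r 0).mem = N)
    (hNW : N ≤ Γ.W) (hW : 1 ≤ Γ.W)
    (hinv : ∀ i c' x, inv i c' → inv i (c'.set r x)) (h0 : inv 0 c)
    (hstep : ∀ i < N, ∀ c', c'.mem r = i → inv i c' →
      Run Γ p t c' fun c'' => c''.mem r = i ∧ inv (i + 1) c'')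
    (hend : ∀ c', inv N c' → Q c') :
    Run Γ (forLoop r e p) s c Q := by
  have time_le : 3 + (e.cost + (1 + N * (t + 6 + 1))) ≤ s := by
    change 3 + (e.cost + (1 + N * (t + 7))) ≤ s
    omega
  refine Run.seq 3 _ time_le (Run.assign le_rfl hr (by decide) (Nat.zero_le _) ?_)
  subst hN
  refine Run.repeatVal (fun i c' => c'.mem r = i ∧ inv i c') he hok
    ⟨Function.update_self .., hinv 0 _ _ h0⟩ ?_ fun c' h => hend c' h.2
  rintro i hi c' ⟨counter, holds⟩
  refine Run.seq t 6 le_rfl ((hstep i hi c' counter holds).mono le_rfl ?_)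
  rintro c'' ⟨counter', holds'⟩
  refine Run.assign le_rfl hr (show max 1 (1 + 1) ≤ 24 by decide) ?_ ⟨?_, hinv _ _ _ holds'⟩
  · simp only [RExpr.ok_add, RExpr.ok_reg, RExpr.ok_lit, RExpr.eval_reg, RExpr.eval_lit, counter']
    omega
  · simp only [Core.set_mem, Function.update_self, RExpr.eval_add, RExpr.eval_reg, RExpr.eval_lit,
      counter']

theorem Run.rand {d a s : ℕ} (hs : 1 ≤ s) (hd : d < 40) (ha : a < 40) (hpos : 0 < c.mem a)
    (h : Q { c.set d (Γ.env.coins (c.draws, c.mem a - 1) : ℕ) with draws := c.draws + 1 }) :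
    Run Γ (.rand d a) s c Q := fun σ hc hσ => by
  have hB := Γ.hB
  subst hc
  rw [State.core_mem_of_not_scratch (Or.inl ha)] at h hpos
  have draw_le : (Γ.env.coins (σ.draws, σ.mem a - 1) : ℕ) ≤ Γ.W := by
    have := (Γ.env.coins (σ.draws, σ.mem a - 1)).isLt
    have := hσ.mem_le a
    omega
  have within := (hσ.put (show d < Γ.B by omega) draw_le).spend 1
  refine ⟨?_, ⟨within.mem_le, within.space_le, within.top_le⟩, Nat.add_le_add_left hs _⟩
  change Q { (σ.put d (Γ.env.coins (σ.draws, σ.mem a - 1))).core with draws := σ.draws + 1 }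
  rw [State.core_put (Or.inl hd)]
  exact h

/-! ### Subroutine calls -/

/-- Memory after a list has been written from address `b` on. -/
def writeList (μ : ℕ → ℕ) (b : ℕ) (L : List ℕ) (a : ℕ) : ℕ :=
  if b ≤ a ∧ a < b + L.length then L.getD (a - b) 0 else μ a

theorem writeList_nil (μ : ℕ → ℕ) (b : ℕ) : writeList μ b [] = μ := by
  funext a
  exact if_neg fun h => absurd h.2 h.1.not_gt

theorem writeList_cons (μ : ℕ → ℕ) (b x : ℕ) (L : List ℕ) :
    writeList μ b (x :: L) = writeList (Function.update μ b x) (b + 1) L := by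
  funext a
  unfold writeList
  rw [List.length_cons]
  rcases eq_or_ne a b with rfl | hab
  · rw [if_pos (by omega), if_neg (by omega), Nat.sub_self, List.getD_cons_zero,
      Function.update_self]
  · rw [Function.update_of_ne hab]
    by_cases h : b + 1 ≤ a ∧ a < b + 1 + L.length
    · rw [if_pos (by omega), if_pos h, show a - b = (a - (b + 1)) + 1 by omega,
        List.getD_cons_succ]
    · rw [if_neg (by omega), if_neg h]

theorem State.core_putList (L : List ℕ) (b : ℕ) (σ : State) (hb : 64 ≤ b) :
    (State.putList b L σ).core = { σ.core with mem := writeList σ.core.mem b L } := by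
  induction L generalizing b σ with
  | nil => rw [writeList_nil]; rfl
  | cons x L ih =>
    rw [putList, ih (b + 1) _ (by omega), core_put (Or.inr hb), writeList_cons]
    rfl

theorem State.Within.putList {B W : ℕ} {L : List ℕ} {b : ℕ} {σ : State} (hσ : σ.Within B W)
    (hB : b + L.length ≤ B) (hL : ∀ x ∈ L, x ≤ W) : (State.putList b L σ).Within B W := by
  induction L generalizing b σ with
  | nil => exact hσ
  | cons x L ih =>
    rw [List.length_cons] at hB
    exact ih (hσ.put (by omega) (hL x List.mem_cons_self)) (by omega)
      fun y hy => hL y (List.mem_cons_of_mem _ hy)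

theorem State.putList_time (L : List ℕ) (b : ℕ) (σ : State) :
    (State.putList b L σ).time = σ.time := by
  induction L generalizing b σ with
  | nil => rfl
  | cons x _ ih => exact ih (b + 1) (σ.put b x)

theorem Run.of_run_eq_call {p : Prog} {S : Subroutine} {a s : ℕ}
    (hp : ∀ σ, p.run Γ.env σ = σ.call S (σ.mem a))
    (hs : 1 + S.cost c.arg + (S.answer c.arg).length ≤ s) (ha : a < 40) (h64 : 64 ≤ c.mem a)
    (hB : c.mem a + (S.answer c.arg).length ≤ Γ.B) (hL : ∀ x ∈ S.answer c.arg, x ≤ Γ.W)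
    (h : Q { c with mem := writeList c.mem (c.mem a) (S.answer c.arg), arg := [] }) :
    Run Γ p s c Q := fun σ hc hσ => by
  subst hc
  rw [State.core_mem_of_not_scratch (Or.inl ha)] at h64 hB h
  have cleared : State.Within Γ.B Γ.W { σ with arg := [] } := ⟨hσ.mem_le, hσ.space_le, hσ.top_le⟩
  rw [hp, State.call]
  refine ⟨?_, (cleared.putList hB hL).spend _, ?_⟩
  · rw [State.core_spend, State.core_putList _ _ _ h64]
    exact h
  · rw [State.spend_time, State.putList_time]
    exact Nat.add_le_add_left hs _

end Rules

/-! ### The algorithm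

Registers: `0, 1, 2` hold `n`, `m`, `⌈1/ε⌉`; `3, …, 6` the current triple; `7` the number `S` of
clusterings from which candidates are formed; `8` the number `T` of sampled clusterings; `9` the
least cost of a candidate so far; `20, 21, 22` the base addresses of the labels of the sampled
clusterings, of the current and of the best candidate.  The sampled indices are stored from
address `64` on.  The registers `10, …, 16` are working space; `11` and `15` are loop counters. -/

section Programs

open RExpr

/-- Sample `T` clusterings with replacement. -/
def drawLoop : Prog :=
  forLoop 15 (reg 8) (.seq (.rand 16 1) (storeAt (lit 64 + reg 15) (reg 16)))

/-- Label every point by itself in every sampled clustering. -/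
def rowLoop : Prog :=
  forLoop 15 (reg 8 * reg 0) (storeAt (reg 20 + reg 15) (reg 15 % reg 0))

/-- The program that is run before the stream. -/
def initProg (C : ℕ) : Prog :=
  .seq (assign 7 (lit C * size (reg 1))) <|
  .seq (assign 8 (reg 7 * (reg 2 * reg 2))) <|
  .seq (assign 20 (lit 64 + reg 8)) <|
  .seq (assign 21 (reg 20 + reg 8 * reg 0)) <|
  .seq (assign 22 (reg 21 + reg 0)) <|
  .seq drawLoop rowLoop

/-- Replace the label of the point in register `p` by the point in register `q`, if that is
smaller. -/
def lower (p q : ℕ) : Prog :=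
  storeAt (reg 16 + reg p) (ld (reg 16 + reg p) - (ld (reg 16 + reg p) - reg q))

/-- Zero if the current triple joins two points of the sample that the counter `15` points to. -/
def mismatchExpr : RExpr := lit 1 - eq (ld (lit 64 + reg 15)) (reg 5) + reg 6

/-- The program that is run on each triple. -/
def updateProg : Prog :=
  forLoop 15 (reg 8) <|
    branch mismatchExpr
      (.seq (assign 16 (reg 20 + reg 15 * reg 0)) (.seq (lower 3 4) (lower 4 3)))
      .skip

/-- `1` if the sample and the current candidate disagree on the pair that is encoded by the counter
`15`, and `0` otherwise. -/
def disagreeExpr : RExpr :=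
  lit 1 - eq
    (eq (ld (reg 20 + reg 15 / reg 0))
      (ld (reg 20 + (reg 15 / reg 0 / reg 0 * reg 0 + reg 15 % reg 0))))
    (eq (ld (reg 21 + reg 15 / reg 0 % reg 0)) (ld (reg 21 + reg 15 % reg 0)))

/-- Compute the cost of the current candidate on the sample. -/
def costLoop : Prog :=
  .seq (assign 10 (lit 0)) <|
    forLoop 15 (reg 8 * (reg 0 * reg 0)) (assign 10 (reg 10 + disagreeExpr))

/-- Make the current candidate the best one. -/
def copyLoop : Prog :=
  forLoop 15 (reg 0) (storeAt (reg 22 + reg 15) (ld (reg 21 + reg 15)))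

/-- Compare the current candidate with the best one. -/
def consider : Prog :=
  .seq costLoop (branch (reg 9 - reg 10) .skip (.seq (assign 9 (reg 10)) copyLoop))

/-- Consider the fair clusterings close to the first `S` samples. -/
def clsLoop : Prog :=
  forLoop 11 (reg 7) <|
    .seq (forLoop 15 (reg 0) (pushVal (ld (reg 20 + (reg 11 * reg 0 + reg 15)))))
      (.seq (.callCls 21) consider)

/-- `1` if the pair that is encoded by the counter `15` is together in the clustering whose labels
start at the address in register `r`. -/
def together (r : ℕ) : RExpr :=
  eq (ld (reg r + reg 15 / reg 0)) (ld (reg r + reg 15 % reg 0))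

/-- The entry of the adjacency matrix of the majority graph that is encoded by the counter `15`. -/
def majorityExpr : RExpr :=
  (together 12 + (together 13 + together 14)) / lit 2 *
    (lit 1 - eq (reg 15 / reg 0) (reg 15 % reg 0))

/-- Point to the labels of the three samples that are encoded by the counter `11`. -/
def selectTriple : Prog :=
  .seq (assign 12 (reg 20 + reg 11 / reg 7 / reg 7 * reg 0)) <|
  .seq (assign 13 (reg 20 + reg 11 / reg 7 % reg 7 * reg 0))
    (assign 14 (reg 20 + reg 11 % reg 7 * reg 0))

/-- Consider the fair correlation clusterings of the majority graphs of triples of samples. -/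
def corLoop : Prog :=
  forLoop 11 (reg 7 * (reg 7 * reg 7)) <|
    .seq selectTriple <|
      .seq (forLoop 15 (reg 0 * reg 0) (pushVal majorityExpr)) (.seq (.callCor 21) consider)

/-- Output the best candidate. -/
def emitLoop : Prog := forLoop 15 (reg 0) (emitVal (ld (reg 22 + reg 15)))

/-- The program that is run after the stream.  The initial value of the register `9` exceeds the
cost of every candidate. -/
def queryProg : Prog :=
  .seq (assign 9 (reg 8 * (reg 0 * reg 0) + lit 1)) (.seq clsLoop (.seq corLoop emitLoop))

/-- The streaming algorithm: sample clusterings, recover their labels from the stream, form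
candidates from a part of the sample, and output the candidate that is best on the sample. -/
def algorithm (C : ℕ) : StreamAlg := ⟨initProg C, updateProg, queryProg⟩

end Programs

/-! #### Memory layout -/

/-- `c'` has the tapes of `c`, and the memory of `c` at all addresses that satisfy `P`. -/
structure AgreeOn (P : ℕ → Prop) (c c' : Core) : Prop where
  mem : ∀ a, P a → c'.mem a = c.mem a
  arg : c'.arg = c.arg
  out : c'.out = c.out

/-- Registers that keep their values after the initialization. -/
structure Regs (n m S T : ℕ) (c : Core) : Prop where
  r0 : c.mem 0 = n
  r1 : c.mem 1 = m
  r7 : c.mem 7 = S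
  r8 : c.mem 8 = T
  r20 : c.mem 20 = 64 + T
  r21 : c.mem 21 = 64 + T + T * n
  r22 : c.mem 22 = 64 + T + T * n + n

/-- The sampled indices. -/
def Indices (T : ℕ) (X : ℕ → ℕ) (c : Core) : Prop := ∀ t < T, c.mem (64 + t) = X t

/-- The labels of the sampled clusterings. -/
def Rows (n T : ℕ) (lab : ℕ → ℕ → ℕ) (c : Core) : Prop :=
  ∀ t < T, ∀ u < n, c.mem (64 + T + (t * n + u)) = lab t u

/-- The space is sufficient and words are large enough. -/
structure Room (n m S T : ℕ) (Γ : Setting) : Prop where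
  npos : 0 < n
  mpos : 0 < m
  space : Γ.B = 64 + T + T * n + n + n
  addr : 64 + T + T * n + n + n ≤ Γ.W
  cost : T * (n * n) + 1 ≤ Γ.W
  triples : S * (S * S) ≤ Γ.W
  pairs : n * n ≤ Γ.W
  le : S ≤ T

section Layout

variable {n m S T : ℕ} {c c' c'' : Core}

namespace AgreeOn

variable {P P' : ℕ → Prop}

theorem refl (P : ℕ → Prop) (c : Core) : AgreeOn P c c := ⟨fun _ _ => rfl, rfl, rfl⟩

theorem trans (h : AgreeOn P c c') (h' : AgreeOn P c' c'') : AgreeOn P c c'' :=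
  ⟨fun a ha => (h'.mem a ha).trans (h.mem a ha), h'.arg.trans h.arg, h'.out.trans h.out⟩

theorem mono (h : AgreeOn P c c') (hP : ∀ a, P' a → P a) : AgreeOn P' c c' :=
  ⟨fun a ha => h.mem a (hP a ha), h.arg, h.out⟩

theorem set (h : AgreeOn P c c') {d : ℕ} (hd : ¬ P d) (x : ℕ) : AgreeOn P c (c'.set d x) :=
  ⟨fun a ha => (Function.update_of_ne (by rintro rfl; exact hd ha) _ _).trans (h.mem a ha),
    h.arg, h.out⟩

end AgreeOn

theorem Regs.of_agreeOn {P : ℕ → Prop} (h : Regs n m S T c) (hcc' : AgreeOn P c c')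
    (hP : ∀ a, a < 2 ∨ 7 ≤ a ∧ a < 9 ∨ 20 ≤ a ∧ a < 23 → P a) : Regs n m S T c' where
  r0 := (hcc'.mem 0 (hP 0 (by norm_num))).trans h.r0
  r1 := (hcc'.mem 1 (hP 1 (by norm_num))).trans h.r1
  r7 := (hcc'.mem 7 (hP 7 (by norm_num))).trans h.r7
  r8 := (hcc'.mem 8 (hP 8 (by norm_num))).trans h.r8
  r20 := (hcc'.mem 20 (hP 20 (by norm_num))).trans h.r20
  r21 := (hcc'.mem 21 (hP 21 (by norm_num))).trans h.r21
  r22 := (hcc'.mem 22 (hP 22 (by norm_num))).trans h.r22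

theorem mul_add_lt {t u : ℕ} (ht : t < T) (hu : u < n) : t * n + u < T * n :=
  calc t * n + u < (t + 1) * n := by rw [Nat.succ_mul]; exact Nat.add_lt_add_left hu _
    _ ≤ T * n := Nat.mul_le_mul_right n ht

theorem mul_add_div_of_lt {t u : ℕ} (hu : u < n) : (t * n + u) / n = t := by
  rw [mul_comm, Nat.mul_add_div (Nat.zero_lt_of_lt hu), Nat.div_eq_of_lt hu, add_zero]

theorem mul_add_mod_of_lt {t u : ℕ} (hu : u < n) : (t * n + u) % n = u := by
  rw [mul_comm, Nat.mul_add_mod, Nat.mod_eq_of_lt hu]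

theorem Indices.of_agreeOn {P : ℕ → Prop} {X : ℕ → ℕ} (h : Indices T X c) (hcc' : AgreeOn P c c')
    (hP : ∀ a, 64 ≤ a → a < 64 + T → P a) : Indices T X c' := fun t ht =>
  (hcc'.mem _ (hP _ (by omega) (by omega))).trans (h t ht)

theorem Indices.succ {X : ℕ → ℕ} (h : Indices T X c) :
    Indices (T + 1) X (c.set (64 + T) (X T)) := fun t ht => by
  rcases Nat.lt_succ_iff_lt_or_eq.1 ht with ht | rfl
  · rw [Core.set_mem, Function.update_of_ne (by omega), h t ht]
  · rw [Core.set_mem, Function.update_self]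

theorem Rows.of_agreeOn {P : ℕ → Prop} {lab : ℕ → ℕ → ℕ} (h : Rows n T lab c)
    (hcc' : AgreeOn P c c') (hP : ∀ a, 64 + T ≤ a → a < 64 + T + T * n → P a) :
    Rows n T lab c' := fun t ht u hu =>
  (hcc'.mem _ (hP _ (by omega) (by have := mul_add_lt ht hu; omega))).trans (h t ht u hu)

/-! #### Initialization -/

variable {Γ : Setting}

theorem drawLoop_run (hΓ : Room n m S T Γ) (hc : Regs n m S T c) (hdraws : c.draws = 0) :
    Run Γ drawLoop (20 + 20 * T) c fun c' =>
      AgreeOn (fun a => a < 15 ∨ 17 ≤ a ∧ a < 64) c c' ∧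
        Indices T (fun t => (Γ.env.coins (t, m - 1) : ℕ)) c' := by
  have := hΓ.addr
  have := hΓ.space
  have := hΓ.npos
  refine Run.forLoop 8 T (fun i c' => (AgreeOn (fun a => a < 15 ∨ 17 ≤ a ∧ a < 64) c c' ∧
      c'.draws = i) ∧ Indices i (fun t => (Γ.env.coins (t, m - 1) : ℕ)) c')
    (by simp; omega) (by decide) (by decide) (by simp) (by simpa using hc.r8) (by omega)
    (by omega) ?_ ⟨⟨.refl _ c, hdraws⟩, fun t ht => absurd ht t.not_lt_zero⟩ ?_
    fun _ h => ⟨h.1.1, h.2⟩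
  · rintro i c' x ⟨⟨agree, draws⟩, indices⟩
    exact ⟨⟨agree.set (by omega) x, draws⟩,
      indices.of_agreeOn ((AgreeOn.refl (64 ≤ ·) c').set (by omega) x) (by omega)⟩
  · rintro i hi c' counter ⟨⟨agree, draws⟩, indices⟩
    have r1 : c'.mem 1 = m := (agree.mem 1 (by omega)).trans hc.r1
    refine Run.seq 1 7 le_rfl (Run.rand le_rfl (by decide) (by decide) (r1 ▸ hΓ.mpos) ?_)
    rw [r1, draws]
    refine Run.storeAt (by decide) (by decide) (by decide) ?_ (by simp) ?_ ?_ ?_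
    · simp [counter]; omega
    · simp [counter]
    · simp [counter]; omega
    simp only [RExpr.eval_add, RExpr.eval_lit, RExpr.eval_reg, Core.set_mem,
      Function.update_self, Function.update_of_ne (show (15 : ℕ) ≠ 16 by decide), counter]
    have drawn (x : ℕ) : AgreeOn (· ≠ 16) c' { c'.set 16 x with draws := i + 1 } :=
      ⟨((AgreeOn.refl _ c').set (by omega) x).mem, rfl, rfl⟩
    refine ⟨?_, ⟨(agree.trans ((drawn _).mono (by omega))).set (by omega) _, rfl⟩, ?_⟩
    · simp [Function.update_of_ne (show 15 ≠ 64 + i by omega), counter]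
    · exact (indices.of_agreeOn (drawn _) (by omega)).succ

theorem rowLoop_run (hΓ : Room n m S T Γ) (hc : Regs n m S T c) :
    Run Γ rowLoop (20 + 20 * (T * n)) c fun c' =>
      AgreeOn (fun a => a < 15 ∨ 16 ≤ a ∧ a < 64 + T) c c' ∧ Rows n T (fun _ u => u) c' := by
  have := hΓ.addr
  have := hΓ.space
  have := hΓ.npos
  refine Run.forLoop 11 (T * n) (fun i c' => AgreeOn (fun a => a < 15 ∨ 16 ≤ a ∧ a < 64 + T) c c' ∧
      ∀ q < i, c'.mem (64 + T + q) = q % n) (by simp; omega) (by decide) (by decide) ?_ ?_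
    (by omega) (by omega) ?_ ⟨.refl _ c, fun q hq => absurd hq q.not_lt_zero⟩ ?_ ?_
  · simp [hc.r8, hc.r0]; omega
  · simp [hc.r8, hc.r0]
  · rintro i c' x ⟨agree, written⟩
    refine ⟨agree.set (by omega) x, fun q hq => ?_⟩
    rw [Core.set_mem, Function.update_of_ne (by omega), written q hq]
  · rintro i hi c' counter ⟨agree, written⟩
    have regs : Regs n m S T c' := hc.of_agreeOn agree (by omega)
    refine Run.storeAt (by decide) (by decide) (by decide) ?_ (by simp) ?_ ?_ ?_
    · simp [counter, regs.r20]; omega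
    · simp [counter, regs.r20]; omega
    · simp [counter, regs.r20]; omega
    simp only [RExpr.eval_add, RExpr.eval_mod, RExpr.eval_reg, counter, regs.r20, regs.r0]
    refine ⟨?_, agree.set (by omega) _, fun q hq => ?_⟩
    · rw [Core.set_mem, Function.update_of_ne (by omega), counter]
    · rcases Nat.lt_succ_iff_lt_or_eq.1 hq with hq | rfl
      · rw [Core.set_mem, Function.update_of_ne (by omega), written q hq]
      · rw [Core.set_mem, Function.update_self]
  · rintro c' ⟨agree, written⟩
    exact ⟨agree, fun t ht u hu => (written _ (mul_add_lt ht hu)).trans (mul_add_mod_of_lt hu)⟩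

theorem initProg_run {C e : ℕ} (hΓ : Room n m S T Γ) (hS : S = C * Nat.size m)
    (hT : T = S * (e * e)) (hC : C ≤ Γ.W) (he : e * e ≤ Γ.W) (h0 : c.mem 0 = n) (h1 : c.mem 1 = m)
    (h2 : c.mem 2 = e) (hdraws : c.draws = 0) :
    Run Γ (initProg C) (200 + 20 * T + 20 * (T * n)) c fun c' =>
      AgreeOn (· < 7) c c' ∧ Regs n m S T c' ∧
        Indices T (fun t => (Γ.env.coins (t, m - 1) : ℕ)) c' ∧ Rows n T (fun _ u => u) c' := by
  have := hΓ.addr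
  have := hΓ.le
  refine Run.assign_seq (193 + 20 * T + 20 * (T * n)) (by simp; omega) (by decide)
    (show max 1 (1 + 1) ≤ 24 by decide) (by simp [h1, ← hS]; omega) ?_
  simp only [RExpr.eval_mul, RExpr.eval_lit, RExpr.eval_size, RExpr.eval_reg, h1, ← hS]
  refine Run.assign_seq (183 + 20 * T + 20 * (T * n)) (by simp; omega) (by decide) (by decide)
    (by simp [h2, ← hT]; omega) ?_
  refine Run.assign_seq (173 + 20 * T + 20 * (T * n)) (by simp; omega) (by decide) (by decide)
    (by simp [h2, ← hT]; omega) ?_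
  refine Run.assign_seq (163 + 20 * T + 20 * (T * n)) (by simp; omega) (by decide) (by decide)
    (by simp [h2, h0, ← hT]; omega) ?_
  refine Run.assign_seq (153 + 20 * T + 20 * (T * n)) (by simp; omega) (by decide) (by decide)
    (by simp [h2, h0, ← hT]; omega) ?_
  refine Run.seq (20 + 20 * T) (20 + 20 * (T * n)) (by omega)
    ((drawLoop_run (S := S) (T := T) (n := n) (m := m) hΓ ?_ ?_).mono le_rfl ?_)
  · constructor <;> simp [h0, h1, h2, ← hT]
  · exact hdraws
  rintro c' ⟨agree, indices⟩
  have regs : Regs n m S T c' := by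
    refine Regs.of_agreeOn ?_ agree (by omega)
    constructor <;> simp [h0, h1, h2, ← hT]
  refine (rowLoop_run hΓ regs).mono le_rfl ?_
  rintro c'' ⟨agree', rows⟩
  refine ⟨?_, regs.of_agreeOn agree' (by omega), indices.of_agreeOn agree' (by omega), rows⟩
  refine AgreeOn.trans ?_ ((agree.mono (by omega)).trans (agree'.mono (by omega)))
  exact (((((AgreeOn.refl _ c).set (by omega) _).set (by omega) _).set (by omega) _).set
    (by omega) _).set (by omega) _

end Layout

/-! #### Processing a triple -/

section ProcessTriple

variable {n m S T : ℕ} {c c' : Core}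

theorem Rows.set_row {lab : ℕ → ℕ → ℕ} (h : Rows n T lab c) {i w : ℕ} (hw : w < n)
    (x : ℕ) : Rows n T (Function.update lab i (Function.update (lab i) w x))
      (c.set (64 + T + (i * n + w)) x) := fun t ht u hu => by
  by_cases hti : t = i
  · subst hti
    by_cases huw : u = w
    · rw [huw, Core.set_mem, Function.update_self, Function.update_self, Function.update_self]
    · rw [Core.set_mem, Function.update_of_ne (by omega), h t ht u hu, Function.update_self,
        Function.update_of_ne huw]
  · have address_ne : t * n + u ≠ i * n + w := fun e => hti <| by
      rw [← mul_add_div_of_lt (t := t) hu, e, mul_add_div_of_lt hw]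
    rw [Core.set_mem, Function.update_of_ne (by omega), h t ht u hu, Function.update_of_ne hti]

theorem Rows.congr_lab {lab lab' : ℕ → ℕ → ℕ} (h : Rows n T lab c)
    (hlab : ∀ t < T, ∀ u < n, lab t u = lab' t u) : Rows n T lab' c := fun t ht u hu =>
  (h t ht u hu).trans (hlab t ht u hu)

/-- The effect of `lower` on the labels of a clustering. -/
def lowerRow (row : ℕ → ℕ) (p q : ℕ) : ℕ → ℕ := Function.update row p (min (row p) q)

/-- The effect of a triple on the labels of the sampled clusterings, whose indices are given
by `X`. -/
def labStep (X : ℕ → ℕ) (u v j b : ℕ) (lab : ℕ → ℕ → ℕ) (t : ℕ) : ℕ → ℕ :=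
  if X t = j ∧ b = 0 then lowerRow (lowerRow (lab t) u v) v u else lab t

theorem lower_run {Γ : Setting} {Q : Core → Prop} (hΓ : Room n m S T Γ) {lab : ℕ → ℕ → ℕ}
    (hlab : Rows n T lab c) {p q i x y : ℕ} (hp : p < 40) (hq : q < 40) (hi : i < T) (hx : x < n)
    (h16 : c.mem 16 = 64 + T + i * n) (hcp : c.mem p = x) (hcq : c.mem q = y)
    (h : Q (c.set (64 + T + (i * n + x)) (min (lab i x) y))) :
    Run Γ (lower p q) 24 c Q := by
  have := hΓ.addr
  have := hΓ.space
  have := mul_add_lt hi hx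
  have label : c.mem (64 + T + i * n + x) = lab i x := by rw [add_assoc, hlab i hi x hx]
  refine Run.storeAt (by simp) (show 2 ≤ 24 by decide) (show 3 ≤ 23 by decide) ?_ ?_ ?_ ?_ ?_
  · simp [hp, h16, hcp]; omega
  · simp [hp, hq, h16, hcp]; omega
  · simp [h16, hcp]; omega
  · simp [h16, hcp]; omega
  · simp only [RExpr.eval_add, RExpr.eval_sub, RExpr.eval_ld, RExpr.eval_reg, h16, hcp, hcq, label]
    rwa [Nat.sub_sub_eq_min, add_assoc]

/-- The registers `3, …, 6` hold the triple `((u, v), j, b)`. -/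
structure Holds (u v j b : ℕ) (c : Core) : Prop where
  r3 : c.mem 3 = u
  r4 : c.mem 4 = v
  r5 : c.mem 5 = j
  r6 : c.mem 6 = b

theorem Holds.of_agreeOn {P : ℕ → Prop} {u v j b : ℕ} (h : Holds u v j b c)
    (hcc' : AgreeOn P c c') (hP : ∀ a, 3 ≤ a → a < 7 → P a) : Holds u v j b c' where
  r3 := (hcc'.mem 3 (hP 3 (by norm_num) (by norm_num))).trans h.r3
  r4 := (hcc'.mem 4 (hP 4 (by norm_num) (by norm_num))).trans h.r4
  r5 := (hcc'.mem 5 (hP 5 (by norm_num) (by norm_num))).trans h.r5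
  r6 := (hcc'.mem 6 (hP 6 (by norm_num) (by norm_num))).trans h.r6

section

variable {Γ : Setting} {X : ℕ → ℕ} {lab : ℕ → ℕ → ℕ} {u v j b i : ℕ}

theorem mismatchExpr_ok (hΓ : Room n m S T Γ) (hX : Indices T X c) (hxb : Holds u v j b c)
    (hb : b ≤ 1) (hi : i < T) (h15 : c.mem 15 = i) : mismatchExpr.Ok Γ.W c.mem := by
  have := hΓ.addr
  have := hΓ.npos
  have value_le : 1 - (if X i = j then 1 else 0) + b ≤ Γ.W := by omega
  simpa [mismatchExpr, h15, hX i hi, hxb.r5, hxb.r6, value_le] using by omega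

theorem eval_mismatchExpr_eq_zero_iff (hX : Indices T X c) (hxb : Holds u v j b c) (hi : i < T)
    (h15 : c.mem 15 = i) : mismatchExpr.eval c.mem = 0 ↔ X i = j ∧ b = 0 := by
  simp only [mismatchExpr, RExpr.eval_add, RExpr.eval_sub, RExpr.eval_eq, RExpr.eval_lit,
    RExpr.eval_ld, RExpr.eval_reg, h15, hX i hi, hxb.r5, hxb.r6]
  split_ifs with h <;> simp [h]

theorem joinRow_run (hΓ : Room n m S T Γ) (hc : Regs n m S T c) (hlab : Rows n T lab c)
    (hxb : Holds u v j b c) (hu : u < n) (hv : v < n) (hi : i < T) (h15 : c.mem 15 = i) :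
    Run Γ (.seq (assign 16 (.reg 20 + .reg 15 * .reg 0)) (.seq (lower 3 4) (lower 4 3))) 80 c
      fun c' => AgreeOn (fun a => a < 16 ∨ 17 ≤ a ∧ a < 64 + T) c c' ∧
        Rows n T (Function.update lab i (lowerRow (lowerRow (lab i) u v) v u)) c' := by
  have := hΓ.addr
  have := mul_add_lt hi hu
  refine Run.assign_seq 48 (by decide) (by decide) (by decide) ?_ ?_
  · simp [h15, hc.r20, hc.r0]; omega
  simp only [RExpr.eval_add, RExpr.eval_mul, RExpr.eval_reg, h15, hc.r20, hc.r0]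
  have agree : AgreeOn (· ≠ 16) c (c.set 16 (64 + T + i * n)) := (AgreeOn.refl _ c).set (by omega) _
  have rows := hlab.of_agreeOn agree (by omega)
  have triple := hxb.of_agreeOn agree (by omega)
  have base : (c.set 16 (64 + T + i * n)).mem 16 = 64 + T + i * n := by
    rw [Core.set_mem, Function.update_self]
  refine Run.seq 24 24 le_rfl (lower_run hΓ rows (by decide) (by decide) hi hu base triple.r3
    triple.r4 ?_)
  have agree' := (AgreeOn.refl (· < 64 + T) (c.set 16 (64 + T + i * n))).set
    (d := 64 + T + (i * n + u)) (by omega) (min (lab i u) v)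
  have triple' := triple.of_agreeOn agree' (by omega)
  have rows' := rows.set_row (i := i) hu (min (lab i u) v)
  refine lower_run hΓ rows' (by decide) (by decide) hi hv ((agree'.mem 16 (by omega)).trans base)
    triple'.r4 triple'.r3 ⟨?_, ?_⟩
  · exact ((agree.mono (by omega)).trans (agree'.mono (by omega))).set (by omega) _
  · have rows'' := rows'.set_row (i := i) hv
      (min (Function.update lab i (Function.update (lab i) u (min (lab i u) v)) i v) u)
    rw [Function.update_idem, Function.update_self] at rows''
    rwa [Function.update_self]

theorem updateProg_run (hΓ : Room n m S T Γ) (hc : Regs n m S T c) (hX : Indices T X c)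
    (hlab : Rows n T lab c) (hxb : Holds u v j b c) (hu : u < n) (hv : v < n) (hb : b ≤ 1) :
    Run Γ updateProg (20 + 120 * T) c fun c' =>
      AgreeOn (fun a => a < 15 ∨ 17 ≤ a ∧ a < 64 + T) c c' ∧
        Rows n T (labStep X u v j b lab) c' := by
  have := hΓ.addr
  have := hΓ.npos
  refine Run.forLoop 110 T (fun i c' => AgreeOn (fun a => a < 15 ∨ 17 ≤ a ∧ a < 64 + T) c c' ∧
      Rows n T (fun t => if t < i then labStep X u v j b lab t else lab t) c') (by simp; omega)
    (by decide) (by decide) (by simp) (by simpa using hc.r8) (by omega) (by omega) ?_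
    ⟨.refl _ c, hlab⟩ ?_ ?_
  · rintro i c' x ⟨agree, rows⟩
    exact ⟨agree.set (by omega) x, rows.of_agreeOn ((AgreeOn.refl (· ≠ 15) c').set (by omega) x)
      (by omega)⟩
  · rintro i hi c' counter ⟨agree, rows⟩
    have triple := hxb.of_agreeOn agree (by omega)
    have indices := hX.of_agreeOn agree (by omega)
    have matches_iff := eval_mismatchExpr_eq_zero_iff indices triple hi counter
    refine Run.branch 80 (by decide) (by decide) (mismatchExpr_ok hΓ indices triple hb hi counter)
      (fun hzero => ?_) fun hne => ?_
    · refine (joinRow_run hΓ (hc.of_agreeOn agree (by omega)) rows triple hu hv hi counter).mono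
        le_rfl ?_
      rintro c'' ⟨agree', rows'⟩
      refine ⟨(agree'.mem 15 (by omega)).trans counter, agree.trans (agree'.mono (by omega)),
        rows'.congr_lab fun t _ _ _ => ?_⟩
      rcases eq_or_ne t i with rfl | hti
      · simp [labStep, matches_iff.1 hzero]
      · have lt_iff : t < i + 1 ↔ t < i := by omega
        simp only [Function.update_of_ne hti, lt_iff]
    · have no_match : ¬ (X i = j ∧ b = 0) := hne ∘ matches_iff.2
      refine Run.skip (by decide) ⟨counter, agree, rows.congr_lab fun t _ _ _ => ?_⟩
      rcases eq_or_ne t i with rfl | hti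
      · simp [labStep, no_match]
      · have lt_iff : t < i + 1 ↔ t < i := by omega
        simp only [lt_iff]
  · rintro c' ⟨agree, rows⟩
    exact ⟨agree, rows.congr_lab fun t ht u _ => congrFun (if_pos ht) u⟩

end

end ProcessTriple

/-! #### Evaluating candidates -/

section Evaluate

variable {n m S T : ℕ} {c c' : Core}

/-- The registers and the labels of the samples when the query starts. -/
structure Sketch (n m S T : ℕ) (lab : ℕ → ℕ → ℕ) (c : Core) : Prop extends Regs n m S T c where
  rows : Rows n T lab c

theorem Sketch.of_agreeOn {P : ℕ → Prop} {lab : ℕ → ℕ → ℕ} (h : Sketch n m S T lab c)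
    (hcc' : AgreeOn P c c') (hP : ∀ a, a < 9 ∨ 20 ≤ a ∧ a < 64 + T + T * n → P a) :
    Sketch n m S T lab c' :=
  ⟨h.toRegs.of_agreeOn hcc' fun a ha => hP a (by omega),
    h.rows.of_agreeOn hcc' fun a _ _ => hP a (by omega)⟩

/-- `L` is stored from address `b` on. -/
def Buffer (n b : ℕ) (L : List ℕ) (c : Core) : Prop := ∀ u < n, c.mem (b + u) = L.getD u 0

theorem Buffer.of_agreeOn {P : ℕ → Prop} {b : ℕ} {L : List ℕ} (h : Buffer n b L c)
    (hcc' : AgreeOn P c c') (hP : ∀ a, b ≤ a → a < b + n → P a) : Buffer n b L c' := fun u hu =>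
  (hcc'.mem _ (hP _ (by omega) (by omega))).trans (h u hu)

theorem exists_mul_add_eq {q : ℕ} (hq : q < T * n) : ∃ t < T, ∃ u < n, q = t * n + u :=
  have hn : 0 < n := Nat.pos_of_mul_pos_left (Nat.zero_lt_of_lt hq)
  ⟨q / n, (Nat.div_lt_iff_lt_mul hn).2 hq, q % n, Nat.mod_lt _ hn, (Nat.div_add_mod' q n).symm⟩

/-- `1` if the labels of sample `t` and the labels `L` disagree about the pair `u`, `v`, and `0`
otherwise. -/
def pairCost (lab : ℕ → ℕ → ℕ) (L : List ℕ) (t u v : ℕ) : ℕ :=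
  if (lab t u = lab t v ↔ L.getD u 0 = L.getD v 0) then 0 else 1

theorem pairCost_le_one (lab : ℕ → ℕ → ℕ) (L : List ℕ) (t u v : ℕ) : pairCost lab L t u v ≤ 1 := by
  unfold pairCost
  split_ifs <;> simp

/-- The number of pairs of a sample and an ordered pair of points that are encoded by a number less
than `N` and on which `L` and the sample disagree. -/
def partialCost (n N : ℕ) (lab : ℕ → ℕ → ℕ) (L : List ℕ) : ℕ :=
  ∑ q ∈ Finset.range N, pairCost lab L (q / n / n) (q / n % n) (q % n)

/-- The cost of `L` on the samples, over ordered pairs of points. -/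
def sampleCost (n T : ℕ) (lab : ℕ → ℕ → ℕ) (L : List ℕ) : ℕ := partialCost n (T * (n * n)) lab L

theorem partialCost_le (N : ℕ) (lab : ℕ → ℕ → ℕ) (L : List ℕ) : partialCost n N lab L ≤ N :=
  (Finset.sum_le_card_nsmul _ _ 1 fun _ _ => pairCost_le_one _ _ _ _ _).trans (by simp)

theorem partialCost_succ {t u v : ℕ} (hu : u < n) (hv : v < n) (lab : ℕ → ℕ → ℕ) (L : List ℕ) :
    partialCost n ((t * n + u) * n + v + 1) lab L =
      partialCost n ((t * n + u) * n + v) lab L + pairCost lab L t u v := by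
  rw [partialCost, Finset.sum_range_succ, mul_add_mod_of_lt hv, mul_add_div_of_lt hv,
    mul_add_div_of_lt hu, mul_add_mod_of_lt hu, partialCost]

section

variable {Γ : Setting} {lab : ℕ → ℕ → ℕ} {L : List ℕ}

theorem disagreeExpr_ok {t u v : ℕ} (hΓ : Room n m S T Γ) (hc : Sketch n m S T lab c) (ht : t < T)
    (hu : u < n) (hv : v < n) (h15 : c.mem 15 = (t * n + u) * n + v) :
    disagreeExpr.Ok Γ.W c.mem := by
  have := hΓ.addr
  have := mul_add_lt ht hu
  have := mul_add_lt ht hv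
  simp [disagreeExpr, hc.r20, hc.r21, hc.r0, h15, mul_add_div_of_lt hv, mul_add_mod_of_lt hv,
    mul_add_div_of_lt hu, mul_add_mod_of_lt hu]
  omega

theorem eval_disagreeExpr {t u v : ℕ} (hc : Sketch n m S T lab c)
    (hL : Buffer n (64 + T + T * n) L c) (ht : t < T) (hu : u < n) (hv : v < n)
    (h15 : c.mem 15 = (t * n + u) * n + v) : disagreeExpr.eval c.mem = pairCost lab L t u v := by
  simp only [disagreeExpr, RExpr.eval_sub, RExpr.eval_lit, RExpr.eval_eq, RExpr.eval_ld,
    RExpr.eval_add, RExpr.eval_mul, RExpr.eval_div, RExpr.eval_mod, RExpr.eval_reg, hc.r20, hc.r21,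
    hc.r0, h15, mul_add_div_of_lt hv, mul_add_mod_of_lt hv, mul_add_div_of_lt hu,
    mul_add_mod_of_lt hu, hc.rows t ht u hu, hc.rows t ht v hv, hL u hu, hL v hv, pairCost]
  by_cases hlab : lab t u = lab t v <;> by_cases hLuv : L.getD u 0 = L.getD v 0 <;>
    simp [hlab, hLuv, -List.getD_eq_getElem?_getD]

theorem costLoop_run (hΓ : Room n m S T Γ) (hc : Sketch n m S T lab c)
    (hL : Buffer n (64 + T + T * n) L c) :
    Run Γ costLoop (20 + 260 * (T * (n * n))) c fun c' =>
      AgreeOn (fun a => a ≠ 10 ∧ a ≠ 15) c c' ∧ c'.mem 10 = sampleCost n T lab L := by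
  have := hΓ.addr
  have := hΓ.npos
  have := hΓ.cost
  have := hΓ.pairs
  refine Run.assign_seq (17 + 260 * (T * (n * n))) (by simp; omega) (by decide) (by decide)
    (by simp) ?_
  refine Run.forLoop 250 (T * (n * n)) (fun i c' => AgreeOn (fun a => a ≠ 10 ∧ a ≠ 15) c c' ∧
      c'.mem 10 = partialCost n i lab L) (by simp; omega) (by decide) (by decide) ?_ ?_
    (by omega) (by omega) ?_ ⟨(AgreeOn.refl _ c).set (by omega) _, by simp [partialCost]⟩ ?_
    fun _ h => h
  · simp [hc.r0, hc.r8]; omega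
  · simp [hc.r0, hc.r8]
  · rintro i c' x ⟨agree, cost⟩
    exact ⟨agree.set (by omega) x, by simpa using cost⟩
  · rintro i hi c' counter ⟨agree, cost⟩
    have sketch := hc.of_agreeOn agree (by omega)
    have candidate := hL.of_agreeOn agree (by omega)
    have cost_le := partialCost_le (n := n) i lab L
    obtain ⟨q, hq, v, hv, rfl⟩ := exists_mul_add_eq (n := n) (by rwa [mul_assoc])
    obtain ⟨t, ht, u, hu, rfl⟩ := exists_mul_add_eq hq
    have disagree := eval_disagreeExpr sketch candidate ht hu hv counter
    have := pairCost_le_one lab L t u v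
    refine Run.assign (by decide) (by decide) (by decide) ?_ ?_
    · simp only [RExpr.ok_add, RExpr.ok_reg, RExpr.eval_reg, cost, disagree]
      exact ⟨by decide, disagreeExpr_ok hΓ sketch ht hu hv counter, by omega⟩
    · simp only [RExpr.eval_add, RExpr.eval_reg, cost, disagree]
      exact ⟨by simpa using counter, agree.set (by omega) _, by simp [partialCost_succ hu hv]⟩

theorem copyLoop_run (hΓ : Room n m S T Γ) (hc : Regs n m S T c)
    (hL : Buffer n (64 + T + T * n) L c) :
    Run Γ copyLoop (20 + 30 * n) c fun c' =>
      AgreeOn (fun a => a ≠ 15 ∧ a < 64 + T + T * n + n) c c' ∧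
        Buffer n (64 + T + T * n + n) L c' := by
  have := hΓ.addr
  have := hΓ.npos
  have := hΓ.space
  refine Run.forLoop 20 n (fun i c' => AgreeOn (fun a => a ≠ 15 ∧ a < 64 + T + T * n + n) c c' ∧
      Buffer i (64 + T + T * n + n) L c') (by simp; omega) (by decide) (by decide) (by simp)
    (by simpa using hc.r0) (by omega) (by omega) ?_
    ⟨.refl _ c, fun u hu => absurd hu u.not_lt_zero⟩ ?_ fun _ h => h
  · rintro i c' x ⟨agree, copied⟩
    exact ⟨agree.set (by omega) x,
      copied.of_agreeOn ((AgreeOn.refl (· ≠ 15) c').set (by omega) x) (by omega)⟩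
  · rintro i hi c' counter ⟨agree, copied⟩
    have regs := hc.of_agreeOn agree (by omega)
    have label := hL.of_agreeOn agree (by omega) i hi
    refine Run.storeAt (by decide) (by decide) (by decide) ?_ ?_ ?_ ?_ ?_
    · simp [counter, regs.r22]; omega
    · simp [counter, regs.r21]; omega
    · simp [counter, regs.r22]; omega
    · simp [counter, regs.r22]; omega
    simp only [RExpr.eval_add, RExpr.eval_ld, RExpr.eval_reg, counter, regs.r21, regs.r22, label]
    refine ⟨?_, agree.set (by omega) _, fun u hu => ?_⟩
    · rw [Core.set_mem, Function.update_of_ne (by omega), counter]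
    · rcases Nat.lt_succ_iff_lt_or_eq.1 hu with hu | rfl
      · rw [Core.set_mem, Function.update_of_ne (by omega), copied u hu]
      · rw [Core.set_mem, Function.update_self]

/-- The best of the candidates in `Done` is stored, with its cost. -/
structure Best (n T : ℕ) (lab : ℕ → ℕ → ℕ) (Done : Set (List ℕ)) (c : Core) : Prop where
  le : ∀ L ∈ Done, c.mem 9 ≤ sampleCost n T lab L
  eq : c.mem 9 = T * (n * n) + 1 ∨ ∃ L ∈ Done, c.mem 9 = sampleCost n T lab L ∧
    Buffer n (64 + T + T * n + n) L c

theorem Best.of_agreeOn {P : ℕ → Prop} {Done : Set (List ℕ)} (h : Best n T lab Done c)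
    (hcc' : AgreeOn P c c') (h9 : P 9)
    (hP : ∀ a, 64 + T + T * n + n ≤ a → a < 64 + T + T * n + n + n → P a) :
    Best n T lab Done c' := by
  have cost_eq := hcc'.mem 9 h9
  exact ⟨fun L hL => cost_eq.trans_le (h.le L hL), h.eq.imp cost_eq.trans
    fun ⟨L, hL, cost, buffer⟩ => ⟨L, hL, cost_eq.trans cost, buffer.of_agreeOn hcc' hP⟩⟩

theorem consider_run (hΓ : Room n m S T Γ) (hc : Sketch n m S T lab c)
    (hL : Buffer n (64 + T + T * n) L c) {Done : Set (List ℕ)} (hbest : Best n T lab Done c) :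
    Run Γ consider (60 + 260 * (T * (n * n)) + 30 * n) c fun c' =>
      AgreeOn (fun a => a ≠ 9 ∧ a ≠ 10 ∧ a ≠ 15 ∧ a < 64 + T + T * n) c c' ∧
        Best n T lab (insert L Done) c' := by
  refine Run.seq (20 + 260 * (T * (n * n))) (40 + 30 * n) (by omega)
    ((costLoop_run hΓ hc hL).mono le_rfl ?_)
  rintro c₁ ⟨agree, cost⟩
  have best := hbest.of_agreeOn agree (by omega) (by omega)
  refine Run.branch (30 + 30 * n) (by simp; omega) (by decide) (by simp) (fun hle => ?_)
    fun hlt => ?_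
  · rw [RExpr.eval_sub, RExpr.eval_reg, RExpr.eval_reg, cost, Nat.sub_eq_zero_iff_le] at hle
    exact Run.skip (by omega) ⟨agree.mono (by omega), Set.forall_mem_insert.2 ⟨hle, best.le⟩,
      best.eq.imp_right fun ⟨L', hL', h⟩ => ⟨L', Set.mem_insert_of_mem L hL', h⟩⟩
  · rw [RExpr.eval_sub, RExpr.eval_reg, RExpr.eval_reg, cost, Nat.sub_ne_zero_iff_lt] at hlt
    refine Run.assign_seq (20 + 30 * n) (by simp; omega) (by decide) (by decide) (by simp) ?_
    rw [RExpr.eval_reg, cost]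
    have agree₁ := (agree.mono (P' := fun a => a ≠ 9 ∧ a ≠ 10 ∧ a ≠ 15) (by omega)).set
      (d := 9) (by omega) (sampleCost n T lab L)
    refine (copyLoop_run hΓ (hc.toRegs.of_agreeOn agree₁ (by omega))
      (hL.of_agreeOn agree₁ (by omega))).mono le_rfl ?_
    rintro c₂ ⟨agree₂, buffer⟩
    have cost' : c₂.mem 9 = sampleCost n T lab L := by
      rw [agree₂.mem 9 (by omega), Core.set_mem, Function.update_self]
    refine ⟨(agree₁.mono (by omega)).trans (agree₂.mono (by omega)), ?_,
      Or.inr ⟨L, Set.mem_insert L Done, cost', buffer⟩⟩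
    rw [cost']
    exact Set.forall_mem_insert.2 ⟨le_rfl, fun L' hL' => hlt.le.trans (best.le L' hL')⟩

end

end Evaluate

/-! #### The query -/

section Query

variable {n m S T : ℕ} {c c' : Core} {Γ : Setting} {lab : ℕ → ℕ → ℕ}

theorem pushLoop_run {e e' : RExpr} {N s t : ℕ} (f : ℕ → ℕ)
    (hs : e'.cost + 4 + N * (t + 7) ≤ s) (ht : e.cost + 1 ≤ t) (hd : e.depth ≤ 24)
    (hd' : e'.depth ≤ 24) (hok : e'.Ok Γ.W (c.set 15 0).mem) (hN : e'.eval (c.set 15 0).mem = N)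
    (hNW : N ≤ Γ.W) (hW : 1 ≤ Γ.W)
    (he : ∀ i < N, ∀ c' : Core, c'.mem 15 = i → (∀ a, a ≠ 15 → c'.mem a = c.mem a) →
      e.Ok Γ.W c'.mem ∧ e.eval c'.mem = f i) :
    Run Γ (forLoop 15 e' (pushVal e)) s c
      (AgreeOn (· ≠ 15) { c with arg := c.arg ++ (List.range N).map f }) := by
  refine Run.forLoop t N (fun i =>
      AgreeOn (· ≠ 15) { c with arg := c.arg ++ (List.range i).map f }) hs (by decide) hd' hok hN
    hNW hW (fun i c' x agree => agree.set (by omega) x) ⟨fun _ _ => rfl, by simp, rfl⟩ ?_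
    fun _ h => h
  rintro i hi c' counter agree
  obtain ⟨ok, eval⟩ := he i hi c' counter agree.mem
  refine Run.pushVal ht hd ok ⟨counter, agree.mem, ?_, agree.out⟩
  rw [eval, agree.arg, List.range_succ, List.map_append, ← List.append_assoc]
  rfl

theorem emitLoop_run (hΓ : Room n m S T Γ) (hc : Regs n m S T c) (hout : c.out = []) {L : List ℕ}
    (hLn : L.length = n) (hL : Buffer n (64 + T + T * n + n) L c) :
    Run Γ emitLoop (20 + 20 * n) c fun c' => c'.out = L := by
  have := hΓ.addr
  have := hΓ.npos
  refine Run.forLoop 13 n (fun i => AgreeOn (· ≠ 15) { c with out := L.take i }) (by simp; omega)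
    (by decide) (by decide) (by simp) (by simpa using hc.r0) (by omega) (by omega)
    (fun i c' x agree => agree.set (by omega) x) ⟨fun _ _ => rfl, rfl, hout⟩ ?_
    fun c' agree => agree.out.trans (List.take_of_length_le hLn.le)
  rintro i hi c' counter agree
  have r22 : c'.mem 22 = _ := (agree.mem 22 (by decide)).trans hc.r22
  have label := (agree.mem (64 + T + T * n + n + i) (by omega)).trans (hL i hi)
  refine Run.emitVal (by decide) (by decide) ?_ ⟨counter, agree.mem, agree.arg, ?_⟩
  · simp [r22, counter]; omega
  · have hi' : i < L.length := hLn.symm ▸ hi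
    simp only [RExpr.eval_ld, RExpr.eval_add, RExpr.eval_reg, r22, counter, label, agree.out]
    rw [List.getD_eq_getElem L 0 hi', List.take_append_getElem hi']

/-- `A` answers the question `w` by `n` labels less than `n`, in time at most `t`. -/
structure Subroutine.AnswersWithin (A : Subroutine) (n t : ℕ) (w : List ℕ) : Prop where
  cost_le : A.cost w ≤ t
  length_eq : (A.answer w).length = n
  lt : ∀ x ∈ A.answer w, x < n

/-- The state of the query after the candidates in `Done` have been considered. -/
structure QueryInv (n m S T : ℕ) (lab : ℕ → ℕ → ℕ) (Done : Set (List ℕ)) (c : Core) : Prop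
    extends Sketch n m S T lab c where
  arg : c.arg = []
  out : c.out = []
  best : Best n T lab Done c

theorem QueryInv.of_agreeOn {P : ℕ → Prop} {Done : Set (List ℕ)}
    (h : QueryInv n m S T lab Done c) (hcc' : AgreeOn P c c') (hP : ∀ a, a < 10 ∨ 20 ≤ a → P a) :
    QueryInv n m S T lab Done c' :=
  ⟨h.toSketch.of_agreeOn hcc' fun a ha => hP a (by omega), hcc'.arg.trans h.arg,
    hcc'.out.trans h.out, h.best.of_agreeOn hcc' (hP 9 (by omega)) fun a _ _ => hP a (by omega)⟩

theorem push_call_consider_run {push call : Prog} {A : Subroutine} {Done : Set (List ℕ)}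
    {w : List ℕ} {s t t' : ℕ} (hΓ : Room n m S T Γ) (hc : QueryInv n m S T lab Done c)
    (hs : t + (61 + 260 * (T * (n * n)) + 31 * n + t') ≤ s)
    (hpush : Run Γ push t c (AgreeOn (· ≠ 15) { c with arg := w }))
    (hcall : ∀ σ, call.run Γ.env σ = σ.call A (σ.mem 21)) (hA : A.AnswersWithin n t' w) :
    Run Γ (.seq push (.seq call consider)) s c fun c' =>
      c'.mem 11 = c.mem 11 ∧ QueryInv n m S T lab (insert (A.answer w) Done) c' := by
  have := hΓ.addr
  have := hΓ.space
  obtain ⟨cost_le, length_eq, lt⟩ := hA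
  refine Run.seq t _ hs (hpush.mono le_rfl fun c₁ pushed => ?_)
  have r21 : c₁.mem 21 = 64 + T + T * n := (pushed.mem 21 (by decide)).trans hc.r21
  have hw : c₁.arg = w := pushed.arg
  subst hw
  refine Run.seq (1 + t' + n) (60 + 260 * (T * (n * n)) + 30 * n) (by omega)
    (Run.of_run_eq_call hcall (by omega) (by decide) (by omega) (by omega)
      (fun x hx => (lt x hx).le.trans (by omega)) ?_)
  rw [r21]
  have agree : AgreeOn (fun a => a ≠ 15 ∧ (a < 64 + T + T * n ∨ 64 + T + T * n + n ≤ a)) c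
      { c₁ with mem := writeList c₁.mem (64 + T + T * n) (A.answer c₁.arg), arg := [] } :=
    ⟨fun a ha => (if_neg (by omega)).trans (pushed.mem a ha.1), hc.arg.symm, pushed.out⟩
  refine (consider_run hΓ (hc.toSketch.of_agreeOn agree (by omega)) (L := A.answer c₁.arg)
    (fun u hu => ?_) (hc.best.of_agreeOn agree (by omega) (by omega))).mono le_rfl ?_
  · exact (if_pos (by omega)).trans (by rw [Nat.add_sub_cancel_left])
  · rintro c₂ ⟨agree₂, best⟩
    have agree' := (agree.mono (P' := fun a => a ≠ 9 ∧ a ≠ 10 ∧ a ≠ 15 ∧ a < 64 + T + T * n)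
      (by omega)).trans agree₂
    exact ⟨agree'.mem 11 (by omega), hc.toSketch.of_agreeOn agree' (by omega),
      agree'.arg.trans hc.arg, agree'.out.trans hc.out, best⟩

/-- The argument for the closest fair clustering subroutine: the labels of sample `t`. -/
def clsArg (n : ℕ) (lab : ℕ → ℕ → ℕ) (t : ℕ) : List ℕ := (List.range n).map (lab t)

theorem pushRow_run {t : ℕ} (hΓ : Room n m S T Γ) (hc : Sketch n m S T lab c) (harg : c.arg = [])
    (ht : t < T) (r11 : c.mem 11 = t) :
    Run Γ (forLoop 15 (.reg 0) (pushVal (.ld (.reg 20 + (.reg 11 * .reg 0 + .reg 15)))))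
      (20 + 30 * n) c (AgreeOn (· ≠ 15) { c with arg := clsArg n lab t }) := by
  have := hΓ.addr
  refine (pushLoop_run (t := 20) (N := n) (lab t) (by simp; omega) (by decide) (by decide)
    (by decide) (by simp) (by simpa using hc.r0) (by omega) (by omega) ?_).mono le_rfl
    fun c' pushed => by rwa [harg] at pushed
  intro u hu c' counter frame
  have r0 := (frame 0 (by decide)).trans hc.r0
  have r11 := (frame 11 (by decide)).trans r11
  have r20 := (frame 20 (by decide)).trans hc.r20
  have := mul_add_lt ht hu
  have label := (frame _ (by omega)).trans (hc.rows t ht u hu)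
  constructor
  · simp [r0, r11, r20, counter]
    omega
  · simp only [RExpr.eval_ld, RExpr.eval_add, RExpr.eval_mul, RExpr.eval_reg, r0, r11, r20, counter,
      label]

theorem insert_union_image_Iio {α : Type*} (D : Set α) (f : ℕ → α) (i : ℕ) :
    insert (f i) (D ∪ f '' Set.Iio i) = D ∪ f '' Set.Iio (i + 1) := by
  rw [← Set.union_insert, ← Set.image_insert_eq, Set.Iio_insert, ← Order.Iio_succ, Nat.succ_eq_succ]

theorem clsLoop_run (hΓ : Room n m S T Γ) {Done : Set (List ℕ)} {t₁ : ℕ}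
    (hcls : ∀ t < S, Γ.env.cls.AnswersWithin n t₁ (clsArg n lab t))
    (hc : QueryInv n m S T lab Done c) :
    Run Γ clsLoop (20 + S * (100 + 260 * (T * (n * n)) + 70 * n + t₁)) c (QueryInv n m S T lab
      (Done ∪ (fun t => Γ.env.cls.answer (clsArg n lab t)) '' Set.Iio S)) := by
  have := hΓ.addr
  have := hΓ.npos
  have := hΓ.space
  have := hΓ.le
  refine Run.forLoop (93 + 260 * (T * (n * n)) + 70 * n + t₁) S (fun i => QueryInv n m S T lab
      (Done ∪ (fun t => Γ.env.cls.answer (clsArg n lab t)) '' Set.Iio i)) ?_ (by decide)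
    (by decide) (by simp) (by simpa using hc.r7) (by omega) (by omega)
    (fun i c' x h => h.of_agreeOn ((AgreeOn.refl (· ≠ 11) c').set (by omega) x) (by omega))
    (by simpa using hc) ?_ fun _ h => h
  · rw [RExpr.cost_reg, show 93 + 260 * (T * (n * n)) + 70 * n + t₁ + 7 =
      100 + 260 * (T * (n * n)) + 70 * n + t₁ by omega]
    omega
  rintro i hi c₀ counter h
  refine (push_call_consider_run hΓ h (by omega)
    (pushRow_run hΓ h.toSketch h.arg (by omega) counter) (fun _ => rfl) (hcls i hi)).mono le_rfl
    fun c₁ ⟨r11, inv⟩ => ⟨r11.trans counter, ?_⟩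
  rwa [← insert_union_image_Iio]

/-- `1` if the pair that is encoded by `p` is together in sample `t`, and `0` otherwise. -/
def togetherBit (n : ℕ) (lab : ℕ → ℕ → ℕ) (t p : ℕ) : ℕ :=
  if lab t (p / n) = lab t (p % n) then 1 else 0

/-- The entry of the adjacency matrix of the majority graph of the samples `i`, `j`, `k` that is
encoded by `p`. -/
def majorityBit (n : ℕ) (lab : ℕ → ℕ → ℕ) (i j k p : ℕ) : ℕ :=
  (togetherBit n lab i p + (togetherBit n lab j p + togetherBit n lab k p)) / 2 *
    (1 - if p / n = p % n then 1 else 0)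

/-- The argument for the fair correlation clustering subroutine: the adjacency matrix of the
majority graph of the triple of samples that is encoded by `q`. -/
def corArg (n S : ℕ) (lab : ℕ → ℕ → ℕ) (q : ℕ) : List ℕ :=
  (List.range (n * n)).map (majorityBit n lab (q / S / S) (q / S % S) (q % S))

theorem togetherBit_le_one (lab : ℕ → ℕ → ℕ) (t p : ℕ) : togetherBit n lab t p ≤ 1 := by
  unfold togetherBit
  split_ifs <;> simp

theorem together_ok {r t p : ℕ} (hΓ : Room n m S T Γ) (hr : r < 40) (ht : t < T) (hp : p < n * n)
    (r0 : c.mem 0 = n) (hcr : c.mem r = 64 + T + t * n) (r15 : c.mem 15 = p) :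
    (together r).Ok Γ.W c.mem := by
  have := hΓ.addr
  obtain ⟨u, hu, v, hv, rfl⟩ := exists_mul_add_eq hp
  have := mul_add_lt ht hu
  have := mul_add_lt ht hv
  simp [together, hcr, r0, r15, hr, mul_add_div_of_lt hv, mul_add_mod_of_lt hv]
  omega

theorem eval_together {r t p : ℕ} (hlab : Rows n T lab c) (ht : t < T) (hp : p < n * n)
    (r0 : c.mem 0 = n) (hcr : c.mem r = 64 + T + t * n) (r15 : c.mem 15 = p) :
    (together r).eval c.mem = togetherBit n lab t p := by
  obtain ⟨u, hu, v, hv, rfl⟩ := exists_mul_add_eq hp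
  simp only [together, togetherBit, RExpr.eval_eq, RExpr.eval_ld, RExpr.eval_add, RExpr.eval_div,
    RExpr.eval_mod, RExpr.eval_reg, hcr, r0, r15, mul_add_div_of_lt hv, mul_add_mod_of_lt hv,
    add_assoc _ (t * n), hlab t ht u hu, hlab t ht v hv]

/-- The registers `12`, `13`, `14` point to the labels of the samples `i`, `j`, `k`. -/
structure Selected (n T i j k : ℕ) (c : Core) : Prop where
  r12 : c.mem 12 = 64 + T + i * n
  r13 : c.mem 13 = 64 + T + j * n
  r14 : c.mem 14 = 64 + T + k * n

theorem majorityExpr_spec {i j k p : ℕ} (hΓ : Room n m S T Γ) (hlab : Rows n T lab c)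
    (r0 : c.mem 0 = n) (hsel : Selected n T i j k c) (hi : i < T) (hj : j < T) (hk : k < T)
    (hp : p < n * n) (r15 : c.mem 15 = p) :
    majorityExpr.Ok Γ.W c.mem ∧ majorityExpr.eval c.mem = majorityBit n lab i j k p := by
  have := hΓ.addr
  have eval_i := eval_together hlab hi hp r0 hsel.r12 r15
  have eval_j := eval_together hlab hj hp r0 hsel.r13 r15
  have eval_k := eval_together hlab hk hp r0 hsel.r14 r15
  have i_le := togetherBit_le_one (n := n) lab i p
  have j_le := togetherBit_le_one (n := n) lab j p
  have k_le := togetherBit_le_one (n := n) lab k p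
  have half_le :
      (togetherBit n lab i p + (togetherBit n lab j p + togetherBit n lab k p)) / 2 ≤ 1 := by omega
  constructor
  · simp only [majorityExpr, RExpr.ok_mul, RExpr.ok_div, RExpr.ok_add, RExpr.ok_sub, RExpr.ok_lit,
      RExpr.ok_eq, RExpr.ok_mod, RExpr.ok_reg, RExpr.eval_add, RExpr.eval_div, RExpr.eval_sub,
      RExpr.eval_lit, eval_i, eval_j, eval_k,
      together_ok hΓ (by decide) hi hp r0 hsel.r12 r15,
      together_ok hΓ (by decide) hj hp r0 hsel.r13 r15,
      together_ok hΓ (by decide) hk hp r0 hsel.r14 r15]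
    exact ⟨⟨⟨trivial, ⟨trivial, trivial, by omega⟩, by omega⟩, by omega⟩,
      ⟨by omega, by omega, ⟨by decide, by decide⟩, by decide, by decide⟩,
      (Nat.mul_le_mul half_le (Nat.sub_le _ _)).trans (by omega)⟩
  · simp only [majorityExpr, majorityBit, RExpr.eval_mul, RExpr.eval_add, RExpr.eval_div,
      RExpr.eval_sub, RExpr.eval_lit, RExpr.eval_eq, RExpr.eval_mod, RExpr.eval_reg, eval_i, eval_j,
      eval_k, r0, r15]

theorem digits_lt_of_lt_cube {q : ℕ} (hST : S ≤ T) (hq : q < S * (S * S)) :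
    q / S / S < T ∧ q / S % S < T ∧ q % S < T := by
  have hS : 0 < S := Nat.pos_of_ne_zero (by rintro rfl; simp at hq)
  refine ⟨lt_of_lt_of_le ?_ hST, (Nat.mod_lt _ hS).trans_le hST, (Nat.mod_lt _ hS).trans_le hST⟩
  rwa [Nat.div_lt_iff_lt_mul hS, Nat.div_lt_iff_lt_mul hS, mul_assoc]

theorem selectTriple_run {q : ℕ} (hΓ : Room n m S T Γ) (hc : Regs n m S T c)
    (hq : q < S * (S * S)) (r11 : c.mem 11 = q) :
    Run Γ selectTriple 60 c fun c' => AgreeOn (fun a => a < 12 ∨ 15 ≤ a) c c' ∧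
      Selected n T (q / S / S) (q / S % S) (q % S) c' := by
  have := hΓ.addr
  have := hΓ.triples
  obtain ⟨hi, hj, hk⟩ := digits_lt_of_lt_cube hΓ.le hq
  have hi' := Nat.mul_le_mul_right n hi.le
  have hj' := Nat.mul_le_mul_right n hj.le
  have hk' := Nat.mul_le_mul_right n hk.le
  have := Nat.div_le_self q S
  have := Nat.div_le_self (q / S) S
  refine Run.assign_seq 40 (by decide) (by decide) (by decide) ?_ ?_
  · simp [hc.r20, hc.r7, hc.r0, r11]
    omega
  refine Run.assign_seq 20 (by decide) (by decide) (by decide) ?_ ?_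
  · simp [hc.r20, hc.r7, hc.r0, r11]
    omega
  refine Run.assign (by decide) (by decide) (by decide) ?_ ⟨?_, ?_, ?_, ?_⟩
  · simp [hc.r20, hc.r7, hc.r0, r11]
    omega
  · exact (((AgreeOn.refl _ c).set (by omega) _).set (by omega) _).set (by omega) _
  all_goals simp [hc.r20, hc.r7, hc.r0, r11]

theorem pushMatrix_run {q : ℕ} (hΓ : Room n m S T Γ) (hc : Sketch n m S T lab c) (harg : c.arg = [])
    (hq : q < S * (S * S)) (hsel : Selected n T (q / S / S) (q / S % S) (q % S) c) :
    Run Γ (forLoop 15 (.reg 0 * .reg 0) (pushVal majorityExpr)) (20 + 200 * (n * n)) c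
      (AgreeOn (· ≠ 15) { c with arg := corArg n S lab q }) := by
  have := hΓ.addr
  have := hΓ.pairs
  obtain ⟨hi, hj, hk⟩ := digits_lt_of_lt_cube hΓ.le hq
  refine (pushLoop_run (t := 193) (N := n * n) (majorityBit n lab (q / S / S) (q / S % S) (q % S))
    (by simp; omega) (by decide) (by decide) (by decide) (by simp [hc.r0]; omega)
    (by simp [hc.r0]) (by omega) (by omega) ?_).mono le_rfl
    fun c' pushed => by rwa [harg] at pushed
  intro p hp c' counter frame
  exact majorityExpr_spec hΓ (fun t ht u hu => (frame _ (by omega)).trans (hc.rows t ht u hu))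
    ((frame 0 (by decide)).trans hc.r0) ⟨(frame 12 (by decide)).trans hsel.r12,
      (frame 13 (by decide)).trans hsel.r13, (frame 14 (by decide)).trans hsel.r14⟩ hi hj hk hp
    counter

theorem corLoop_run (hΓ : Room n m S T Γ) {Done : Set (List ℕ)} {t₂ : ℕ}
    (hcor : ∀ q < S * (S * S), Γ.env.cor.AnswersWithin n t₂ (corArg n S lab q))
    (hc : QueryInv n m S T lab Done c) :
    Run Γ corLoop
      (20 + S * (S * S) * (200 + 260 * (T * (n * n)) + 200 * (n * n) + 40 * n + t₂)) c
      (QueryInv n m S T lab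
        (Done ∪ (fun q => Γ.env.cor.answer (corArg n S lab q)) '' Set.Iio (S * (S * S)))) := by
  have := hΓ.addr
  have := hΓ.npos
  have := hΓ.space
  have := hΓ.le
  have := hΓ.triples
  have := hΓ.pairs
  refine Run.forLoop (193 + 260 * (T * (n * n)) + 200 * (n * n) + 40 * n + t₂) (S * (S * S))
    (fun i => QueryInv n m S T lab
      (Done ∪ (fun q => Γ.env.cor.answer (corArg n S lab q)) '' Set.Iio i)) ?_ (by decide)
    (by decide) ?_ (by simp [hc.r7]) (by omega) (by omega)
    (fun i c' x h => h.of_agreeOn ((AgreeOn.refl (· ≠ 11) c').set (by omega) x) (by omega))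
    (by simpa using hc) ?_ fun _ h => h
  · rw [show 193 + 260 * (T * (n * n)) + 200 * (n * n) + 40 * n + t₂ + 7 =
      200 + 260 * (T * (n * n)) + 200 * (n * n) + 40 * n + t₂ by omega]
    exact Nat.add_le_add_right (by decide) _
  · have := Nat.le_mul_self (S * S)
    simp only [RExpr.ok_mul, RExpr.ok_reg, RExpr.eval_mul, RExpr.eval_reg, Core.set_mem,
      Function.update_of_ne (show 7 ≠ 11 by decide), hc.r7]
    exact ⟨by decide, ⟨by decide, by decide, by nlinarith⟩, by omega⟩
  rintro q hq c₀ counter h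
  refine Run.seq 60 (133 + 260 * (T * (n * n)) + 200 * (n * n) + 40 * n + t₂) (by omega)
    ((selectTriple_run hΓ h.toRegs hq counter).mono le_rfl ?_)
  rintro c₁ ⟨agree, sel⟩
  have h₁ := h.of_agreeOn agree (by omega)
  have r11 := (agree.mem 11 (by omega)).trans counter
  refine (push_call_consider_run hΓ h₁ (by omega) (pushMatrix_run hΓ h₁.toSketch h₁.arg hq sel)
    (fun _ => rfl) (hcor q hq)).mono le_rfl fun c₂ ⟨frame, inv⟩ => ⟨frame.trans r11, ?_⟩
  rwa [← insert_union_image_Iio]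

/-- The clusterings among which the query chooses. -/
def candidates (n S : ℕ) (E : Env) (lab : ℕ → ℕ → ℕ) : Set (List ℕ) :=
  (fun t => E.cls.answer (clsArg n lab t)) '' Set.Iio S ∪
    (fun q => E.cor.answer (corArg n S lab q)) '' Set.Iio (S * (S * S))

theorem queryProg_run (hΓ : Room n m S T Γ) (hS : 0 < S) {t₁ t₂ : ℕ}
    (hcls : ∀ t < S, Γ.env.cls.AnswersWithin n t₁ (clsArg n lab t))
    (hcor : ∀ q < S * (S * S), Γ.env.cor.AnswersWithin n t₂ (corArg n S lab q))
    (hc : Sketch n m S T lab c) (harg : c.arg = []) (hout : c.out = []) :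
    Run Γ queryProg (100 + 20 * n + S * (100 + 260 * (T * (n * n)) + 70 * n + t₁) +
      S * (S * S) * (200 + 260 * (T * (n * n)) + 200 * (n * n) + 40 * n + t₂)) c
      fun c' => c'.out ∈ candidates n S Γ.env lab ∧
        ∀ L ∈ candidates n S Γ.env lab, sampleCost n T lab c'.out ≤ sampleCost n T lab L := by
  have := hΓ.addr
  have := hΓ.cost
  have := hΓ.pairs
  refine Run.assign_seq (20 + S * (100 + 260 * (T * (n * n)) + 70 * n + t₁) +
    (20 + S * (S * S) * (200 + 260 * (T * (n * n)) + 200 * (n * n) + 40 * n + t₂) + (20 + 20 * n)))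
    ?_ (by decide) (by decide) (by simp [hc.r8, hc.r0]; omega) ?_
  · simp only [RExpr.cost_add, RExpr.cost_mul, RExpr.cost_reg, RExpr.cost_lit]
    omega
  simp only [RExpr.eval_add, RExpr.eval_mul, RExpr.eval_reg, RExpr.eval_lit, hc.r8, hc.r0]
  have start : QueryInv n m S T lab ∅ (c.set 9 (T * (n * n) + 1)) :=
    ⟨hc.of_agreeOn ((AgreeOn.refl (· ≠ 9) c).set (by omega) _) (by omega), harg, hout,
      fun L hL => hL.elim, Or.inl (by simp)⟩
  refine Run.seq _ _ le_rfl ((clsLoop_run hΓ hcls start).mono le_rfl fun c₁ h₁ => ?_)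
  refine Run.seq _ _ le_rfl ((corLoop_run hΓ hcor h₁).mono le_rfl fun c₂ h₂ => ?_)
  rw [Set.empty_union] at h₂
  rcases h₂.best.eq with initial | ⟨L, hL, cost, buffer⟩
  · obtain ⟨L, hL⟩ : (candidates n S Γ.env lab).Nonempty := ⟨_, Or.inl ⟨0, hS, rfl⟩⟩
    have le_sampleCost := initial ▸ h₂.best.le L hL
    exact absurd (le_sampleCost.trans (partialCost_le _ lab L)) (Nat.not_succ_le_self _)
  · have length_eq : L.length = n := by
      rcases hL with ⟨t, ht, rfl⟩ | ⟨q, hq, rfl⟩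
      exacts [(hcls t ht).length_eq, (hcor q hq).length_eq]
    refine (emitLoop_run hΓ h₂.toRegs h₂.out length_eq buffer).mono le_rfl ?_
    rintro c₃ rfl
    exact ⟨hL, fun L' hL' => cost ▸ h₂.best.le L' hL'⟩

end Query

/-! ### Labels and clusterings -/

section Labels

variable {n m S T : ℕ}

/-- The least point of the cluster of `u`: the canonical label of `u`.  It is a function on `ℕ`
because the labels of a row are; for `n ≤ u` it has the junk value `0`. -/
noncomputable def minLabel (C : Clustering n) (u : ℕ) : ℕ :=
  sInf {w : ℕ | ∃ (hw : w < n) (hu : u < n), C.r ⟨w, hw⟩ ⟨u, hu⟩}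

theorem exists_minLabel_eq (C : Clustering n) (u : Fin n) :
    ∃ w : Fin n, minLabel C u = w ∧ C.r w u := by
  obtain ⟨hw, _, h⟩ := Nat.sInf_mem (s := {w : ℕ | ∃ (hw : w < n) (hu : (u : ℕ) < n),
    C.r ⟨w, hw⟩ ⟨u, hu⟩}) ⟨u, u.2, u.2, C.refl' _⟩
  exact ⟨⟨_, hw⟩, rfl, h⟩

theorem minLabel_le (C : Clustering n) {u w : Fin n} (h : C.r w u) : minLabel C u ≤ w :=
  Nat.sInf_le ⟨w.2, u.2, h⟩

theorem minLabel_lt (C : Clustering n) (u : Fin n) : minLabel C u < n := by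
  obtain ⟨w, h, -⟩ := exists_minLabel_eq C u
  exact h ▸ w.2

theorem minLabel_eq_iff (C : Clustering n) (u v : Fin n) :
    minLabel C u = minLabel C v ↔ C.r u v := by
  obtain ⟨w, hw, hwu⟩ := exists_minLabel_eq C u
  obtain ⟨x, hx, hxv⟩ := exists_minLabel_eq C v
  refine ⟨fun h => ?_, fun h => le_antisymm ?_ ?_⟩
  · obtain rfl : w = x := Fin.ext (hw ▸ hx ▸ h)
    exact C.trans' (C.symm' hwu) hxv
  · exact hx ▸ minLabel_le C (C.trans' hxv (C.symm' h))
  · exact hw ▸ minLabel_le C (C.trans' hwu h)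

theorem represents_map_minLabel (C : Clustering n) :
    Represents ((List.range n).map (minLabel C)) C := by
  refine ⟨by simp, ?_, fun u v => ?_⟩
  · intro x hx
    obtain ⟨u, hu, rfl⟩ := List.mem_map.1 hx
    exact minLabel_lt C ⟨u, List.mem_range.1 hu⟩
  · simp [← minLabel_eq_iff]

/-- The canonical labels of the clusterings with indices `X t`. -/
noncomputable def sampleLab (I : Fin m → Clustering n) (X : ℕ → Fin m) (t : ℕ) : ℕ → ℕ :=
  minLabel (I (X t))

/-! #### The labels during the stream -/

/-- Each label is a point of the same cluster which is not larger. -/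
def IsLabeling (C : Clustering n) (row : ℕ → ℕ) : Prop :=
  ∀ u : Fin n, ∃ w : Fin n, row u = w ∧ C.r w u ∧ w ≤ u

theorem isLabeling_id (C : Clustering n) : IsLabeling C fun u => u :=
  fun u => ⟨u, rfl, C.refl' u, le_rfl⟩

theorem lowerRow_le (row : ℕ → ℕ) (p q u : ℕ) : lowerRow row p q u ≤ row u := by
  by_cases h : u = p
  · subst h; simp [lowerRow]
  · simp [lowerRow, Function.update_of_ne h]

theorem lowerRow_self_le (row : ℕ → ℕ) (p q : ℕ) : lowerRow row p q p ≤ q := by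
  simp [lowerRow]

theorem IsLabeling.lowerRow {C : Clustering n} {row : ℕ → ℕ} (h : IsLabeling C row) {p q : Fin n}
    (hpq : C.r p q) : IsLabeling C (lowerRow row p q) := by
  intro u
  obtain ⟨w, row_eq, related, le⟩ := h u
  by_cases hup : u = p
  · subst hup
    rcases le_total w q with hle | hle
    · exact ⟨w, by simp [FairConsensus.lowerRow, row_eq, hle], related, le⟩
    · exact ⟨q, by simp [FairConsensus.lowerRow, row_eq, hle], C.symm' hpq, hle.trans le⟩
  · refine ⟨w, ?_, related, le⟩
    rw [FairConsensus.lowerRow, Function.update_of_ne (Fin.val_ne_of_ne hup), row_eq]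

/-- What is known about the labels after the triples of `l`: those that put two points together in
a sampled clustering have lowered the label of each of the two points to the other point. -/
structure TracksStream (I : Fin m → Clustering n) (X : ℕ → Fin m) (l : List (Triple n m))
    (lab : ℕ → ℕ → ℕ) : Prop where
  isLabeling : ∀ t, IsLabeling (I (X t)) (lab t)
  le : ∀ t, ∀ x ∈ l, x.j = X t → x.sep = false → lab t x.u ≤ x.v ∧ lab t x.v ≤ x.u

variable {I : Fin m → Clustering n} {X : ℕ → Fin m} {l : List (Triple n m)} {lab : ℕ → ℕ → ℕ}

theorem tracksStream_nil (I : Fin m → Clustering n) (X : ℕ → Fin m) :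
    TracksStream I X [] fun _ u => u :=
  ⟨fun t => isLabeling_id _, by simp⟩

theorem labStep_le (X : ℕ → ℕ) (u v j b : ℕ) (lab : ℕ → ℕ → ℕ) (t w : ℕ) :
    labStep X u v j b lab t w ≤ lab t w := by
  rw [labStep]
  split_ifs
  exacts [(lowerRow_le _ _ _ _).trans (lowerRow_le _ _ _ _), le_rfl]

theorem TracksStream.concat (h : TracksStream I X l lab) {x : Triple n m}
    (hx : x.sep = false ↔ (I x.j).r x.u x.v) :
    TracksStream I X (l ++ [x])
      (labStep (fun t => (X t : ℕ)) x.u x.v x.j (if x.sep then 1 else 0) lab) := by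
  refine ⟨fun t => ?_, fun t y hy hj hs => ?_⟩
  · by_cases hcond : (X t : ℕ) = x.j ∧ (if x.sep then 1 else 0) = 0
    · obtain ⟨hXt, hsep⟩ : X t = x.j ∧ x.sep = false := by simpa [Fin.val_inj] using hcond
      have related : (I (X t)).r x.u x.v := hXt ▸ hx.1 hsep
      rw [labStep, if_pos hcond]
      exact ((h.isLabeling t).lowerRow related).lowerRow ((I (X t)).symm' related)
    · rw [labStep, if_neg hcond]
      exact h.isLabeling t
  rcases List.mem_append.1 hy with hy | hy
  · exact ⟨(labStep_le _ _ _ _ _ _ _ _).trans (h.le t y hy hj hs).1,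
      (labStep_le _ _ _ _ _ _ _ _).trans (h.le t y hy hj hs).2⟩
  · obtain rfl := List.mem_singleton.1 hy
    rw [labStep, if_pos ⟨by rw [hj], by simp [hs]⟩]
    exact ⟨(lowerRow_le _ _ _ _).trans (lowerRow_self_le _ _ _), lowerRow_self_le _ _ _⟩

theorem TracksStream.le_of_related (h : TracksStream I X l lab) (hl : IsStream I l) {t : ℕ}
    {u w : Fin n} (hwu : w ≠ u) (related : (I (X t)).r w u) : lab t u ≤ w := by
  obtain ⟨x, hx, hj, ⟨rfl, rfl⟩ | ⟨rfl, rfl⟩⟩ := hl.2 (X t) w u hwu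
  · exact (h.le t x hx hj ((hl.1 x hx).2 (hj ▸ related))).2
  · exact (h.le t x hx hj ((hl.1 x hx).2 (hj ▸ (I (X t)).symm' related))).1

theorem TracksStream.eq_sampleLab (h : TracksStream I X l lab) (hl : IsStream I l) (t : ℕ)
    (u : Fin n) : lab t u = sampleLab I X t u := by
  obtain ⟨w, row_eq, related, le⟩ := h.isLabeling t u
  obtain ⟨x, label_eq, hxu⟩ := exists_minLabel_eq (I (X t)) u
  refine le_antisymm ?_ (row_eq ▸ minLabel_le _ related)
  rw [sampleLab, label_eq]
  by_cases hne : x = u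
  · exact row_eq ▸ hne ▸ le
  · exact h.le_of_related hl hne hxu

/-! #### Arguments and costs in terms of clusterings -/

theorem matrixWord_eq_map_range (G : SimpleGraph (Fin n)) {f : ℕ → ℕ}
    (hf : ∀ u v : Fin n, f (u * n + v) = open Classical in if G.Adj u v then 1 else 0) :
    matrixWord G = (List.range (n * n)).map f := by
  rw [← List.map_coe_finRange_eq_range, List.map_map, ← List.ofFn_eq_map, List.ofFn_mul,
    List.ofFn_eq_map, matrixWord, List.flatMap]
  congr 1
  refine List.map_congr_left fun u _ => ?_
  rw [List.ofFn_eq_map]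
  exact List.map_congr_left fun v _ => (hf u v).symm

theorem majorityBit_sampleLab (I : Fin m → Clustering n) (X : ℕ → Fin m) (i j k : ℕ)
    (u v : Fin n) : majorityBit n (sampleLab I X) i j k (u * n + v) =
      open Classical in if (majority (I (X i)) (I (X j)) (I (X k))).Adj u v then 1 else 0 := by
  classical
  simp only [majorityBit, togetherBit, sampleLab, mul_add_div_of_lt v.2, mul_add_mod_of_lt v.2,
    minLabel_eq_iff, majority, Fin.val_inj]
  by_cases huv : u = v
  · simp [huv]
  · by_cases hi : (I (X i)).r u v <;> by_cases hj : (I (X j)).r u v <;>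
      by_cases hk : (I (X k)).r u v <;> simp [huv, hi, hj, hk]

theorem corArg_sampleLab (I : Fin m → Clustering n) (X : ℕ → Fin m) (q : ℕ) :
    corArg n S (sampleLab I X) q =
      matrixWord (majority (I (X (q / S / S))) (I (X (q / S % S))) (I (X (q % S)))) :=
  (matrixWord_eq_map_range _ (majorityBit_sampleLab I X _ _ _)).symm

theorem sum_range_mul_div_mod {M : Type*} [AddCommMonoid M] (f : ℕ → ℕ → M) (a b : ℕ) :
    ∑ q ∈ Finset.range (a * b), f (q / b) (q % b) = ∑ x ∈ Finset.range a, ∑ y : Fin b, f x y := by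
  rw [Finset.sum_range, Finset.sum_range]
  exact (finProdFinEquiv.symm.sum_comp fun p : Fin a × Fin b => f p.1 p.2).trans
    (Fintype.sum_prod_type _)

theorem card_filter_eq_two_mul_card_filter_lt {α : Type*} [Fintype α] [LinearOrder α]
    {r : α → α → Prop} [DecidableRel r] (hsymm : ∀ a b, r a b ↔ r b a) (hirrefl : ∀ a, ¬ r a a) :
    (Finset.univ.filter fun p : α × α => r p.1 p.2).card =
      2 * (Finset.univ.filter fun p : α × α => p.1 < p.2 ∧ r p.1 p.2).card := by
  have card_swap : (Finset.univ.filter fun p : α × α => p.2 < p.1 ∧ r p.1 p.2).card =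
      (Finset.univ.filter fun p : α × α => p.1 < p.2 ∧ r p.1 p.2).card :=
    Finset.card_equiv (Equiv.prodComm α α) fun p => by
      simp [hsymm p.1 p.2]
  have disjoint : Disjoint (Finset.univ.filter fun p : α × α => p.1 < p.2 ∧ r p.1 p.2)
      (Finset.univ.filter fun p : α × α => p.2 < p.1 ∧ r p.1 p.2) :=
    Finset.disjoint_filter.2 fun p _ h h' => h.1.asymm h'.1
  have hne : ∀ p : α × α, r p.1 p.2 → p.1 ≠ p.2 := fun p h hp => hirrefl p.2 (hp ▸ h)
  calc (Finset.univ.filter fun p : α × α => r p.1 p.2).card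
      = (Finset.univ.filter fun p : α × α =>
          p.1 < p.2 ∧ r p.1 p.2 ∨ p.2 < p.1 ∧ r p.1 p.2).card := by
        refine congrArg Finset.card (Finset.filter_congr fun p _ => ?_)
        rw [← or_and_right, ← ne_iff_lt_or_gt, and_comm]
        exact iff_self_and.2 (hne p)
    _ = _ := by rw [Finset.filter_or, Finset.card_union_of_disjoint disjoint, card_swap, two_mul]

theorem sampleCost_sampleLab (I : Fin m → Clustering n) (X : ℕ → Fin m) {L : List ℕ}
    {F : Clustering n} (hL : Represents L F) :
    sampleCost n T (sampleLab I X) L = 2 * ∑ t ∈ Finset.range T, dist (I (X t)) F := by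
  classical
  have hcost : ∀ t, ∑ p : Fin n × Fin n, pairCost (sampleLab I X) L t p.1 p.2 =
      2 * dist (I (X t)) F := by
    intro t
    have hdist := card_filter_eq_two_mul_card_filter_lt
      (r := fun u v => ¬ ((I (X t)).r u v ↔ F.r u v))
      (fun u v => by simp only [(I (X t)).comm', F.comm']) (by simp)
    simp only [pairCost, sampleLab, minLabel_eq_iff, ← hL.2.2, dist]
    convert hdist using 1
    simp [Finset.sum_ite]
  rw [sampleCost, partialCost, ← mul_assoc,
    sum_range_mul_div_mod (fun x v => pairCost (sampleLab I X) L (x / n) (x % n) v),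
    sum_range_mul_div_mod (fun t u => ∑ v : Fin n, pairCost (sampleLab I X) L t u v),
    Finset.mul_sum]
  exact Finset.sum_congr rfl fun t _ => (Fintype.sum_prod_type _).symm.trans (hcost t)

end Labels

/-! #### Runs of the algorithm -/

section Runs

variable {n m S T C e : ℕ}

/-- The number of samples from which candidates are formed. -/
def numSeeds (C m : ℕ) : ℕ := C * Nat.size m

/-- The number of samples on which candidates are compared. -/
def numSamples (C m e : ℕ) : ℕ := numSeeds C m * (e * e)

/-- The parameters for which the runs are analysed; `e` stands for `⌈1/ε⌉`. -/
structure Admissible (C n m e : ℕ) : Prop where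
  C_pos : 0 < C
  n_pos : 0 < n
  two_le_m : 2 ≤ m
  two_le_e : 2 ≤ e

/-- The bounds on the addresses and on the words in the runs of `algorithm C`. -/
def setting (C n m e : ℕ) (E : Env) : Setting where
  env := E
  B := 64 + numSamples C m e + numSamples C m e * n + n + n
  W := (n + m + e) ^ (3 * C + 12)
  hB := by omega

theorem numSeeds_le_pow {M : ℕ} (hM : 2 ≤ M) (hm : m ≤ M) : numSeeds C m ≤ M ^ (C + 1) :=
  calc C * Nat.size m ≤ 2 ^ C * m :=
        Nat.mul_le_mul Nat.lt_two_pow_self.le (Nat.size_le.2 Nat.lt_two_pow_self)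
    _ ≤ M ^ C * M := Nat.mul_le_mul (Nat.pow_le_pow_left hM C) hm
    _ = M ^ (C + 1) := (pow_succ M C).symm

theorem numSamples_le_pow {M : ℕ} (hM : 2 ≤ M) (hm : m ≤ M) (he : e ≤ M) :
    numSamples C m e ≤ M ^ (C + 3) :=
  calc numSeeds C m * (e * e) ≤ M ^ (C + 1) * (M * M) :=
        Nat.mul_le_mul (numSeeds_le_pow hM hm) (Nat.mul_le_mul he he)
    _ = M ^ (C + 3) := by ring

theorem hundred_mul_pow_le_pow {M : ℕ} (hM : 5 ≤ M) : 100 * M ^ (C + 5) ≤ M ^ (3 * C + 12) :=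
  calc 100 * M ^ (C + 5) ≤ M ^ 3 * M ^ (C + 5) :=
        Nat.mul_le_mul_right _ ((by norm_num : 100 ≤ 5 ^ 3).trans (Nat.pow_le_pow_left hM 3))
    _ = M ^ (3 + (C + 5)) := (pow_add M 3 (C + 5)).symm
    _ ≤ M ^ (3 * C + 12) := Nat.pow_le_pow_right (by omega) (by omega)

namespace Admissible

variable (h : Admissible C n m e)
include h

theorem m_pos : 0 < m := Nat.zero_lt_of_lt h.two_le_m

theorem five_le : 5 ≤ n + m + e := by
  have := h.n_pos
  have := h.two_le_m
  have := h.two_le_e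
  omega

theorem numSeeds_pos : 0 < numSeeds C m := Nat.mul_pos h.C_pos (Nat.size_pos.2 h.m_pos)

theorem mul_self_pos : 0 < e * e :=
  Nat.mul_pos (Nat.zero_lt_of_lt h.two_le_e) (Nat.zero_lt_of_lt h.two_le_e)

theorem numSeeds_le_numSamples : numSeeds C m ≤ numSamples C m e :=
  Nat.le_mul_of_pos_right _ h.mul_self_pos

theorem numSamples_pos : 0 < numSamples C m e := h.numSeeds_pos.trans_le h.numSeeds_le_numSamples

theorem C_le_numSamples : C ≤ numSamples C m e :=
  (Nat.le_mul_of_pos_right C (Nat.size_pos.2 h.m_pos)).trans h.numSeeds_le_numSamples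

theorem numSamples_mul_le_pow {i : ℕ} (hi : i ≤ (n + m + e) ^ 2) :
    numSamples C m e * i ≤ (n + m + e) ^ (C + 5) :=
  calc numSamples C m e * i ≤ (n + m + e) ^ (C + 3) * (n + m + e) ^ 2 :=
        Nat.mul_le_mul (numSamples_le_pow (by have := h.five_le; omega) (by omega) (by omega)) hi
    _ = (n + m + e) ^ (C + 5) := (pow_add _ (C + 3) 2).symm

theorem room (E : Env) : Room n m (numSeeds C m) (numSamples C m e) (setting C n m e E) := by
  have hM := h.five_le
  have hW : 100 * (n + m + e) ^ (C + 5) ≤ (setting C n m e E).W := hundred_mul_pow_le_pow hM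
  have one_le : 1 ≤ (n + m + e) ^ (C + 5) := Nat.one_le_pow _ _ (by omega)
  have hn₂ : n ≤ (n + m + e) ^ 2 :=
    (by omega : n ≤ n + m + e).trans (Nat.le_self_pow two_ne_zero _)
  have hTn : numSamples C m e * n ≤ (n + m + e) ^ (C + 5) := h.numSamples_mul_le_pow hn₂
  have hT : numSamples C m e ≤ numSamples C m e * n := Nat.le_mul_of_pos_right _ h.n_pos
  have hTnn : numSamples C m e * (n * n) ≤ (n + m + e) ^ (C + 5) :=
    h.numSamples_mul_le_pow (by rw [sq]; gcongr <;> omega)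
  have hn : n ≤ numSamples C m e * n := Nat.le_mul_of_pos_left _ h.numSamples_pos
  have hnn : n * n ≤ numSamples C m e * (n * n) := Nat.le_mul_of_pos_left _ h.numSamples_pos
  refine ⟨h.n_pos, h.m_pos, rfl, by omega, by omega, ?_, by omega, h.numSeeds_le_numSamples⟩
  have hS : numSeeds C m ≤ (n + m + e) ^ (C + 1) := numSeeds_le_pow (by omega) (by omega)
  calc numSeeds C m * (numSeeds C m * numSeeds C m)
      ≤ (n + m + e) ^ (C + 1) * ((n + m + e) ^ (C + 1) * (n + m + e) ^ (C + 1)) := by gcongr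
    _ = (n + m + e) ^ (3 * C + 3) := by ring
    _ ≤ (n + m + e) ^ (3 * C + 12) := Nat.pow_le_pow_right (by omega) (by omega)

theorem le_setting_W {k : ℕ} (E : Env) (hk : k ≤ n + m + e ∨ k ≤ numSamples C m e) :
    k ≤ (setting C n m e E).W := by
  have := (h.room E).addr
  have := h.five_le
  have hM : n + m + e ≤ (n + m + e) ^ (3 * C + 12) := Nat.le_self_pow (by omega) _
  rcases hk with hk | hk
  · exact hk.trans hM
  · omega

end Admissible

/-- What holds after the initialization and the triples of `l`. -/
structure StreamInv (Γ : Setting) (I : Fin m → Clustering n) (X : ℕ → Fin m) (S T : ℕ)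
    (l : List (Triple n m)) (σ : State) : Prop where
  within : σ.Within Γ.B Γ.W
  regs : Regs n m S T σ.core
  arg : σ.core.arg = []
  out : σ.core.out = []
  indices : Indices T (fun t => (X t : ℕ)) σ.core
  rows : ∃ lab, Rows n T lab σ.core ∧ TracksStream I X l lab

theorem start_spec (h : Admissible C n m e) (E : Env) (I : Fin m → Clustering n) :
    StreamInv (setting C n m e E) I (draw h.m_pos E.coins) (numSeeds C m) (numSamples C m e) []
        ((algorithm C).start E n m e) ∧
      ((algorithm C).start E n m e).time ≤
        200 + 20 * numSamples C m e + 20 * (numSamples C m e * n) := by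
  have hB := (setting C n m e E).hB
  have hn : n ≤ (setting C n m e E).W := h.le_setting_W E (by omega)
  have hm : m ≤ (setting C n m e E).W := h.le_setting_W E (by omega)
  have he : e ≤ (setting C n m e E).W := h.le_setting_W E (by omega)
  have hee : e * e ≤ numSamples C m e := Nat.le_mul_of_pos_left _ h.numSeeds_pos
  have empty : State.empty.Within (setting C n m e E).B (setting C n m e E).W :=
    ⟨fun _ => Nat.zero_le _, Nat.zero_le _, Nat.zero_le _⟩
  have core : (((State.empty.put 0 n).put 1 m).put 2 e).core =
      ((State.empty.core.set 0 n).set 1 m).set 2 e := by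
    rw [State.core_put (by omega), State.core_put (by omega), State.core_put (by omega)]
  obtain ⟨⟨agree, regs, indices, rows⟩, within, time_le⟩ := initProg_run (h.room E) rfl rfl
    (h.le_setting_W E (.inr h.C_le_numSamples)) (h.le_setting_W E (.inr hee))
    (c := ((State.empty.core.set 0 n).set 1 m).set 2 e) (by simp) (by simp) (by simp) rfl _ core
    (((empty.put (by omega) hn).put (by omega) hm).put (by omega) he)
  exact ⟨⟨within, regs, agree.arg, agree.out, indices, _, rows, tracksStream_nil I _⟩,
    time_le.trans (Nat.zero_add _).le⟩

variable {Γ : Setting} {I : Fin m → Clustering n} {X : ℕ → Fin m} {l : List (Triple n m)}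
  {σ : State}

theorem StreamInv.step (hΓ : Room n m S T Γ) (hm : m ≤ Γ.W) (h : StreamInv Γ I X S T l σ)
    (x : Triple n m) (hx : x.sep = false ↔ (I x.j).r x.u x.v) :
    StreamInv Γ I X S T (l ++ [x]) ((algorithm C).step Γ.env σ x) ∧
      ((algorithm C).step Γ.env σ x).time ≤ σ.time + (20 + 120 * T) := by
  have hB := Γ.hB
  have := hΓ.addr
  have hu := x.u.2
  have hv := x.v.2
  have hj := x.j.2
  have hb : (if x.sep then 1 else 0) ≤ 1 := by split_ifs <;> simp
  have within : ((((σ.put 3 x.u).put 4 x.v).put 5 x.j).put 6 (if x.sep then 1 else 0)).Within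
      Γ.B Γ.W :=
    (((h.within.put (by omega) (by omega)).put (by omega) (by omega)).put (by omega)
      (by omega)).put (by omega) (by omega)
  have core : ((((σ.put 3 x.u).put 4 x.v).put 5 x.j).put 6 (if x.sep then 1 else 0)).core =
      (((σ.core.set 3 x.u).set 4 x.v).set 5 x.j).set 6 (if x.sep then 1 else 0) := by
    rw [State.core_put (by omega), State.core_put (by omega), State.core_put (by omega),
      State.core_put (by omega)]
  have frame := ((((AgreeOn.refl (fun a => a < 3 ∨ 7 ≤ a) σ.core).set (d := 3) (by omega) x.u).set
    (d := 4) (by omega) x.v).set (d := 5) (by omega) x.j).set (d := 6) (by omega)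
    (if x.sep then 1 else 0)
  obtain ⟨lab, rows, tracks⟩ := h.rows
  obtain ⟨⟨agree, rows'⟩, within', time_le⟩ := updateProg_run hΓ
    (h.regs.of_agreeOn frame (by omega)) (h.indices.of_agreeOn frame (by omega))
    (rows.of_agreeOn frame (by omega)) (u := x.u) (v := x.v) (j := x.j)
    (b := if x.sep then 1 else 0) ⟨by simp, by simp, by simp, by simp⟩ hu hv hb _ core within
  have frame' := (frame.mono (P' := fun a => a < 3 ∨ 7 ≤ a ∧ a < 15 ∨ 17 ≤ a ∧ a < 64 + T)
    (by omega)).trans (agree.mono (by omega))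
  exact ⟨⟨within', h.regs.of_agreeOn frame' (by omega), frame'.arg.trans h.arg,
    frame'.out.trans h.out, h.indices.of_agreeOn frame' (by omega), _, rows', tracks.concat hx⟩,
    time_le⟩

theorem after_concat (A : StreamAlg) (E : Env) (e : ℕ) (l : List (Triple n m)) (x : Triple n m) :
    A.after E e (l ++ [x]) = A.step E (A.after E e l) x := by
  simp [StreamAlg.after]

theorem StreamInv.after (h : Admissible C n m e) (E : Env)
    (hl : ∀ x ∈ l, x.sep = false ↔ (I x.j).r x.u x.v) :
    StreamInv (setting C n m e E) I (draw h.m_pos E.coins) (numSeeds C m) (numSamples C m e) l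
      ((algorithm C).after E e l) := by
  induction l using List.reverseRecOn with
  | nil => exact (start_spec h E I).1
  | append_singleton l x ih =>
    rw [after_concat]
    exact (StreamInv.step (h.room E) (h.le_setting_W E (by omega))
      (ih fun y hy => hl y (List.mem_append_left _ hy)) x (hl x List.mem_concat_self)).1

theorem after_concat_time_le (h : Admissible C n m e) (E : Env) (hl : IsStream I l)
    {l' : List (Triple n m)} {x : Triple n m} (hpre : l' ++ [x] <+: l) :
    ((algorithm C).after E e (l' ++ [x])).time ≤
      ((algorithm C).after E e l').time + (20 + 120 * numSamples C m e) := by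
  rw [after_concat]
  exact (StreamInv.step (h.room E) (h.le_setting_W E (by omega))
    (StreamInv.after h E fun y hy => hl.1 y (hpre.subset (List.mem_append_left _ hy))) x
    (hl.1 x (hpre.subset List.mem_concat_self))).2

theorem final_attains (h : Admissible C n m e) (E : Env) (hl : IsStream I l) {t₁ t₂ : ℕ}
    (hcls : ∀ i, E.cls.AnswersWithin n t₁ ((List.range n).map (minLabel (I i))))
    (hcor : ∀ i j k, E.cor.AnswersWithin n t₂ (matrixWord (majority (I i) (I j) (I k)))) :
    Attains (setting C n m e E)
      (fun c => c.out ∈ candidates n (numSeeds C m) E (sampleLab I (draw h.m_pos E.coins)) ∧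
        ∀ L ∈ candidates n (numSeeds C m) E (sampleLab I (draw h.m_pos E.coins)),
          sampleCost n (numSamples C m e) (sampleLab I (draw h.m_pos E.coins)) c.out ≤
            sampleCost n (numSamples C m e) (sampleLab I (draw h.m_pos E.coins)) L)
      (((algorithm C).after E e l).time + (100 + 20 * n +
        numSeeds C m * (100 + 260 * (numSamples C m e * (n * n)) + 70 * n + t₁) +
        numSeeds C m * (numSeeds C m * numSeeds C m) *
          (200 + 260 * (numSamples C m e * (n * n)) + 200 * (n * n) + 40 * n + t₂)))
      ((algorithm C).final E e l) := by
  have inv := StreamInv.after h E hl.1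
  obtain ⟨lab, rows, tracks⟩ := inv.rows
  exact queryProg_run (lab := sampleLab I (draw h.m_pos E.coins)) (h.room E) h.numSeeds_pos
    (fun t _ => hcls _)
    (fun q _ => by rw [corArg_sampleLab]; exact hcor _ _ _)
    ⟨inv.regs, rows.congr_lab fun t _ u hu => tracks.eq_sampleLab hl t ⟨u, hu⟩⟩ inv.arg inv.out
    _ rfl inv.within

end Runs

/-! #### Resource bounds -/

section Bounds

variable {n m C : ℕ} {ε : ℝ}

theorem size_le_log (hm : 2 ≤ m) : (Nat.size m : ℝ) ≤ 3 * Real.log m := by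
  obtain ⟨k, hk⟩ : ∃ k, Nat.size m = k + 1 :=
    Nat.exists_eq_succ_of_ne_zero (Nat.size_pos.2 (Nat.zero_lt_of_lt hm)).ne'
  have hpow : 2 ^ k ≤ m := Nat.lt_size.1 (hk ▸ k.lt_succ_self)
  have hlog : (k : ℝ) * Real.log 2 ≤ Real.log m := by
    rw [← Real.log_pow]
    exact Real.log_le_log (by positivity) (by exact_mod_cast hpow)
  have hlog_two : Real.log 2 ≤ Real.log m :=
    Real.log_le_log (by norm_num) (by exact_mod_cast hm)
  have := Real.log_two_gt_d9
  rw [hk, Nat.cast_succ]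
  nlinarith

theorem numSeeds_le_log (C : ℕ) (hm : 2 ≤ m) : (numSeeds C m : ℝ) ≤ 3 * C * Real.log m :=
  calc (numSeeds C m : ℝ) = C * Nat.size m := Nat.cast_mul _ _
    _ ≤ C * (3 * Real.log m) := by gcongr; exact size_le_log hm
    _ = 3 * C * Real.log m := by ring

theorem numSamples_ceil_le (C : ℕ) (hm : 2 ≤ m) (hε₀ : 0 < ε) (hε₁ : ε ≤ 1) :
    (numSamples C m ⌈1 / ε⌉₊ : ℝ) ≤ 12 * C * (ε⁻¹ ^ 2 * Real.log m) := by
  have hinv : 1 ≤ ε⁻¹ := (one_le_inv₀ hε₀).2 hε₁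
  have hceil : (⌈1 / ε⌉₊ : ℝ) ≤ 2 * ε⁻¹ := by
    rw [one_div]
    exact Nat.ceil_le_two_mul (by linarith)
  calc (numSamples C m ⌈1 / ε⌉₊ : ℝ) = numSeeds C m * (⌈1 / ε⌉₊ * ⌈1 / ε⌉₊) := by
        simp only [numSamples, Nat.cast_mul]
    _ ≤ 3 * C * Real.log m * (2 * ε⁻¹ * (2 * ε⁻¹)) := by
        gcongr
        exact numSeeds_le_log C hm
    _ = 12 * C * (ε⁻¹ ^ 2 * Real.log m) := by ring

theorem admissible_ceil (hC : 0 < C) (hn : 0 < n) (hm : 2 ≤ m) (hε₀ : 0 < ε) (hε₁ : ε < 1) :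
    Admissible C n m ⌈1 / ε⌉₊ where
  C_pos := hC
  n_pos := hn
  two_le_m := hm
  two_le_e := Nat.lt_ceil.2 (by exact_mod_cast one_lt_one_div hε₀ hε₁)

theorem mul_pow_mul_le {k x : ℝ} {i : ℕ} (hC : 0 < C) (hx : 0 ≤ x) (hk : k ≤ 500000)
    (hi : i ≤ 4) : k * (C : ℝ) ^ i * x ≤ 500000 * (C : ℝ) ^ 4 * x := by
  gcongr
  exact_mod_cast hC

theorem time_sum_le {S T : ℕ} (hn : 0 < n) (hS : 0 < S) (hT : 0 < T) (t₁ t₂ : ℕ) :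
    200 + 20 * T + 20 * (T * n) + (100 + 20 * n + S * (100 + 260 * (T * (n * n)) + 70 * n + t₁) +
      S * (S * S) * (200 + 260 * (T * (n * n)) + 200 * (n * n) + 40 * n + t₂)) ≤
    1500 * (S ^ 3 * (T * (n * n))) + S * t₁ + S ^ 3 * t₂ := by
  have le_sq : n ≤ n * n := Nat.le_mul_of_pos_left n hn
  have sq_le : n * n ≤ T * (n * n) := Nat.le_mul_of_pos_left _ hT
  have mul_le : T * n ≤ T * (n * n) := Nat.mul_le_mul_left T le_sq
  have le_mul : T ≤ T * n := Nat.le_mul_of_pos_right T hn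
  set V := T * (n * n)
  have hSV : V ≤ S ^ 3 * V := Nat.le_mul_of_pos_left V (by positivity)
  calc 200 + 20 * T + 20 * (T * n) + (100 + 20 * n + S * (100 + 260 * V + 70 * n + t₁) +
        S * (S * S) * (200 + 260 * V + 200 * (n * n) + 40 * n + t₂))
      ≤ 360 * V + S * (430 * V + t₁) + S * (S * S) * (700 * V + t₂) := by
        have hcls : 100 + 260 * V + 70 * n + t₁ ≤ 430 * V + t₁ := by omega
        have hcor : 200 + 260 * V + 200 * (n * n) + 40 * n + t₂ ≤ 700 * V + t₂ := by omega
        have := Nat.mul_le_mul_left S hcls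
        have := Nat.mul_le_mul_left (S * (S * S)) hcor
        omega
    _ = 360 * V + 430 * (S * V) + 700 * (S ^ 3 * V) + S * t₁ + S ^ 3 * t₂ := by ring
    _ ≤ 1500 * (S ^ 3 * V) + S * t₁ + S ^ 3 * t₂ := by
        have : S * V ≤ S ^ 3 * V := Nat.mul_le_mul_right V (Nat.le_self_pow (by norm_num) S)
        omega

theorem cast_time_bound_le {S T : ℕ} {a ℓ : ℝ} (hC : 0 < C) (hℓ : 0 ≤ ℓ) (hS : S ≤ 3 * C * ℓ)
    (hT : T ≤ 12 * C * (a ^ 2 * ℓ)) (n t₁ t₂ : ℕ) :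
    (1500 * (S ^ 3 * (T * (n * n))) + S * t₁ + S ^ 3 * t₂ : ℝ) ≤
      500000 * (C : ℝ) ^ 4 * (a ^ 2 * (n : ℝ) ^ 2 * ℓ ^ 4 + t₁ * ℓ + t₂ * ℓ ^ 3) :=
  calc (1500 * (S ^ 3 * (T * (n * n))) + S * t₁ + S ^ 3 * t₂ : ℝ)
      ≤ 1500 * ((3 * C * ℓ) ^ 3 * (12 * C * (a ^ 2 * ℓ) * (n * n))) + 3 * C * ℓ * t₁ +
          (3 * C * ℓ) ^ 3 * t₂ := by gcongr
    _ = 486000 * (C : ℝ) ^ 4 * (a ^ 2 * (n : ℝ) ^ 2 * ℓ ^ 4) + 3 * (C : ℝ) ^ 1 * (t₁ * ℓ) +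
          27 * (C : ℝ) ^ 3 * (t₂ * ℓ ^ 3) := by ring
    _ ≤ 500000 * (C : ℝ) ^ 4 * (a ^ 2 * (n : ℝ) ^ 2 * ℓ ^ 4) +
          500000 * (C : ℝ) ^ 4 * (t₁ * ℓ) + 500000 * (C : ℝ) ^ 4 * (t₂ * ℓ ^ 3) := by
        refine add_le_add_three ?_ ?_ ?_ <;>
          exact mul_pow_mul_le hC (by positivity) (by norm_num) (by norm_num)
    _ = 500000 * (C : ℝ) ^ 4 * (a ^ 2 * (n : ℝ) ^ 2 * ℓ ^ 4 + t₁ * ℓ + t₂ * ℓ ^ 3) := by ring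

variable {E : Env} {I : Fin m → Clustering n} {l : List (Triple n m)} {t₁ t₂ : ℕ}

theorem time_outside_pass_le (hC : 0 < C) (hn : 0 < n) (hm : 2 ≤ m) (hε₀ : 0 < ε) (hε₁ : ε < 1)
    (hl : IsStream I l)
    (hcls : ∀ i, E.cls.AnswersWithin n t₁ ((List.range n).map (minLabel (I i))))
    (hcor : ∀ i j k, E.cor.AnswersWithin n t₂ (matrixWord (majority (I i) (I j) (I k)))) :
    (((algorithm C).start E n m ⌈1 / ε⌉₊).time : ℝ) +
        (((algorithm C).final E ⌈1 / ε⌉₊ l).time - ((algorithm C).after E ⌈1 / ε⌉₊ l).time) ≤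
      500000 * (C : ℝ) ^ 4 * (ε⁻¹ ^ 2 * (n : ℝ) ^ 2 * Real.log m ^ 4 + t₁ * Real.log m +
        t₂ * Real.log m ^ 3) := by
  have h := admissible_ceil hC hn hm hε₀ hε₁
  have start_le := (start_spec h E I).2
  have final_le := (final_attains h E hl hcls hcor).time_le
  have sum_le := time_sum_le h.n_pos h.numSeeds_pos h.numSamples_pos t₁ t₂
  have total_le : ((algorithm C).start E n m ⌈1 / ε⌉₊).time +
      ((algorithm C).final E ⌈1 / ε⌉₊ l).time ≤
        1500 * (numSeeds C m ^ 3 * (numSamples C m ⌈1 / ε⌉₊ * (n * n))) + numSeeds C m * t₁ +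
          numSeeds C m ^ 3 * t₂ + ((algorithm C).after E ⌈1 / ε⌉₊ l).time := by omega
  rify at total_le
  linarith [cast_time_bound_le hC (Real.log_natCast_nonneg m) (numSeeds_le_log C hm)
    (numSamples_ceil_le C hm hε₀ hε₁.le) n t₁ t₂]

theorem time_per_triple_le (hC : 0 < C) (hn : 0 < n) (hm : 2 ≤ m) (hε₀ : 0 < ε) (hε₁ : ε < 1)
    (E : Env) (hl : IsStream I l) {l' : List (Triple n m)} {x : Triple n m}
    (hpre : l' ++ [x] <+: l) :
    (((algorithm C).after E ⌈1 / ε⌉₊ (l' ++ [x])).time : ℝ) -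
        ((algorithm C).after E ⌈1 / ε⌉₊ l').time ≤
      500000 * (C : ℝ) ^ 4 * (ε⁻¹ ^ 2 * Real.log m) := by
  have h := admissible_ceil hC hn hm hε₀ hε₁
  have step_le := after_concat_time_le h E hl hpre
  have := h.numSamples_pos
  have step_le' : ((algorithm C).after E ⌈1 / ε⌉₊ (l' ++ [x])).time ≤
      ((algorithm C).after E ⌈1 / ε⌉₊ l').time + 140 * numSamples C m ⌈1 / ε⌉₊ := by omega
  rify at step_le'
  have hlog : 0 ≤ ε⁻¹ ^ 2 * Real.log m :=
    mul_nonneg (by positivity) (Real.log_natCast_nonneg m)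
  linarith [numSamples_ceil_le C hm hε₀ hε₁.le,
    mul_pow_mul_le (k := 1680) (i := 1) hC hlog (by norm_num) (by norm_num)]

theorem cast_space_le (hC : 0 < C) (hn : 0 < n) (hm : 2 ≤ m) (hε₀ : 0 < ε) (hε₁ : ε < 1)
    {σ : State} {W : ℕ} (hσ : σ.Within (setting C n m ⌈1 / ε⌉₊ E).B W) :
    (σ.space : ℝ) ≤ 500000 * (C : ℝ) ^ 4 * (ε⁻¹ ^ 2 * n * Real.log m) := by
  have hT := (admissible_ceil hC hn hm hε₀ hε₁).numSamples_pos
  have hTn := Nat.le_mul_of_pos_right (numSamples C m ⌈1 / ε⌉₊) hn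
  have hnT := Nat.le_mul_of_pos_left n hT
  have le_mul : σ.space ≤ 68 * (numSamples C m ⌈1 / ε⌉₊ * n) := hσ.space_le.trans (by
    simp only [setting]
    omega)
  have := Real.log_natCast_nonneg m
  calc (σ.space : ℝ) ≤ 68 * (numSamples C m ⌈1 / ε⌉₊ * n) := by exact_mod_cast le_mul
    _ ≤ 68 * (12 * C * (ε⁻¹ ^ 2 * Real.log m) * n) := by
        gcongr
        exact numSamples_ceil_le C hm hε₀ hε₁.le
    _ = 816 * (C : ℝ) ^ 1 * (ε⁻¹ ^ 2 * n * Real.log m) := by ring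
    _ ≤ 500000 * (C : ℝ) ^ 4 * (ε⁻¹ ^ 2 * n * Real.log m) :=
        mul_pow_mul_le hC (by positivity) (by norm_num) (by norm_num)

end Bounds

/-! #### Success probability -/

section Success

variable {n m S T : ℕ} {P : Set (Fin n) → Prop} {E : Env} {I : Fin m → Clustering n}
  {X : ℕ → Fin m} {cls : Fin m → Clustering n} {cor : Fin m → Fin m → Fin m → Clustering n}

theorem SolvesClosestFair.answersWithin {γ : ℝ} {t : ℕ} {A : Subroutine}
    (h : SolvesClosestFair P γ t A) (D : Clustering n) :
    A.AnswersWithin n t ((List.range n).map (minLabel D)) := by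
  obtain ⟨cost_le, N, ⟨length_eq, lt, -⟩, -⟩ := h D _ (represents_map_minLabel D)
  exact ⟨cost_le, length_eq, lt⟩

theorem SolvesFairCor.answersWithin {η : ℝ} {t : ℕ} {A : Subroutine}
    (h : SolvesFairCor P η t A) (G : SimpleGraph (Fin n)) :
    A.AnswersWithin n t (matrixWord G) := by
  obtain ⟨cost_le, F, ⟨length_eq, lt, -⟩, -⟩ := h G
  exact ⟨cost_le, length_eq, lt⟩

theorem exists_isOptConsensus (I : Fin m → Clustering n) (h : ∃ N, IsFair P N) :
    ∃ N, IsOptConsensus P I N :=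
  ⟨Function.argminOn (obj I) {N | IsFair P N} h, Function.argminOn_mem _ {N | IsFair P N} _,
    fun _ hD => Function.argminOn_le _ {N | IsFair P N} hD⟩

theorem IsOptConsensus.isApproxConsensus {ρ : ℝ} {N F : Clustering n} (hN : IsOptConsensus P I N)
    (hF : IsFair P F) (hle : obj I F ≤ ρ * obj I N) : IsApproxConsensus P ρ I F := by
  refine ⟨hF, fun D hD => ?_⟩
  rwa [le_antisymm (hD.2 N hN.1) (hN.2 D hD.1)]

/-- The clusterings that can become candidates: the answers to the single input clusterings and to
the majority graphs of triples of input clusterings, in one family. -/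
abbrev answers (cls : Fin m → Clustering n) (cor : Fin m → Fin m → Fin m → Clustering n) :
    Fin m ⊕ Fin m × Fin m × Fin m → Clustering n :=
  Sum.elim cls fun q => cor q.1 q.2.1 q.2.2

theorem exists_represents_of_mem_candidates
    (hcls : ∀ i, Represents (E.cls.answer ((List.range n).map (minLabel (I i)))) (cls i))
    (hcor : ∀ i j k,
      Represents (E.cor.answer (matrixWord (majority (I i) (I j) (I k)))) (cor i j k))
    {L : List ℕ} (hL : L ∈ candidates n S E (sampleLab I X)) :
    ∃ a, Represents L (answers cls cor a) := by
  rcases hL with ⟨t, -, rfl⟩ | ⟨q, -, rfl⟩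
  · exact ⟨.inl (X t), hcls _⟩
  · dsimp only
    rw [corArg_sampleLab]
    exact ⟨.inr (X (q / S / S), X (q / S % S), X (q % S)), hcor _ _ _⟩

theorem cor_answer_mem_candidates {i j k : ℕ} (hi : i < S) (hj : j < S) (hk : k < S) (E : Env)
    (I : Fin m → Clustering n) (X : ℕ → Fin m) :
    E.cor.answer (matrixWord (majority (I (X i)) (I (X j)) (I (X k)))) ∈
      candidates n S E (sampleLab I X) := by
  have hq : (i * S + j) * S + k < S * (S * S) := by
    rw [← mul_assoc]
    exact mul_add_lt (mul_add_lt hi hj) hk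
  refine .inr ⟨_, hq, ?_⟩
  dsimp only
  rw [corArg_sampleLab, mul_add_div_of_lt hk, mul_add_mod_of_lt hk, mul_add_div_of_lt hj,
    mul_add_mod_of_lt hj]

theorem exists_mem_candidates_obj_le
    (hcls : ∀ i, Represents (E.cls.answer ((List.range n).map (minLabel (I i)))) (cls i))
    (hcor : ∀ i j k,
      Represents (E.cor.answer (matrixWord (majority (I i) (I j) (I k)))) (cor i j k)) {b : ℝ}
    (hgood : (∃ i ∈ X '' Set.Iio S, (obj I (cls i) : ℝ) ≤ b) ∨
      ∃ i ∈ X '' Set.Iio S, ∃ j ∈ X '' Set.Iio S, ∃ k ∈ X '' Set.Iio S,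
        (obj I (cor i j k) : ℝ) ≤ b) :
    ∃ L ∈ candidates n S E (sampleLab I X), ∃ a,
      Represents L (answers cls cor a) ∧ (obj I (answers cls cor a) : ℝ) ≤ b := by
  rcases hgood with ⟨_, ⟨i, hi, rfl⟩, hle⟩ |
    ⟨_, ⟨i, hi, rfl⟩, _, ⟨j, hj, rfl⟩, _, ⟨k, hk, rfl⟩, hle⟩
  · exact ⟨_, .inl ⟨i, hi, rfl⟩, .inl _, hcls _, hle⟩
  · exact ⟨_, cor_answer_mem_candidates hi hj hk E I X, .inr (_, _, _), hcor _ _ _, hle⟩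

theorem obj_le_of_sampleCost_le {ε : ℝ} (hε₀ : 0 < ε) (hε₁ : ε < 1) {L L' : List ℕ}
    {F F' : Clustering n} (hL : Represents L F) (hL' : Represents L' F')
    (hle : sampleCost n T (sampleLab I X) L ≤ sampleCost n T (sampleLab I X) L')
    (hcmp : (1 + 2 * ε) * obj I F' < obj I F →
      ∑ t ∈ Finset.range T, dist (I (X t)) F' < ∑ t ∈ Finset.range T, dist (I (X t)) F) :
    (obj I F : ℝ) ≤ (1 + ε) / (1 - ε) * obj I F' := by
  rw [sampleCost_sampleLab I X hL, sampleCost_sampleLab I X hL'] at hle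
  calc (obj I F : ℝ) ≤ (1 + 2 * ε) * obj I F' := not_lt.1 fun hlt => by have := hcmp hlt; omega
    _ ≤ (1 + ε) / (1 - ε) * obj I F' := by
        gcongr
        rw [le_div_iff₀ (by linarith)]
        nlinarith

theorem exists_isApproxConsensus {ε r : ℝ} (hε₀ : 0 < ε) (hε₁ : ε < 1)
    (hcls : ∀ i, Represents (E.cls.answer ((List.range n).map (minLabel (I i)))) (cls i))
    (hcor : ∀ i j k,
      Represents (E.cor.answer (matrixWord (majority (I i) (I j) (I k)))) (cor i j k))
    (cls_fair : ∀ i, IsFair P (cls i)) (cor_fair : ∀ i j k, IsFair P (cor i j k))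
    {N : Clustering n} (hN : IsOptConsensus P I N) {L : List ℕ}
    (hL : L ∈ candidates n S E (sampleLab I X))
    (hmin : ∀ L' ∈ candidates n S E (sampleLab I X),
      sampleCost n T (sampleLab I X) L ≤ sampleCost n T (sampleLab I X) L')
    (hgood : (∃ i ∈ X '' Set.Iio S, (obj I (cls i) : ℝ) ≤ r * obj I N) ∨
      ∃ i ∈ X '' Set.Iio S, ∃ j ∈ X '' Set.Iio S, ∃ k ∈ X '' Set.Iio S,
        (obj I (cor i j k) : ℝ) ≤ r * obj I N)
    (hcmp : ∀ a b, (1 + 2 * ε) * obj I (answers cls cor b) < obj I (answers cls cor a) →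
      ∑ t ∈ Finset.range T, dist (I (X t)) (answers cls cor b) <
        ∑ t ∈ Finset.range T, dist (I (X t)) (answers cls cor a)) :
    ∃ F, Represents L F ∧ IsApproxConsensus P ((1 + ε) / (1 - ε) * r) I F := by
  obtain ⟨a, ha⟩ := exists_represents_of_mem_candidates hcls hcor hL
  obtain ⟨L', hL', b, hb, good⟩ := exists_mem_candidates_obj_le hcls hcor hgood
  have fair : IsFair P (answers cls cor a) := by
    rcases a with i | ⟨i, j, k⟩
    exacts [cls_fair i, cor_fair i j k]
  refine ⟨_, ha, hN.isApproxConsensus fair ?_⟩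
  calc (obj I (answers cls cor a) : ℝ) ≤ (1 + ε) / (1 - ε) * obj I (answers cls cor b) :=
        obj_le_of_sampleCost_le hε₀ hε₁ ha hb (hmin L' hL') (hcmp a b)
    _ ≤ (1 + ε) / (1 - ε) * (r * obj I N) :=
        mul_le_mul_of_nonneg_left good (div_nonneg (by linarith) (by linarith))
    _ = (1 + ε) / (1 - ε) * r * obj I N := (mul_assoc _ _ _).symm

theorem card_fin_three_prod_le (hm : 2 ≤ m) :
    Fintype.card (Fin 3 × Fin m × Fin m) ≤ m ^ 4 := by
  simp only [Fintype.card_prod, Fintype.card_fin]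
  calc 3 * (m * m) ≤ m * m * (m * m) := Nat.mul_le_mul_right _ (by nlinarith)
    _ = m ^ 4 := by ring

theorem card_fin_sum_prod_le (hm : 2 ≤ m) :
    Fintype.card (Fin m ⊕ Fin m × Fin m × Fin m) ≤ m ^ 4 := by
  simp only [Fintype.card_sum, Fintype.card_prod, Fintype.card_fin]
  calc m + m * (m * m) ≤ 2 * (m * (m * m)) := by nlinarith [Nat.mul_le_mul hm hm]
    _ ≤ m * (m * (m * m)) := Nat.mul_le_mul_right _ hm
    _ = m ^ 4 := by ring

theorem min_one_div_le_one {s : ℝ} (hs : 1 ≤ s) (g : ℝ) : min (1 / g) (1 / (2 * s)) ≤ 1 :=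
  (min_le_right _ _).trans ((div_le_one (by linarith)).2 (by linarith))

theorem exists_sample_constant {p : ℝ} (hp₀ : 0 < p) (hp₁ : p ≤ 1) :
    ∃ C : ℕ, 0 < C ∧ (1 - p) ^ C ≤ (1 / 2 : ℝ) ^ 6 ∧
      Real.exp (-(1 / 8)) ^ C ≤ (1 / 2 : ℝ) ^ 10 := by
  have small_pow {x y : ℝ} (hx₀ : 0 ≤ x) (hx₁ : x < 1) (hy : 0 < y) :
      ∀ᶠ C : ℕ in Filter.atTop, x ^ C ≤ y :=
    (tendsto_pow_atTop_nhds_zero_of_lt_one hx₀ hx₁).eventually_le_const hy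
  exact ((Filter.eventually_gt_atTop 0).and
    ((small_pow (by linarith) (by linarith) (by positivity)).and
      (small_pow (Real.exp_pos _).le (Real.exp_lt_one_iff.2 (by norm_num)) (by positivity)))).exists

theorem ofReal_le_coinMeasure_isApproxConsensus {C : ℕ} {γ η α β c s g ε : ℝ} (hγ : 0 < γ)
    (hη : 0 < η) (hα : 0 < α) (hβ₀ : 0 < β) (hβ₁ : β < 1) (hc : 0 < c) (hs : 1 < s) (hg : 0 < g)
    (hsc : 0 < s * c - s - 2 * c) (hC : 0 < C)
    (hCp : (1 - min (1 / g) (1 / (2 * s))) ^ C ≤ (1 / 2) ^ 6)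
    (hCe : Real.exp (-(1 / 8)) ^ C ≤ (1 / 2) ^ 10) (hn : 0 < n) (hm : 2 ≤ m) {t₁ t₂ : ℕ}
    {Scls Scor : Subroutine} (hScls : SolvesClosestFair P γ t₁ Scls)
    (hScor : SolvesFairCor P η t₂ Scor) (hε₀ : 0 < ε) (hε₁ : ε < 1) {l : List (Triple n m)}
    (hl : IsStream I l) :
    ENNReal.ofReal (1 - 1 / (m : ℝ)) ≤ coinMeasure {ω | ∃ F : Clustering n,
      Represents ((algorithm C).final ⟨ω, Scls, Scor⟩ ⌈1 / ε⌉₊ l).out F ∧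
        IsApproxConsensus P ((1 + ε) / (1 - ε) * ratio γ η α β c s g) I F} := by
  have h := admissible_ceil hC hn hm hε₀ hε₁
  choose cls hcls cls_close using fun i => (hScls (I i) _ (represents_map_minLabel (I i))).2
  choose cor hcor cor_approx using fun i j k => (hScor (majority (I i) (I j) (I k))).2
  obtain ⟨N, hN⟩ := exists_isOptConsensus I ⟨_, (cls_close ⟨0, h.m_pos⟩).1⟩
  obtain ⟨𝒜, card_le, yields⟩ := exists_family_yielding_good_candidate hγ hη hα hβ₀ hβ₁ hc hs
    hg hsc h.m_pos I hN.1 cls cls_close cor cor_approx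
  have sample := one_sub_le_measureReal_good_sample hm (min_one_div_le_one hs.le g) hε₀ hε₁.le
    ((div_le_iff₀ hε₀).1 (Nat.le_ceil _)) hCp hCe (card_fin_three_prod_le hm)
    (card_fin_sum_prod_le hm) 𝒜 card_le I (answers cls cor)
  refine (ENNReal.ofReal_le_of_le_toReal sample).trans (measure_mono ?_)
  rintro ω ⟨hit, compare⟩
  obtain ⟨out_mem, out_le⟩ := (final_attains h ⟨ω, Scls, Scor⟩ hl
    (fun i => hScls.answersWithin _) fun i j k => hScor.answersWithin _).post
  exact exists_isApproxConsensus hε₀ hε₁ hcls hcor (fun i => (cls_close i).1)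
    (fun i j k => (cor_approx i j k).1) hN out_mem out_le
    (yields _ fun q => (hit q).elim fun t ht => ⟨_, ⟨t, ht.1, rfl⟩, ht.2⟩) compare

end Success

theorem mainTheorem4_general {γ η α β c s g : ℝ} (hγ : 0 < γ) (hη : 0 < η) (hα : 0 < α)
    (hβ₀ : 0 < β) (hβ₁ : β < 1) (hc : 0 < c) (hs : 1 < s) (hg : 0 < g)
    (hsc : 0 < s * c - s - 2 * c) :
    ∃ (A : StreamAlg) (K : ℝ) (κ : ℕ),
      ∀ (tcls tcor : ℕ → ℕ) (n m : ℕ) (_ : 1 ≤ n) (_ : 2 ≤ m) (P : Set (Fin n) → Prop)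
        (Scls Scor : Subroutine) (_ : SolvesClosestFair P γ (tcls n) Scls)
        (_ : SolvesFairCor P η (tcor n) Scor) (ε : ℝ) (_ : 0 < ε) (_ : ε < 1)
        (I : Fin m → Clustering n) (l : List (Triple n m)) (_ : IsStream I l),
        ENNReal.ofReal (1 - 1 / (m : ℝ)) ≤
          coinMeasure {ω | ∃ F : Clustering n,
            Represents (A.final ⟨ω, Scls, Scor⟩ ⌈1 / ε⌉₊ l).out F ∧
              IsApproxConsensus P ((1 + ε) / (1 - ε) * ratio γ η α β c s g) I F} ∧
        ∀ ω : Coins,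
          (((A.start ⟨ω, Scls, Scor⟩ n m ⌈1 / ε⌉₊).time : ℝ) +
              ((A.final ⟨ω, Scls, Scor⟩ ⌈1 / ε⌉₊ l).time
                - (A.after ⟨ω, Scls, Scor⟩ ⌈1 / ε⌉₊ l).time) ≤
            K * (ε⁻¹ ^ 2 * (n : ℝ) ^ 2 * Real.log m ^ 4 + tcls n * Real.log m
              + tcor n * Real.log m ^ 3)) ∧
          (∀ (l' : List (Triple n m)) (x : Triple n m), l' ++ [x] <+: l →
            ((A.after ⟨ω, Scls, Scor⟩ ⌈1 / ε⌉₊ (l' ++ [x])).time : ℝ)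
                - (A.after ⟨ω, Scls, Scor⟩ ⌈1 / ε⌉₊ l').time ≤
              K * (ε⁻¹ ^ 2 * Real.log m)) ∧
          ((A.final ⟨ω, Scls, Scor⟩ ⌈1 / ε⌉₊ l).space : ℝ) ≤
            K * (ε⁻¹ ^ 2 * n * Real.log m) ∧
          (A.final ⟨ω, Scls, Scor⟩ ⌈1 / ε⌉₊ l).top ≤ (n + m + ⌈1 / ε⌉₊) ^ κ := by
  obtain ⟨C, hC, hCp, hCe⟩ := exists_sample_constant (p := min (1 / g) (1 / (2 * s)))
    (by positivity) (min_one_div_le_one hs.le g)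
  refine ⟨algorithm C, 500000 * (C : ℝ) ^ 4, 3 * C + 12, fun tcls tcor n m hn hm P Scls Scor hScls
    hScor ε hε₀ hε₁ I l hl => ⟨ofReal_le_coinMeasure_isApproxConsensus hγ hη hα hβ₀ hβ₁ hc hs hg hsc
      hC hCp hCe hn hm hScls hScor hε₀ hε₁ hl, fun ω => ?_⟩⟩
  have hcls i := hScls.answersWithin (I i)
  have hcor i j k := hScor.answersWithin (majority (I i) (I j) (I k))
  have final_within := (final_attains (admissible_ceil hC hn hm hε₀ hε₁) ⟨ω, Scls, Scor⟩ hl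
    hcls hcor).within
  exact ⟨time_outside_pass_le hC hn hm hε₀ hε₁ hl hcls hcor,
    fun _ _ hpre => time_per_triple_le hC hn hm hε₀ hε₁ _ hl hpre,
    cast_space_le hC hn hm hε₀ hε₁ final_within, final_within.top_le⟩

end FairConsensus

open FairConsensus in
/-- The algorithm `A` and the constants `K`, `κ` depend only on `γ, η, α, β, c, s, g`. The accuracy
`ε` is handed to the machine as the word `⌈1/ε⌉`. -/
theorem mainTheorem4 (γ η α β c s g : ℝ) (hγ : 0 < γ) (hη : 0 < η) (hα : 0 < α)
    (hβ₀ : 0 < β) (hβ₁ : β < 1) (hc : 1 < c) (hs : 1 < s) (hg : s < g)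
    (hsc : 0 < s * c - s - 2 * c) :
    ∃ (A : StreamAlg) (K : ℝ) (κ : ℕ),
      ∀ (tcls tcor : ℕ → ℕ) (n m : ℕ) (_ : 1 ≤ n) (_ : 2 ≤ m) (P : Set (Fin n) → Prop)
        (Scls Scor : Subroutine) (_ : SolvesClosestFair P γ (tcls n) Scls)
        (_ : SolvesFairCor P η (tcor n) Scor) (ε : ℝ) (_ : 0 < ε) (_ : ε < 1)
        (I : Fin m → Clustering n) (l : List (Triple n m)) (_ : IsStream I l),
        -- success probability and approximation ratio
        ENNReal.ofReal (1 - 1 / (m : ℝ)) ≤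
          coinMeasure {ω | ∃ F : Clustering n,
            Represents (A.final ⟨ω, Scls, Scor⟩ ⌈1 / ε⌉₊ l).out F ∧
              IsApproxConsensus P ((1 + ε) / (1 - ε) * ratio γ η α β c s g) I F} ∧
        ∀ ω : Coins,
          -- running time before and after the pass over the stream
          (((A.start ⟨ω, Scls, Scor⟩ n m ⌈1 / ε⌉₊).time : ℝ) +
              ((A.final ⟨ω, Scls, Scor⟩ ⌈1 / ε⌉₊ l).time
                - (A.after ⟨ω, Scls, Scor⟩ ⌈1 / ε⌉₊ l).time) ≤
            K * (ε⁻¹ ^ 2 * (n : ℝ) ^ 2 * Real.log m ^ 4 + tcls n * Real.log m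
              + tcor n * Real.log m ^ 3)) ∧
          -- time per triple of the stream
          (∀ (l' : List (Triple n m)) (x : Triple n m), l' ++ [x] <+: l →
            ((A.after ⟨ω, Scls, Scor⟩ ⌈1 / ε⌉₊ (l' ++ [x])).time : ℝ)
                - (A.after ⟨ω, Scls, Scor⟩ ⌈1 / ε⌉₊ l').time ≤
              K * (ε⁻¹ ^ 2 * Real.log m)) ∧
          -- number of memory words, over the whole run
          ((A.final ⟨ω, Scls, Scor⟩ ⌈1 / ε⌉₊ l).space : ℝ) ≤
            K * (ε⁻¹ ^ 2 * n * Real.log m) ∧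
          -- each memory word has `O(log (n + m + 1/ε))` bits
          (A.final ⟨ω, Scls, Scor⟩ ⌈1 / ε⌉₊ l).top ≤ (n + m + ⌈1 / ε⌉₊) ^ κ :=
  mainTheorem4_general hγ hη hα hβ₀ hβ₁ (by linarith) hs (by linarith) hsc
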